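/- Let $\mathbf F_q$ be a finite field. A prime of $\mathbf F_q[t]$ is a monic irreducible polynomial; $|f|=q^{\deg f}$; $\varphi$ and $\mu$ are the Euler and Möbius functions of $\mathbf F_q[t]$; $\mathbf A_n$ is the set of monic polynomials of degree $n$. Let $\mathcal H\subseteq\mathbf F_q[t]$ be a finite set of $k$ polynomials which is admissible, i.e. $\mathcal H+(p)\ne\mathbf F_q[t]$ for every prime $p$. For $\epsilon>0$ let $\mathcal P_\epsilon(\mathcal H)$ (which depends on $n$) be the set of $f\in\mathbf F_q[t]$ such that every prime factor of $\prod_{h\in\mathcal H}(f+h)$ has degree at least $\epsilon n$. For $w\in\mathbf N$ let $W=\prod_{p \text{ prime},\,\deg p<w}p$. We always assume that $w\ge2$, that $w>\deg h$ for all $h\in\mathcal H$, and that $w\le C\log\log n$ with a constant $C>0$; $b$ is a polynomial with $\deg b<\deg W$ and $(W,b+h)=1$ for all $h\in\mathcal H$; and $\mathbf F_{q^n}$ is $\mathbf F_q[t]/(M)$ with $M$ monic irreducible of degree $n$, its elements being identified with the polynomials of degree less than $n$. $\mathbf E$ denotes the normalized average over a finite set. For $G:\mathbf R\to\mathbf R$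 smooth with $G(0)=1$ and $G=0$ on $[1,\infty)$, put $c_G=\int_0^1G'(s)^2\,ds$ and, for $r>0$, $\Lambda_r(f)=\sum_{d\mid f,\ d\text{ monic}}\mu(d)\,G(\deg d/r)$. A family of functions $\nu:\mathbf F_{q^n}\to[0,\infty)$, indexed by the parameters $(w,n,M,b)$ above, is called $\ell$-pseudorandom if for every set $S$ of at least two polynomials of degree less than $\ell$ and all exponents $c_{j,\omega}\in\{0,1\}$, $$\mathbf E\Big[\prod_{j\in S}\ \prod_{\omega\in\{0,1\}^{S\setminus\{j\}}}\nu\Big(\sum_{i\in S\setminus\{j\}}(i-j)\,x_{i,\omega_i}\Big)^{c_{j,\omega}}\Big]=1+o(1),$$ the average being over all $x_{i,0},x_{i,1}\in\mathbf F_{q^n}$ $(i\in S)$, where $o(1)\to0$ as $w\to\infty$, uniformly in $n$, $M$, $b$ (subject to $w\le C\log\log n$ with $C$ fixed), $S$ and the exponents. **Theorem.** Let $\mathcal H$ be admissible with $k$ elements, let $\epsilon>0$ and let $\ell\ge1$. There are a function $G$ as above, a number $\rho\in(0,1)$ and a constant $c_0>0$ (depending only on $q,\mathcal H,\epsilon,\ell$)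 such that, for every $C>0$, the following holds with $r=\rho n$. The functions $$\nu(f)=\prod_{h\in\mathcal H}\frac{r\,\varphi(W)}{c_G\,|W|}\,\Lambda_r(Wf+b+h)^2$$ on $\mathbf F_{q^n}$ are $\ell$-pseudorandom. Moreover, for all $w,n,M,b$ as above, every $a\in(0,1)$ and every $$\mathcal A\subseteq\{f\in\mathcal P_\epsilon(\mathcal H)\cap\mathbf A_n: f\equiv b \bmod W\}\quad\text{with}\quad |\mathcal A|\ \ge\ a\,\frac{|W|^{k-1}}{\varphi(W)^k}\,\frac{|\mathbf A_n|}{n^k},$$ there is a function $\phi:\mathbf F_{q^n}\to[0,\infty)$ such that, with $\delta=c_0a/|W|>0$: (i) $\phi(f)=0$ unless $Wf+b\in\mathcal A$; (ii) $\phi(f)\le\nu(f)$ for all $f\in\mathbf F_{q^n}$; (iii) $\mathbf E_{f\in\mathbf F_{q^n}}\phi(f)\ge\delta$; (iv) $\|\phi\|_\infty\le n^k$. -/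

import Mathlib

open Polynomial
open scoped ContDiff Pointwise

namespace PolyTranslates

noncomputable section

section Arithmetic

variable {F : Type*} [Field F] [Fintype F]

/-- A prime of `F[X]` is a monic irreducible polynomial. -/
def IsPrimePoly (p : F[X]) : Prop := p.Monic ∧ Irreducible p

/-- The norm `|f| = q ^ deg f` (used for nonzero `f` only). -/
def polyNorm (f : F[X]) : ℝ := (Fintype.card F : ℝ) ^ f.natDegree

/-- Euler's totient function: the number of units modulo `f`. -/
def polyTotient (f : F[X]) : ℕ := Nat.card (F[X] ⧸ Ideal.span {f})ˣ

open Classical in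
/-- The Möbius function on `F[X]`. -/
def polyMoebius (d : F[X]) : ℝ :=
  if Squarefree d then (-1) ^ (UniqueFactorizationMonoid.factors d).card else 0

/-- `H` is admissible if `H + (p) ≠ F[X]` for every prime `p`. -/
def Admissible (H : Finset F[X]) : Prop :=
  ∀ p : F[X], IsPrimePoly p →
    (H : Set F[X]) + ((Ideal.span {p} : Ideal F[X]) : Set F[X]) ≠ Set.univ

variable (F) in
/-- `W`, the product of all primes of degree less than `w`. -/
def primeProduct (w : ℕ) : F[X] :=
  ∏ᶠ p ∈ {p : F[X] | IsPrimePoly p ∧ p.natDegree < w}, p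

variable (F) in
/-- Monic polynomials of degree `n`. -/
def monicDeg (n : ℕ) : Set F[X] := {f | f.Monic ∧ f.natDegree = n}

/-- Almost-prime translates of `H`: the polynomials `f` such that every prime factor of
`∏ (f + h)`, `h ∈ H`, has degree at least `ε n`. -/
def almostPrimeTranslates (H : Finset F[X]) (ε : ℝ) (n : ℕ) : Set F[X] :=
  {f | ∀ p : F[X], IsPrimePoly p → p ∣ ∏ h ∈ H, (f + h) → ε * n ≤ p.natDegree}

/-- The Goldston–Yıldırım divisor sum `∑ μ(d) G(deg d / r)` over the monic divisors `d` of `f`.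
As `G` vanishes on `[1, ∞)`, only finitely many `d` contribute, also for `f = 0`. -/
def divisorSum (G : ℝ → ℝ) (r : ℝ) (f : F[X]) : ℝ :=
  ∑ᶠ d ∈ {d : F[X] | d.Monic ∧ d ∣ f}, polyMoebius d * G (d.natDegree / r)

end Arithmetic

/-- The normalized average of a real function on a finite type. -/
def mean {α : Type*} (f : α → ℝ) : ℝ := (∑ᶠ x, f x) / Nat.card α

theorem mean_eq {α : Type*} [Fintype α] (f : α → ℝ) :
    mean f = (∑ x, f x) / Fintype.card α := by
  rw [mean, finsum_eq_sum_of_fintype, Nat.card_eq_fintype_card]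

section Quotient

variable {F : Type*} [Field F] [Fintype F]

/-- The quotient by a monic polynomial of degree `n` is finite, so averages over it make sense. -/
theorem finite_adjoinRoot {M : F[X]} (hM : M.Monic) : Finite (AdjoinRoot M) :=
  have : Module.Finite F (AdjoinRoot M) := Monic.finite_adjoinRoot hM
  Module.finite_of_finite F

/-- The representative of degree less than `deg M` of a class modulo `M`. -/
def rep {M : F[X]} (hM : M.Monic) (x : AdjoinRoot M) : F[X] :=
  AdjoinRoot.modByMonicHom hM x

open Classical in
/-- The average, over all `x_{i,0}, x_{i,1}` (`i ∈ S`), of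
`∏_{j ∈ S} ∏_{e ∈ {0,1}^{S \ {j}}} ν (∑_{i ∈ S \ {j}} (i - j) x_{i, e_i}) ^ {c_{j,e}}`. -/
def linearFormsMean {M : F[X]} (ν : AdjoinRoot M → ℝ) (S : Finset F[X])
    (c : (j : S) → ({i : S // i ≠ j} → Fin 2) → Fin 2) : ℝ :=
  mean fun x : S → Fin 2 → AdjoinRoot M =>
    ∏ j : S, ∏ e : {i : S // i ≠ j} → Fin 2,
      ν (∑ i : {i : S // i ≠ j},
          AdjoinRoot.mk M ((i.1 : F[X]) - (j : F[X])) * x i.1 (e i)) ^ (c j e : ℕ)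

/-- `ν` is nonnegative and satisfies the linear forms conditions attached to the sets of
polynomials of degree less than `ℓ`, up to an error of at most `κ`. -/
def PseudorandomUpTo {M : F[X]} (ℓ : ℕ) (κ : ℝ) (ν : AdjoinRoot M → ℝ) : Prop :=
  (∀ x, 0 ≤ ν x) ∧
  ∀ S : Finset F[X], (∀ i ∈ S, i.degree < ℓ) → 2 ≤ S.card →
    ∀ c : (j : S) → ({i : S // i ≠ j} → Fin 2) → Fin 2,
      |linearFormsMean ν S c - 1| ≤ κ

/-- The measure `f ↦ r φ(W) / (c_G |W|) * Λ_r(W f + b + h) ^ 2`, with `c_G = ∫₀¹ G'(t)² dt`. -/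
def gyFactor {M : F[X]} (hM : M.Monic) (G : ℝ → ℝ) (r : ℝ) (w : ℕ) (b h : F[X])
    (x : AdjoinRoot M) : ℝ :=
  r * polyTotient (primeProduct F w) / ((∫ t in (0 : ℝ)..1, deriv G t ^ 2) * polyNorm (primeProduct F w))
    * divisorSum G r (primeProduct F w * rep hM x + b + h) ^ 2

/-- The product of the measures above over `h ∈ H`. -/
def gyMeasure {M : F[X]} (hM : M.Monic) (G : ℝ → ℝ) (r : ℝ) (w : ℕ) (b : F[X])
    (H : Finset F[X]) (x : AdjoinRoot M) : ℝ :=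
  ∏ h ∈ H, gyFactor hM G r w b h x

/-- The standing conventions on the parameters: `w` exceeds `1` and the degrees of the elements of
`H`, `w ≤ C log log n`, the field with `q ^ n` elements is `F[X] / (M)`, and `b` is the reduced
representative of a class modulo `W` with `(W, b + h) = 1` for all `h ∈ H`. -/
structure Setup (H : Finset F[X]) (C : ℝ) (w n : ℕ) (M b : F[X]) : Prop where
  two_le : 2 ≤ w
  natDegree_lt : ∀ h ∈ H, h.natDegree < w
  growth : (w : ℝ) ≤ C * Real.log (Real.log n)
  monic : M.Monic
  irreducible : Irreducible M
  natDegree_eq : M.natDegree = n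
  reduced : b.degree < (primeProduct F w).degree
  coprime : ∀ h ∈ H, IsCoprime (primeProduct F w) (b + h)

end Quotient

end

end PolyTranslates

open PolyTranslates

open PolyTranslates

/-! The theorem rests on the Goldston–Yıldırım correlation estimate, proved here without contour
integrals, by algebra in a weighted `ℓ¹` convolution algebra.

Averaging over translates by polynomials of degree less than `n - ℓ` replaces the linear forms over
the field by affine forms over `F[X]`, with no reduction modulo `M`. Expand a product of `T` squared
divisor sums. Since `G` cuts off at degree `r` and `r` is a small multiple of `n`, the Chinese
remainder theorem evaluates every term exactly (`mean_prod_divisorSum_sq`). The result is `φ(F)`,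
where `F` is the product over primes `p` with `w ≤ deg p < n` of local factors in variables `z_i ^
deg p`, two variables `z, z'` for each form, and the functional `φ` sends a monomial to the product
of the values `G(exponent / r)`.

At each prime, the local factor agrees to first order in `1/|p|` with `∏ (1 - z/|p|)(1 - z'/|p|) /
(1 - z z'/|p|)`, powers of the variables being understood. Let `Y` be the Euler product over all
primes of degree less than `n`. Then `F ∏ Y(z z') = H ∏ Y(z) Y(z')`, where `H` is controlled by the
primes dividing `W` and a convergent error. Unique factorization gives `Y = 1 - X` modulo `X ^ n`,
and the functionals in play kill `n`-th powers of the variables.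

Now let `θ` have kernel `∑_k g(a+k) g(b+k)` in each pair, with `g(k) = G(k/r)`. Multiplying by `1 -
z z'` telescopes this kernel to `g(a) g(b)`; multiplying by `(1 - z)(1 - z')` turns it into the
autocorrelation of the differences of `g`. Hence `φ(F) = θ(F ∏ (1 - z z')) = θ(H ∏ (1 - z)(1 - z'))
= ψ(H)`, where `ψ` has that last kernel (`kernelFunctional_product_eq_corr`). It is a Riemann sum
close to the constant `c_G / r`, so `ψ(H)` is about `(c_G / r) ^ T H(1)`, and `H(1)` is about `(|W|
/ φ(W)) ^ T`. This is the normalization of `ν`. The norm of `H` is exponential in `w`, which `w ≤ C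
log log n` makes negligible against `n`.

For the second half take `φ = ν` on the `f` with `W f + b ∈ A`, and `0` elsewhere. As `ρ ≤ ε`, the
divisor sums there reduce to the term `d = 1`, so `ν` is an explicit constant and the mean is a
count. -/

/-- Finitely supported functions on an additive monoid, with convolution and the `ℓ¹` norm. -/
def FinConv (N : Type*) := AddMonoidAlgebra ℝ N

/-! ### The algebra of finitely supported functions with the `ℓ¹` norm. -/

namespace FinConv

variable {N : Type*} [AddCommMonoid N]

noncomputable instance : CommRing (FinConv N) := inferInstanceAs (CommRing (AddMonoidAlgebra ℝ N))
noncomputable instance : Algebra ℝ (FinConv N) :=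
  inferInstanceAs (Algebra ℝ (AddMonoidAlgebra ℝ N))

/-- The coefficients of an element of the convolution algebra. -/
noncomputable def coeffs : FinConv N ≃ₗ[ℝ] (N →₀ ℝ) := AddMonoidAlgebra.coeffLinearEquiv ℝ

/-- The element `c • δ_a`. -/
noncomputable def mono (a : N) (c : ℝ) : FinConv N := AddMonoidAlgebra.single a c

theorem coeffs_mono (a : N) (c : ℝ) : coeffs (mono a c) = Finsupp.single a c := rfl

theorem mono_mul_mono (a b : N) (c d : ℝ) : mono a c * mono b d = mono (a + b) (c * d) :=
  AddMonoidAlgebra.single_mul_single ..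

theorem eq_sum (f : FinConv N) : f = (coeffs f).sum mono := by
  apply coeffs.injective
  rw [map_finsuppSum]
  simp only [coeffs_mono]
  exact (Finsupp.sum_single _).symm

/-- The `ℓ¹` norm. -/
noncomputable def l1 (f : FinConv N) : ℝ := (coeffs f).sum fun _ c => |c|

theorem l1_eq_sum (f : FinConv N) (s : Finset N) (h : (coeffs f).support ⊆ s) :
    l1 f = ∑ a ∈ s, |coeffs f a| :=
  Finsupp.sum_of_support_subset _ h _ (by simp)

theorem l1_mono (a : N) (c : ℝ) : l1 (mono a c) = |c| := by
  rw [l1, coeffs_mono, Finsupp.sum_single_index]; simp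

theorem l1_add_le (f g : FinConv N) : l1 (f + g) ≤ l1 f + l1 g := by
  classical
  let s := (coeffs f).support ∪ (coeffs g).support
  rw [l1_eq_sum f s Finset.subset_union_left, l1_eq_sum g s Finset.subset_union_right,
    l1_eq_sum (f + g) s (by rw [map_add]; exact Finsupp.support_add), ← Finset.sum_add_distrib]
  refine Finset.sum_le_sum fun a _ => ?_
  rw [map_add]
  exact abs_add_le _ _

theorem l1_zero : l1 (0 : FinConv N) = 0 := by simp [l1]

theorem l1_sum_le {α : Type*} (s : Finset α) (f : α → FinConv N) :
    l1 (∑ i ∈ s, f i) ≤ ∑ i ∈ s, l1 (f i) :=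
  Finset.le_sum_of_subadditive l1 l1_zero.le l1_add_le s f

theorem l1_mul_le (f g : FinConv N) : l1 (f * g) ≤ l1 f * l1 g := by
  conv_lhs => rw [eq_sum f, eq_sum g]
  simp only [Finsupp.sum, Finset.sum_mul_sum]
  refine (l1_sum_le _ _).trans ?_
  simp only [l1, Finsupp.sum, Finset.sum_mul_sum]
  refine Finset.sum_le_sum fun a _ => (l1_sum_le _ _).trans (Finset.sum_le_sum fun b _ => ?_)
  rw [mono_mul_mono, l1_mono, abs_mul]

/-- The `ℓ¹` norm as a ring seminorm. -/
noncomputable def l1Seminorm : RingSeminorm (FinConv N) where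
  toFun := l1
  map_zero' := l1_zero
  add_le' := l1_add_le
  mul_le' := l1_mul_le
  neg' f := by simp [l1, Finsupp.sum]

noncomputable instance : SeminormedCommRing (FinConv N) :=
  { l1Seminorm.toSeminormedRing with mul_comm := mul_comm }

theorem norm_def (f : FinConv N) : ‖f‖ = l1 f := rfl

noncomputable instance : NormedAlgebra ℝ (FinConv N) where
  norm_smul_le c f := by
    rw [norm_def, norm_def, l1_eq_sum (c • f) (coeffs f).support
      (by rw [map_smul]; exact Finsupp.support_smul), l1_eq_sum f _ subset_rfl, Finset.mul_sum]
    simp [abs_mul]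

/-- The pairing with a bounded function, as a continuous linear functional. -/
noncomputable def pairing (φ : N → ℝ) (C : ℝ) (h : ∀ a, |φ a| ≤ C) : FinConv N →L[ℝ] ℝ :=
  LinearMap.mkContinuous (Finsupp.linearCombination ℝ φ ∘ₗ coeffs.toLinearMap) C fun f => by
    rw [norm_def, l1, LinearMap.comp_apply, Finsupp.linearCombination_apply, Finsupp.sum,
      Finsupp.sum, Finset.mul_sum]
    refine (norm_sum_le _ _).trans (Finset.sum_le_sum fun a _ => ?_)
    rw [norm_smul, mul_comm, Real.norm_eq_abs, Real.norm_eq_abs]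
    exact mul_le_mul_of_nonneg_right (h a) (abs_nonneg _)

theorem pairing_mono (φ : N → ℝ) (C : ℝ) (h : ∀ a, |φ a| ≤ C) (a : N) (c : ℝ) :
    pairing φ C h (mono a c) = c * φ a := by
  change Finsupp.linearCombination ℝ φ (coeffs (mono a c)) = _
  rw [coeffs_mono, Finsupp.linearCombination_single, smul_eq_mul]

end FinConv

/-- The convolution algebra `ℓ¹(N)`. -/
abbrev ConvAlg (N : Type*) [AddCommMonoid N] := UniformSpace.Completion (FinConv N)

/-! ### The completed convolution algebra and its functionals. -/

namespace ConvAlg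

variable {N : Type*} [AddCommMonoid N]

/-- The unit mass at `a`. -/
noncomputable def δ (a : N) : ConvAlg N := ((FinConv.mono a 1 : FinConv N) : ConvAlg N)

theorem δ_zero : δ (0 : N) = 1 := rfl

theorem δ_add (a b : N) : δ (a + b) = δ a * δ b := by
  rw [δ, δ, δ, ← UniformSpace.Completion.coe_mul, FinConv.mono_mul_mono, mul_one]

theorem norm_δ (a : N) : ‖δ a‖ = 1 := by
  rw [δ, UniformSpace.Completion.norm_coe, FinConv.norm_def, FinConv.l1_mono, abs_one]

instance : NormOneClass (ConvAlg N) := ⟨by rw [← δ_zero, norm_δ]⟩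

/-- The span of the unit masses is dense, so identities between continuous functionals need only be
checked on monomials. -/
theorem hom_ext {f g : ConvAlg N →L[ℝ] ℝ} (h : ∀ a, f (δ a) = g (δ a)) : f = g := by
  ext x
  induction x using UniformSpace.Completion.induction_on with
  | hp => exact isClosed_eq f.continuous g.continuous
  | ih x =>
    have key : ∀ (a : N) (c : ℝ), ((FinConv.mono a c : FinConv N) : ConvAlg N) = c • δ a := by
      intro a c
      rw [δ, ← UniformSpace.Completion.coe_smul]
      congr 1
      apply FinConv.coeffs.injective
      rw [map_smul, FinConv.coeffs_mono, FinConv.coeffs_mono]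
      simp
    rw [FinConv.eq_sum x, Finsupp.sum]
    have : ((∑ a ∈ (FinConv.coeffs x).support, FinConv.mono a (FinConv.coeffs x a) : FinConv N) :
        ConvAlg N) = ∑ a ∈ (FinConv.coeffs x).support, (FinConv.coeffs x a) • δ a := by
      rw [← UniformSpace.Completion.coe_toComplL (𝕜 := ℝ), map_sum]
      exact Finset.sum_congr rfl fun a _ => key a _
    rw [this, map_sum, map_sum]
    simp [h]

/-- The pairing with a bounded function, as a continuous linear functional. -/
theorem exists_pairing (φ : N → ℝ) (C : ℝ) (h : ∀ a, |φ a| ≤ C) :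
    ∃ f : ConvAlg N →L[ℝ] ℝ, (∀ a, f (δ a) = φ a) ∧ ∀ x, |f x| ≤ C * ‖x‖ := by
  let g := FinConv.pairing φ C h
  let f : ConvAlg N →L[ℝ] ℝ := g.extend UniformSpace.Completion.toComplL
  have hf : ∀ x : FinConv N, f x = g x := fun x =>
    ContinuousLinearMap.extend_eq _ (UniformSpace.Completion.denseRange_coe)
      (UniformSpace.Completion.isUniformInducing_coe _) x
  refine ⟨f, fun a => by rw [δ, hf, FinConv.pairing_mono, one_mul], fun x => ?_⟩
  induction x using UniformSpace.Completion.induction_on with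
  | hp => exact isClosed_le (by fun_prop) (by fun_prop)
  | ih x =>
    rw [hf, UniformSpace.Completion.norm_coe]
    refine (g.le_opNorm x).trans (mul_le_mul_of_nonneg_right ?_ (norm_nonneg _))
    exact LinearMap.mkContinuous_norm_le _ ((abs_nonneg _).trans (h 0)) _

/-- The functional attached to a bounded function. -/
noncomputable def pair (φ : N → ℝ) {C : ℝ} (h : ∀ a, |φ a| ≤ C) : ConvAlg N →L[ℝ] ℝ :=
  (exists_pairing φ C h).choose

theorem pair_δ (φ : N → ℝ) {C : ℝ} (h : ∀ a, |φ a| ≤ C) (a : N) : pair φ h (δ a) = φ a :=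
  (exists_pairing φ C h).choose_spec.1 a

theorem abs_pair_le (φ : N → ℝ) {C : ℝ} (h : ∀ a, |φ a| ≤ C) (x : ConvAlg N) :
    |pair φ h x| ≤ C * ‖x‖ :=
  (exists_pairing φ C h).choose_spec.2 x

/-- Functionals that agree after multiplication by fixed elements on unit masses agree. -/
theorem pair_mul_eq {f g : ConvAlg N →L[ℝ] ℝ} (u v : ConvAlg N)
    (h : ∀ a, f (δ a * u) = g (δ a * v)) (x : ConvAlg N) : f (x * u) = g (x * v) := by
  have := hom_ext (f := f.comp ((ContinuousLinearMap.mul ℝ (ConvAlg N)).flip u))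
    (g := g.comp ((ContinuousLinearMap.mul ℝ (ConvAlg N)).flip v)) (by simpa [mul_comm] using h)
  simpa [mul_comm] using DFunLike.congr_fun this x

/-- The functional attached to a bounded character is multiplicative. -/
theorem pair_mul (φ : N → ℝ) {C : ℝ} (h : ∀ a, |φ a| ≤ C) (hφ : ∀ a b, φ (a + b) = φ a * φ b)
    (x y : ConvAlg N) : pair φ h (x * y) = pair φ h x * pair φ h y := by
  have h1 : ∀ a, ∀ x, pair φ h (x * δ a) = pair φ h x * φ a := fun a x => by
    have := pair_mul_eq (f := pair φ h) (g := φ a • pair φ h) (δ a) 1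
      (fun b => by simp [← δ_add, pair_δ, hφ, mul_comm]) x
    simpa [mul_comm] using this
  have := hom_ext (f := (pair φ h).comp ((ContinuousLinearMap.mul ℝ (ConvAlg N)) x))
    (g := pair φ h x • pair φ h) (fun a => by simp [h1, pair_δ])
  simpa using DFunLike.congr_fun this y

end ConvAlg

/-! ### Inverses and perturbed products in a commutative Banach algebra. -/

section BanachAlgebra

variable {R : Type*} [NormedCommRing R]

theorem exists_inverse_one_sub [NormOneClass R] [CompleteSpace R] (u : R) (hu : ‖u‖ < 1) :
    ∃ v : R, (1 - u) * v = 1 ∧ ‖v‖ ≤ (1 - ‖u‖)⁻¹ :=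
  ⟨∑' k, u ^ k, mul_neg_geom_series u hu, by simpa using tsum_geometric_le_of_norm_lt_one u hu⟩

/-- The expanded product has `2 ^ s.card - 1` nonconstant terms, each of norm at most `η` because `η
≤ 1`. -/
theorem norm_prod_one_add_sub_one_le_two_pow {α : Type*} (s : Finset α) (u : α → R) {η : ℝ}
    (hη : η ≤ 1) (hu : ∀ i ∈ s, ‖u i‖ ≤ η) :
    ‖∏ i ∈ s, (1 + u i) - 1‖ ≤ (2 ^ s.card - 1) * η := by
  classical
  induction s using Finset.induction_on with
  | empty => simp
  | insert a s ha ih =>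
    rw [Finset.prod_insert ha, Finset.card_insert_of_notMem ha]
    have h1 := ih fun i hi => hu i (Finset.mem_insert_of_mem hi)
    have h2 := hu a (Finset.mem_insert_self a s)
    have h3 : ‖u a * (∏ i ∈ s, (1 + u i) - 1)‖ ≤ 1 * ((2 ^ s.card - 1) * η) :=
      (norm_mul_le _ _).trans (mul_le_mul (h2.trans hη) h1 (norm_nonneg _) zero_le_one)
    calc ‖(1 + u a) * ∏ i ∈ s, (1 + u i) - 1‖
        = ‖(∏ i ∈ s, (1 + u i) - 1) + u a * (∏ i ∈ s, (1 + u i) - 1) + u a‖ := by congr 1; ring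
      _ ≤ (2 ^ s.card - 1) * η + 1 * ((2 ^ s.card - 1) * η) + η :=
          norm_add₃_le.trans (by gcongr)
      _ = _ := by ring

/-- Every term of degree at least two in the expansion is at most `η ^ 2`. This isolates the first
order part, which will cancel in `localFactor_compare`. -/
theorem norm_prod_one_add_sub_sum_le {α : Type*} (s : Finset α) (u : α → R) {η : ℝ}
    (hη0 : 0 ≤ η) (hη : η ≤ 1) (hu : ∀ i ∈ s, ‖u i‖ ≤ η) :
    ‖∏ i ∈ s, (1 + u i) - 1 - ∑ i ∈ s, u i‖ ≤ 2 ^ s.card * η ^ 2 := by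
  classical
  induction s using Finset.induction_on with
  | empty => simp [sq_nonneg]
  | insert a s ha ih =>
    rw [Finset.prod_insert ha, Finset.card_insert_of_notMem ha, Finset.sum_insert ha]
    have h1 := ih fun i hi => hu i (Finset.mem_insert_of_mem hi)
    have h2 := hu a (Finset.mem_insert_self a s)
    have h3 := norm_prod_one_add_sub_one_le_two_pow s u hη
      fun i hi => hu i (Finset.mem_insert_of_mem hi)
    have h4 : ‖u a * (∏ i ∈ s, (1 + u i) - 1)‖ ≤ η * ((2 ^ s.card - 1) * η) :=
      (norm_mul_le _ _).trans (mul_le_mul h2 h3 (norm_nonneg _) hη0)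
    calc ‖(1 + u a) * ∏ i ∈ s, (1 + u i) - 1 - (u a + ∑ i ∈ s, u i)‖
        = ‖(∏ i ∈ s, (1 + u i) - 1 - ∑ i ∈ s, u i) + u a * (∏ i ∈ s, (1 + u i) - 1)‖ := by
          congr 1; ring
      _ ≤ 2 ^ s.card * η ^ 2 + η * ((2 ^ s.card - 1) * η) := norm_add_le_of_le h1 h4
      _ ≤ _ := by rw [pow_succ (2 : ℝ) s.card]; linarith [mul_nonneg hη0 hη0, show η * ((2 ^ s.card - 1) * η) = 2 ^ s.card * η ^ 2 - η * η by ring]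

theorem norm_finset_prod_le_exp [NormOneClass R] {α : Type*} (s : Finset α) (u : α → R) (b : α → ℝ)
    (h : ∀ i ∈ s, ‖u i‖ ≤ Real.exp (b i)) : ‖∏ i ∈ s, u i‖ ≤ Real.exp (∑ i ∈ s, b i) := by
  rw [Real.exp_sum]
  exact (Finset.norm_prod_le _ _).trans (Finset.prod_le_prod (fun _ _ => norm_nonneg _) h)

/-- The range `u ≤ 3 / 4` is what a prime of degree one over the field with two elements requires,
with variables of norm up to `3 / 2`; on it `(1 - u)⁻¹ ≤ 1 + 4 u`. -/
theorem inv_one_sub_le_exp {u : ℝ} (h0 : 0 ≤ u) (h1 : u ≤ 3 / 4) :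
    (1 - u)⁻¹ ≤ Real.exp (4 * u) := by
  have h2 : (1 - u)⁻¹ ≤ 1 + 4 * u := by
    rw [inv_le_iff_one_le_mul₀ (by linarith)]; nlinarith
  linarith [Real.add_one_le_exp (4 * u)]

end BanachAlgebra

/-! ### First order comparison of a single Euler factor. -/

section LocalFactor

variable {R : Type*} [NormedCommRing R] [NormOneClass R] [NormedAlgebra ℝ R]
variable {J : Type*} [Fintype J] [DecidableEq J]

/-- The Euler factor `∑ (-1)^|B| α(B) ∏_{i ∈ B} x_i` over sets `B` of variables. -/
def localFactor {ι : Type*} [Fintype ι] (α : Finset ι → ℝ) (x : ι → R) : R :=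
  ∑ B : Finset ι, ((-1) ^ B.card * α B) • ∏ i ∈ B, x i

/-- The conditions on the local densities at a prime of norm `1 / y`. -/
structure LocalDensity (y : ℝ) (α : Finset (J × Bool) → ℝ) : Prop where
  empty : α ∅ = 1
  single : ∀ B : Finset (J × Bool), B.Nonempty → (∃ t, ∀ i ∈ B, i.1 = t) → α B = y
  multi : ∀ B : Finset (J × Bool), B.Nonempty → (¬ ∃ t, ∀ i ∈ B, i.1 = t) → |α B| ≤ y ^ 2

/-- Sets `B` over one index `t` are `{false}`, `{true}` or both, with density exactly `y`; they
produce the linear part. There are at most `4 ^ T` other sets, `T` being the number of indices, each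
of density at most `y ^ 2` and with at most `2 T` variables. -/
theorem localFactor_linear_part (y : ℝ) (α : Finset (J × Bool) → ℝ) (hα : LocalDensity y α)
    (x : J × Bool → R) {s : ℝ} (hs : 1 ≤ s) (hx : ∀ i, ‖x i‖ ≤ s) :
    ‖localFactor α x - 1 + y • ∑ t, (x (t, false) + x (t, true) - x (t, false) * x (t, true))‖
      ≤ 4 ^ Fintype.card J * y ^ 2 * s ^ (2 * Fintype.card J) := by
  classical
  have hbound : ∀ B : Finset (J × Bool), B.Nonempty → (¬ ∃ t, ∀ i ∈ B, i.1 = t) →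
      ‖((-1) ^ B.card * α B) • ∏ i ∈ B, x i‖ ≤ y ^ 2 * s ^ (2 * Fintype.card J) := by
    intro B hne hB
    rw [norm_smul]
    have h1 : ‖(-1) ^ B.card * α B‖ ≤ y ^ 2 := by simpa using hα.multi B hne hB
    have h2 : ‖∏ i ∈ B, x i‖ ≤ s ^ (2 * Fintype.card J) := by
      refine (Finset.norm_prod_le _ _).trans ?_
      refine (Finset.prod_le_prod (fun _ _ => norm_nonneg _) fun i _ => hx i).trans ?_
      rw [Finset.prod_const]
      refine pow_le_pow_right₀ hs ((Finset.card_le_univ B).trans_eq ?_)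
      simp [Fintype.card_prod, mul_comm]
    exact mul_le_mul h1 h2 (norm_nonneg _) (sq_nonneg y)
  have hmain : ∑ B ∈ (Finset.univ : Finset (Finset (J × Bool))) with
        (¬ B = ∅ ∧ ∃ t, ∀ i ∈ B, i.1 = t), ((-1) ^ B.card * α B) • ∏ i ∈ B, x i
      = - (y • ∑ t, (x (t, false) + x (t, true) - x (t, false) * x (t, true))) := by
    have : ∀ t : J, ∑ C ∈ (Finset.univ : Finset (Finset Bool)).erase ∅,
        ((-1) ^ C.card * y) • ∏ b ∈ C, x (t, b)
        = - (y • (x (t, false) + x (t, true) - x (t, false) * x (t, true))) := by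
      intro t
      have hu : (Finset.univ : Finset (Finset Bool)).erase ∅ = {{false}, {true}, {false, true}} := by
        decide
      rw [hu, Finset.sum_insert (by decide), Finset.sum_insert (by decide), Finset.sum_singleton,
        Finset.prod_pair (by decide)]
      simp [smul_sub, smul_add]
      abel
    rw [Finset.smul_sum, ← Finset.sum_neg_distrib, Finset.sum_congr rfl fun t _ => (this t).symm,
      Finset.sum_sigma']
    symm
    refine Finset.sum_bij (fun a _ => {a.1} ×ˢ a.2) ?_ ?_ ?_ ?_
    · rintro ⟨t, C⟩ h
      simp only [Finset.mem_sigma, Finset.mem_univ, Finset.mem_erase, true_and, and_true] at h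
      simp only [Finset.mem_filter, Finset.mem_univ, true_and, Finset.product_eq_empty]
      exact ⟨by simpa using h, t, fun i hi => by simpa using (Finset.mem_product.1 hi).1⟩
    · rintro ⟨t, C⟩ h ⟨t', C'⟩ h' heq
      simp only [Finset.mem_sigma, Finset.mem_univ, Finset.mem_erase, true_and, and_true] at h h'
      obtain ⟨b, hb⟩ := Finset.nonempty_iff_ne_empty.2 h
      have hmem : ∀ u c, (u = t ∧ c ∈ C) ↔ (u = t' ∧ c ∈ C') := by
        intro u c
        have := iff_of_eq (congrArg ((u, c) ∈ ·) heq)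
        simpa only [Finset.mem_product, Finset.mem_singleton] using this
      have ht : t = t' := ((hmem t b).1 ⟨rfl, hb⟩).1
      subst ht
      have hC : C = C' := by
        ext c
        simpa using hmem t c
      rw [hC]
    · intro B hB
      simp only [Finset.mem_filter, Finset.mem_univ, true_and] at hB
      obtain ⟨h0, t, ht⟩ := hB
      have hB' : {t} ×ˢ (Finset.univ.filter fun b => (t, b) ∈ B) = B := by
        ext ⟨u, c⟩
        simp only [Finset.mem_product, Finset.mem_filter, Finset.mem_univ, true_and,
          Finset.mem_singleton]
        constructor
        · rintro ⟨rfl, h⟩; exact h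
        · intro h; have := ht _ h; simp only at this; subst this; exact ⟨rfl, h⟩
      refine ⟨⟨t, Finset.univ.filter fun b => (t, b) ∈ B⟩, ?_, hB'⟩
      simp only [Finset.mem_sigma, Finset.mem_univ, Finset.mem_erase, true_and, and_true]
      intro h
      rw [h] at hB'
      exact h0 (by rw [← hB']; simp)
    · rintro ⟨t, C⟩ h
      simp only [Finset.mem_sigma, Finset.mem_univ, Finset.mem_erase, true_and, and_true] at h
      rw [Finset.card_product, Finset.prod_product, hα.single _ (by
        simpa [Finset.nonempty_product] using Finset.nonempty_iff_ne_empty.2 h)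
          ⟨t, fun i hi => by simpa using (Finset.mem_product.1 hi).1⟩]
      simp
  have hsplit : localFactor α x - 1
      + y • ∑ t, (x (t, false) + x (t, true) - x (t, false) * x (t, true))
      = ∑ B ∈ (Finset.univ : Finset (Finset (J × Bool))) with
        (¬ B = ∅ ∧ ¬ ∃ t, ∀ i ∈ B, i.1 = t), ((-1) ^ B.card * α B) • ∏ i ∈ B, x i := by
    rw [localFactor, ← Finset.sum_filter_add_sum_filter_not Finset.univ (fun B => B = ∅),
      ← Finset.sum_filter_add_sum_filter_not (Finset.univ.filter fun B => ¬ B = ∅)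
        (fun B => ∃ t, ∀ i ∈ B, i.1 = t), Finset.filter_filter, Finset.filter_filter, hmain]
    have : (Finset.univ : Finset (Finset (J × Bool))).filter (fun B => B = ∅) = {∅} := by
      ext; simp
    rw [this, Finset.sum_singleton]
    simp [hα.empty]
  rw [hsplit]
  refine (norm_sum_le_of_le _ fun B hB => hbound B
    (Finset.nonempty_iff_ne_empty.2 (Finset.mem_filter.1 hB).2.1) (Finset.mem_filter.1 hB).2.2).trans ?_
  rw [Finset.sum_const, nsmul_eq_mul, mul_assoc]
  refine mul_le_mul_of_nonneg_right ?_ (by positivity)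
  calc ((_ : ℕ) : ℝ) ≤ (Fintype.card (Finset (J × Bool)) : ℕ) := by
        exact_mod_cast Finset.card_le_univ _
    _ = 4 ^ Fintype.card J := by
        rw [Fintype.card_finset, Fintype.card_prod, Fintype.card_bool, mul_comm, pow_mul]; norm_num

/-- The constant in the bound for a single Euler factor. -/
def localConst (T : ℕ) : ℝ := 3 * T + 4 ^ T + 1

/-- The constant in the second order bound for a single Euler factor. -/
def localConst' (T : ℕ) : ℝ := 2 ^ (3 * T + 1) * localConst T ^ 2 + 4 ^ T + 4 * T

/-- The first order terms are `-y (x + x' - x x')` from the local factor, `-y x x'` from `1 - y x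
x'`, and `y x + y x'` from inverting `1 - y x` and `1 - y x'`. They cancel, so `E - 1` is of order
`y ^ 2` and summable over primes. -/
theorem localFactor_compare [CompleteSpace R] {y : ℝ} {α : Finset (J × Bool) → ℝ}
    (hα : LocalDensity y α) (hy : 0 ≤ y) (x : J × Bool → R) {s : ℝ} (hs : 1 ≤ s)
    (hx : ∀ i, ‖x i‖ ≤ s) (hys : y * s ≤ 1 / 2)
    (hK : localConst (Fintype.card J) * (y * s ^ (2 * Fintype.card J + 2)) ≤ 1) :
    ∃ E : R, localFactor α x * ∏ t, (1 - y • (x (t, false) * x (t, true)))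
        = (∏ i, (1 - y • x i)) * E ∧
      ‖E - 1‖ ≤ localConst' (Fintype.card J) * (y ^ 2 * s ^ (4 * Fintype.card J + 4)) := by
  classical
  set T := Fintype.card J with hT
  have hs0 : 0 ≤ s := zero_le_one.trans hs
  have hsle : ∀ {a b : ℕ}, a ≤ b → s ^ a ≤ s ^ b := fun h => pow_le_pow_right₀ hs h
  have hy1 : y ≤ 1 := by nlinarith
  have hyx : ∀ i, ‖y • x i‖ ≤ y * s := fun i => by
    rw [norm_smul, Real.norm_of_nonneg hy]; exact mul_le_mul_of_nonneg_left (hx i) hy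
  have hinv : ∀ i, ∃ v : R, (1 - y • x i) * v = 1 ∧ ‖v‖ ≤ 2 := by
    intro i
    obtain ⟨v, hv, hv'⟩ := exists_inverse_one_sub (y • x i) ((hyx i).trans_lt (by linarith))
    refine ⟨v, hv, hv'.trans ?_⟩
    rw [inv_le_comm₀ (by linarith [hyx i]) two_pos]
    linarith [hyx i]
  choose v hv hv2 using hinv
  have hv1 : ∀ i, v i - 1 = y • x i * v i := fun i => by linear_combination (hv i)
  have hvn : ∀ i, ‖v i - 1‖ ≤ y * s * 2 := fun i => by
    rw [hv1]
    exact (norm_mul_le _ _).trans (mul_le_mul (hyx i) (hv2 i) (norm_nonneg _) (by positivity))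
  have hvn2 : ∀ i, ‖v i - 1 - y • x i‖ ≤ y * s * (y * s * 2) := fun i => by
    have : v i - 1 - y • x i = y • x i * (v i - 1) := by rw [mul_sub, hv1, mul_one]
    rw [this]
    exact (norm_mul_le _ _).trans (mul_le_mul (hyx i) (hvn i) (norm_nonneg _) (by positivity))
  have hxx : ∀ t, ‖x (t, false) * x (t, true)‖ ≤ s ^ 2 := fun t => by
    rw [pow_two]
    exact (norm_mul_le _ _).trans (mul_le_mul (hx _) (hx _) (norm_nonneg _) hs0)
  have hyxx : ∀ t, ‖y • (x (t, false) * x (t, true))‖ ≤ y * s ^ 2 := fun t => by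
    rw [norm_smul, Real.norm_of_nonneg hy]; exact mul_le_mul_of_nonneg_left (hxx t) hy
  have hF := localFactor_linear_part y α hα x hs hx
  rw [← hT] at hF
  set F := localFactor α x with hFdef
  set η := localConst T * (y * s ^ (2 * T + 2)) with hη
  have hC1 : (2 : ℝ) ≤ localConst T := by
    have : (1 : ℝ) ≤ 4 ^ T := one_le_pow₀ (by norm_num)
    rw [localConst]; linarith [Nat.cast_nonneg (α := ℝ) T]
  have hF1 : ‖F - 1‖ ≤ η := by
    have h1 : ‖y • ∑ t, (x (t, false) + x (t, true) - x (t, false) * x (t, true))‖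
        ≤ y * (T * (3 * s ^ 2)) := by
      rw [norm_smul, Real.norm_of_nonneg hy]
      refine mul_le_mul_of_nonneg_left ?_ hy
      refine (norm_sum_le_of_le (f := fun t => (x (t, false) + x (t, true)
        - x (t, false) * x (t, true))) (n := fun _ => 3 * s ^ 2) _ fun t _ => ?_).trans ?_
      · have := norm_sub_le (x (t, false) + x (t, true)) (x (t, false) * x (t, true))
        have := norm_add_le (x (t, false)) (x (t, true))
        nlinarith [hx (t, false), hx (t, true), hxx t]
      · simp [hT]
    have h2 : F - 1 = (F - 1
        + y • ∑ t, (x (t, false) + x (t, true) - x (t, false) * x (t, true)))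
        - y • ∑ t, (x (t, false) + x (t, true) - x (t, false) * x (t, true)) := by ring
    rw [h2]
    refine (norm_sub_le _ _).trans ((add_le_add hF h1).trans ?_)
    have e1 : (4 : ℝ) ^ T * y ^ 2 * s ^ (2 * T) ≤ 4 ^ T * (y * s ^ (2 * T + 2)) := by
      rw [mul_assoc]
      refine mul_le_mul_of_nonneg_left ?_ (by positivity)
      exact mul_le_mul (by nlinarith) (hsle (by lia)) (by positivity) hy
    have e2 : y * (T * (3 * s ^ 2)) ≤ (3 * T) * (y * s ^ (2 * T + 2)) := by
      have := mul_le_mul_of_nonneg_left (hsle (show 2 ≤ 2 * T + 2 by lia))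
        (show 0 ≤ 3 * (T : ℝ) * y by positivity)
      linarith
    have e3 : 0 ≤ y * s ^ (2 * T + 2) := by positivity
    rw [hη, localConst]; linarith
  have hη0 : 0 ≤ η := (norm_nonneg _).trans hF1
  have h2η : 2 * (y * s ^ 2) ≤ η := by
    rw [hη]
    exact mul_le_mul hC1 (mul_le_mul_of_nonneg_left (hsle (by lia)) hy) (by positivity)
      (by linarith)
  have hss : s ≤ s ^ 2 := by nlinarith
  -- `E` is a product of `1 + T + 2 T` factors `1 + u k`: the local factor, the factors `1 - y x
  -- x'`, and the inverses `v i` of `1 - y x i`.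
  let u : Unit ⊕ (J ⊕ (J × Bool)) → R := Sum.elim (fun _ => F - 1)
    (Sum.elim (fun t => -(y • (x (t, false) * x (t, true)))) (fun i => v i - 1))
  have hu : ∀ k ∈ Finset.univ, ‖u k‖ ≤ η := by
    rintro (k | t | i) -
    · exact hF1
    · simp only [u, Sum.elim_inl, Sum.elim_inr, norm_neg]
      have := hyxx t
      have : 0 ≤ y * s ^ 2 := by positivity
      linarith
    · simp only [u, Sum.elim_inr]
      refine (hvn i).trans (le_trans ?_ h2η)
      nlinarith [mul_le_mul_of_nonneg_left hss hy]
  have hprod : ∏ k, (1 + u k)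
      = F * ((∏ t, (1 - y • (x (t, false) * x (t, true)))) * ∏ i, v i) := by
    rw [Fintype.prod_sum_type, Fintype.prod_sum_type]
    simp [u, sub_eq_add_neg]
  -- The cancellation: only the second order remainders of the local factor and of the inverses are
  -- left.
  have hsum : ∑ k, u k = (F - 1
        + y • ∑ t, (x (t, false) + x (t, true) - x (t, false) * x (t, true)))
        + ∑ i, (v i - 1 - y • x i) := by
    rw [Fintype.sum_sum_type, Fintype.sum_sum_type]
    simp only [u, Sum.elim_inl, Sum.elim_inr, Finset.univ_unique, Finset.sum_singleton]
    rw [Fintype.sum_prod_type, Fintype.sum_prod_type, Finset.smul_sum, add_assoc,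
      ← Finset.sum_add_distrib, ← Finset.sum_add_distrib]
    congr 1
    refine Finset.sum_congr rfl fun t _ => ?_
    simp only [Fintype.sum_bool, smul_add, smul_sub]
    ring
  refine ⟨∏ k, (1 + u k), ?_, ?_⟩
  · rw [hprod]
    have : (∏ i, (1 - y • x i)) * ∏ i, v i = 1 := by
      rw [← Finset.prod_mul_distrib]; exact Finset.prod_eq_one fun i _ => hv i
    linear_combination -(F * ∏ t, (1 - y • (x (t, false) * x (t, true)))) * this
  · have h1 := norm_prod_one_add_sub_sum_le Finset.univ u hη0 hK hu
    have h2 : ‖∑ k, u k‖ ≤ 4 ^ T * y ^ 2 * s ^ (2 * T) + T * 2 * (y * s * (y * s * 2)) := by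
      rw [hsum]
      refine norm_add_le_of_le hF ((norm_sum_le_of_le _ fun i _ => hvn2 i).trans ?_)
      simp [hT]
    have hcard : (Finset.univ : Finset (Unit ⊕ (J ⊕ (J × Bool)))).card = 3 * T + 1 := by
      simp [hT]; ring
    rw [hcard] at h1
    have h3 : ∏ k, (1 + u k) - 1 = (∏ k, (1 + u k) - 1 - ∑ k, u k) + ∑ k, u k := by ring
    rw [h3]
    refine (norm_add_le_of_le h1 h2).trans ?_
    have e1 : η ^ 2 = localConst T ^ 2 * (y ^ 2 * s ^ (4 * T + 4)) := by
      rw [hη]; ring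
    have e2 : (4 : ℝ) ^ T * y ^ 2 * s ^ (2 * T) ≤ 4 ^ T * (y ^ 2 * s ^ (4 * T + 4)) := by
      rw [mul_assoc]
      exact mul_le_mul_of_nonneg_left (mul_le_mul_of_nonneg_left (hsle (by lia)) (by positivity))
        (by positivity)
    have e3 : T * 2 * (y * s * (y * s * 2)) ≤ 4 * T * (y ^ 2 * s ^ (4 * T + 4)) := by
      have := mul_le_mul_of_nonneg_left (hsle (show 2 ≤ 4 * T + 4 by lia))
        (show 0 ≤ 4 * (T : ℝ) * y ^ 2 by positivity)
      linarith
    rw [e1, localConst']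
    linarith

end LocalFactor

/-! ### Comparison of finite Euler products. -/

section EulerProduct

variable {R : Type*} [NormedCommRing R] [NormOneClass R] [NormedAlgebra ℝ R]
variable {Q : Type*} (y : Q → ℝ) (m : Q → ℕ)

/-- The finite Euler product `∏ (1 - y_p x ^ m_p)`. -/
def eulerProd {R : Type*} [CommRing R] [Algebra ℝ R] (s : Finset Q) (x : R) : R :=
  ∏ p ∈ s, (1 - y p • x ^ m p)

variable {y m}

/-- Each factor is inverted by a geometric series. The exponent `12` is `4 * 3`, from
`inv_one_sub_le_exp` and the bound `σ ^ m p ≤ 3`. -/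
theorem exists_inverse_eulerProd [CompleteSpace R] (s : Finset Q) (x : R) {σ A : ℝ}
    (hy : ∀ p ∈ s, 0 ≤ y p) (hσ : ‖x‖ ≤ σ) (h1 : ∀ p ∈ s, y p * σ ^ m p ≤ 3 / 4)
    (h2 : ∀ p ∈ s, σ ^ m p ≤ 3) (h3 : ∑ p ∈ s, y p ≤ A) :
    ∃ v : R, eulerProd y m s x * v = 1 ∧ ‖v‖ ≤ Real.exp (12 * A) := by
  classical
  have hn : ∀ p ∈ s, ‖y p • x ^ m p‖ ≤ y p * σ ^ m p := fun p hp => by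
    rw [norm_smul, Real.norm_of_nonneg (hy p hp)]
    exact mul_le_mul_of_nonneg_left ((norm_pow_le _ _).trans
      (pow_le_pow_left₀ (norm_nonneg _) hσ _)) (hy p hp)
  have hinv : ∀ p, ∃ v : R, p ∈ s → (1 - y p • x ^ m p) * v = 1 ∧ ‖v‖ ≤ Real.exp (12 * y p) := by
    intro p
    by_cases hp : p ∈ s
    · obtain ⟨v, hv, hv'⟩ := exists_inverse_one_sub (y p • x ^ m p)
        ((hn p hp).trans_lt (by linarith [h1 p hp]))
      refine ⟨v, fun _ => ⟨hv, hv'.trans ((inv_one_sub_le_exp (norm_nonneg _)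
        ((hn p hp).trans (h1 p hp))).trans (Real.exp_le_exp.2 ?_))⟩⟩
      nlinarith [hn p hp, mul_le_mul_of_nonneg_left (h2 p hp) (hy p hp)]
    · exact ⟨0, fun h => absurd h hp⟩
  choose v hv using hinv
  refine ⟨∏ p ∈ s, v p, ?_, ?_⟩
  · rw [eulerProd, ← Finset.prod_mul_distrib]
    exact Finset.prod_eq_one fun p hp => (hv p hp).1
  · refine (norm_finset_prod_le_exp s v (fun p => 12 * y p) fun p hp => (hv p hp).2).trans
      (Real.exp_le_exp.2 ?_)
    rw [← Finset.mul_sum]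
    linarith

/-- The argument will be a product of two variables, hence the radius `σ ^ 2` and the constant `9 =
3 ^ 2`. -/
theorem norm_eulerProd_le (s : Finset Q) (x : R) {σ A : ℝ}
    (hy : ∀ p ∈ s, 0 ≤ y p) (hσ : ‖x‖ ≤ σ ^ 2) (hσ0 : 0 ≤ σ)
    (h2 : ∀ p ∈ s, σ ^ m p ≤ 3) (h3 : ∑ p ∈ s, y p ≤ A) :
    ‖eulerProd y m s x‖ ≤ Real.exp (9 * A) := by
  refine (norm_finset_prod_le_exp s _ (fun p => 9 * y p) fun p hp => ?_).trans
      (Real.exp_le_exp.2 (by rw [← Finset.mul_sum]; linarith))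
  have h4 : ‖y p • x ^ m p‖ ≤ 9 * y p := by
    rw [norm_smul, Real.norm_of_nonneg (hy p hp), mul_comm]
    refine mul_le_mul_of_nonneg_right ((norm_pow_le _ _).trans
      ((pow_le_pow_left₀ (norm_nonneg _) hσ _).trans ?_)) (hy p hp)
    rw [← pow_mul, mul_comm, pow_mul]
    nlinarith [h2 p hp, pow_nonneg hσ0 (m p)]
  have := norm_sub_le (1 : R) (y p • x ^ m p)
  rw [norm_one] at this
  linarith [Real.add_one_le_exp (9 * y p)]

/-- The local factors run over `P` only, whereas the collapse to `1 - X` needs all of `S ∪ P`.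
Inserting the factors at `S` on both sides defines `H`, which is `E` times the ratio of the Euler
products over `S`. The first identity feeds the kernel argument; the second determines `H` when all
variables equal `1`. In the norm bound `33 = 2 * 12 + 9`. -/
theorem eulerProduct_compare [CompleteSpace R] {J : Type*} [Fintype J] [DecidableEq J]
    {S P : Finset Q} (hSP : Disjoint S P) {α : Q → Finset (J × Bool) → ℝ}
    (hα : ∀ p ∈ P, LocalDensity (y p) (α p)) (hyS : ∀ p ∈ S, 0 ≤ y p) (hyP : ∀ p ∈ P, 0 ≤ y p)
    (z : J × Bool → R) {σ A η : ℝ} (hσ : 1 ≤ σ) (hz : ∀ i, ‖z i‖ ≤ σ)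
    (hS1 : ∀ p ∈ S, y p * σ ^ m p ≤ 3 / 4) (hS2 : ∀ p ∈ S, σ ^ m p ≤ 3) (hS3 : ∑ p ∈ S, y p ≤ A)
    (hP1 : ∀ p ∈ P, y p * σ ^ m p ≤ 1 / 2)
    (hP2 : ∀ p ∈ P,
      localConst (Fintype.card J) * (y p * (σ ^ m p) ^ (2 * Fintype.card J + 2)) ≤ 1)
    (hP3 : ∑ p ∈ P, y p ^ 2 * (σ ^ m p) ^ (4 * Fintype.card J + 4) ≤ η) :
    ∃ E H : R,
      (∏ p ∈ P, localFactor (α p) (fun i => z i ^ m p)) *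
          ∏ t, eulerProd y m (S.disjUnion P hSP) (z (t, false) * z (t, true))
        = H * ∏ i, eulerProd y m (S.disjUnion P hSP) (z i) ∧
      (∏ i, eulerProd y m S (z i)) * H = (∏ t, eulerProd y m S (z (t, false) * z (t, true))) * E ∧
      ‖E - 1‖ ≤ Real.exp (localConst' (Fintype.card J) * η) - 1 ∧
      ‖H‖ ≤ Real.exp (33 * Fintype.card J * A + localConst' (Fintype.card J) * η) := by
  classical
  set T := Fintype.card J with hT
  have hσ0 : 0 ≤ σ := zero_le_one.trans hσ
  have hloc : ∀ p, ∃ E : R, p ∈ P → localFactor (α p) (fun i => z i ^ m p) *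
        ∏ t, (1 - y p • (z (t, false) ^ m p * z (t, true) ^ m p))
        = (∏ i, (1 - y p • z i ^ m p)) * E ∧
      ‖E - 1‖ ≤ localConst' T * (y p ^ 2 * (σ ^ m p) ^ (4 * T + 4)) := by
    intro p
    by_cases hp : p ∈ P
    · obtain ⟨E, hE⟩ := localFactor_compare (hα p hp) (hyP p hp) (fun i => z i ^ m p)
        (s := σ ^ m p) (one_le_pow₀ hσ) (fun i => (norm_pow_le _ _).trans
          (pow_le_pow_left₀ (norm_nonneg _) (hz i) _)) (hP1 p hp) (hP2 p hp)
      exact ⟨E, fun _ => hE⟩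
    · exact ⟨0, fun h => absurd h hp⟩
  choose e he using hloc
  have hK : 0 ≤ localConst' T := by unfold localConst'; positivity
  have hsum : ∑ p ∈ P, ‖e p - 1‖ ≤ localConst' T * η := by
    refine (Finset.sum_le_sum fun p hp => (he p hp).2).trans ?_
    rw [← Finset.mul_sum]
    exact mul_le_mul_of_nonneg_left hP3 hK
  have hE1 : ‖∏ p ∈ P, e p - 1‖ ≤ Real.exp (localConst' T * η) - 1 := by
    have := Finset.norm_prod_one_add_sub_one_le P (fun p => e p - 1)
    simp only [add_sub_cancel] at this
    exact this.trans (sub_le_sub_right (Real.exp_le_exp.2 hsum) 1)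
  have hE2 : ‖∏ p ∈ P, e p‖ ≤ Real.exp (localConst' T * η) := by
    have := norm_add_le (∏ p ∈ P, e p - 1) 1
    rw [sub_add_cancel, norm_one] at this
    linarith
  have hV : ∀ i, ∃ v : R, eulerProd y m S (z i) * v = 1 ∧ ‖v‖ ≤ Real.exp (12 * A) := fun i =>
    exists_inverse_eulerProd S (z i) hyS (hz i) hS1 hS2 hS3
  choose v hv hv' using hV
  have hVinv : (∏ i, eulerProd y m S (z i)) * ∏ i, v i = 1 := by
    rw [← Finset.prod_mul_distrib]; exact Finset.prod_eq_one fun i _ => hv i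
  have hprod : ∀ x : R, eulerProd y m (S.disjUnion P hSP) x
      = eulerProd y m S x * eulerProd y m P x := fun x => by
    rw [eulerProd, Finset.prod_disjUnion]; rfl
  refine ⟨∏ p ∈ P, e p, (∏ p ∈ P, e p) * (∏ i, v i) *
    ∏ t, eulerProd y m S (z (t, false) * z (t, true)), ?_, ?_, hE1, ?_⟩
  · have h1 : (∏ p ∈ P, localFactor (α p) (fun i => z i ^ m p)) *
          ∏ t, eulerProd y m P (z (t, false) * z (t, true))
        = (∏ i, eulerProd y m P (z i)) * ∏ p ∈ P, e p := by
      simp only [eulerProd]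
      rw [Finset.prod_comm (s := Finset.univ) (t := P), Finset.prod_comm (s := Finset.univ) (t := P),
        ← Finset.prod_mul_distrib, ← Finset.prod_mul_distrib]
      refine Finset.prod_congr rfl fun p hp => ?_
      simp only [mul_pow]
      exact (he p hp).1
    simp only [hprod, Finset.prod_mul_distrib]
    linear_combination (∏ t, eulerProd y m S (z (t, false) * z (t, true))) * h1 -
      (∏ p ∈ P, e p) * (∏ t, eulerProd y m S (z (t, false) * z (t, true))) *
        (∏ i, eulerProd y m P (z i)) * hVinv
  · linear_combination (∏ p ∈ P, e p) * (∏ t, eulerProd y m S (z (t, false) * z (t, true))) * hVinv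
  · have h1 : ‖∏ i, v i‖ ≤ Real.exp (∑ _i : J × Bool, 12 * A) :=
      norm_finset_prod_le_exp _ _ _ fun i _ => hv' i
    have h2 : ‖∏ t, eulerProd y m S (z (t, false) * z (t, true))‖
        ≤ Real.exp (∑ _t : J, 9 * A) := by
      refine norm_finset_prod_le_exp _ _ _ fun t _ =>
        norm_eulerProd_le S _ hyS ?_ hσ0 hS2 hS3
      rw [pow_two]
      exact (norm_mul_le _ _).trans (mul_le_mul (hz _) (hz _) (norm_nonneg _) hσ0)
    calc _ ≤ Real.exp (localConst' T * η) * Real.exp (∑ _i : J × Bool, 12 * A) *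
          Real.exp (∑ _t : J, 9 * A) :=
        (norm_mul_le _ _).trans (mul_le_mul ((norm_mul_le _ _).trans
          (mul_le_mul hE2 h1 (norm_nonneg _) (Real.exp_nonneg _))) h2 (norm_nonneg _)
            (by positivity))
      _ = _ := by
        rw [← Real.exp_add, ← Real.exp_add]
        congr 1
        simp [← hT]
        ring

end EulerProduct

/-! ### Functionals on monomials given by kernels on pairs of exponents. -/

namespace ConvAlg

variable {J : Type*} [Fintype J] [DecidableEq J]

/-- The generator of index `i`, scaled to have norm `σ`. -/
noncomputable def gen (σ : ℝ) (i : J × Bool) : ConvAlg (J × Bool → ℕ) := σ • δ (Pi.single i 1)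

theorem norm_gen_le {σ : ℝ} (hσ : 1 ≤ σ) (i : J × Bool) : ‖gen σ i‖ ≤ σ := by
  rw [gen, norm_smul, norm_δ, mul_one, Real.norm_of_nonneg (zero_le_one.trans hσ)]

theorem prod_gen_pow (σ : ℝ) (a : J × Bool → ℕ) :
    ∏ i, gen σ i ^ a i = σ ^ (∑ i, a i) • δ a := by
  have h1 : ∀ (i : J × Bool) (k : ℕ), gen σ i ^ k = σ ^ k • δ (Pi.single i k) := by
    intro i k
    rw [gen, _root_.smul_pow]
    congr 1
    induction k with
    | zero => simp [δ_zero]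
    | succ k ih => rw [pow_succ, ih, ← δ_add, Pi.single_add]
  have h2 : ∀ s : Finset (J × Bool), ∏ i ∈ s, δ (Pi.single i (a i))
      = δ (∑ i ∈ s, Pi.single i (a i) : J × Bool → ℕ) := by
    intro s
    induction s using Finset.induction_on with
    | empty => simp [δ_zero]
    | insert i s hi ih => rw [Finset.prod_insert hi, Finset.sum_insert hi, ih, δ_add]
  simp only [h1]
  rw [Finset.prod_smul, h2, Finset.univ_sum_single, Finset.prod_pow_eq_pow_sum]

/-- The function on monomials obtained from a kernel `φ` on pairs of exponents. -/
noncomputable def weight (σ : ℝ) (φ : ℕ → ℕ → ℝ) (a : J × Bool → ℕ) : ℝ :=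
  (σ ^ ∑ i, a i)⁻¹ * ∏ t, φ (a (t, false)) (a (t, true))

theorem abs_weight_le {σ : ℝ} (hσ : 1 ≤ σ) {φ : ℕ → ℕ → ℝ} {B : ℝ} (hφ : ∀ a b, |φ a b| ≤ B)
    (a : J × Bool → ℕ) : |weight σ φ a| ≤ B ^ Fintype.card J := by
  have h1 : (1 : ℝ) ≤ σ ^ ∑ i, a i := one_le_pow₀ hσ
  rw [weight, abs_mul, Finset.abs_prod, abs_of_nonneg (by positivity)]
  have h2 : ∏ t, |φ (a (t, false)) (a (t, true))| ≤ B ^ Fintype.card J := by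
    refine (Finset.prod_le_prod (fun _ _ => abs_nonneg _) fun t _ => hφ _ _).trans ?_
    simp
  have h3 : (σ ^ ∑ i, a i)⁻¹ ≤ 1 := inv_le_one_of_one_le₀ h1
  have h4 : 0 ≤ ∏ t, |φ (a (t, false)) (a (t, true))| := Finset.prod_nonneg fun _ _ => abs_nonneg _
  nlinarith

/-- The functional on the convolution algebra attached to a bounded kernel. -/
noncomputable def kernelFunctional {σ : ℝ} (hσ : 1 ≤ σ) {φ : ℕ → ℕ → ℝ} {B : ℝ}
    (hφ : ∀ a b, |φ a b| ≤ B) : ConvAlg (J × Bool → ℕ) →L[ℝ] ℝ :=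
  pair (weight σ φ) (abs_weight_le hσ hφ)

theorem kernelFunctional_δ {σ : ℝ} (hσ : 1 ≤ σ) {φ : ℕ → ℕ → ℝ} {B : ℝ}
    (hφ : ∀ a b, |φ a b| ≤ B) (a : J × Bool → ℕ) :
    kernelFunctional hσ hφ (δ a) = weight σ φ a := pair_δ _ _ _

theorem kernelFunctional_prod_gen {σ : ℝ} (hσ : 1 ≤ σ) {φ : ℕ → ℕ → ℝ} {B : ℝ}
    (hφ : ∀ a b, |φ a b| ≤ B) (a : J × Bool → ℕ) :
    kernelFunctional hσ hφ (∏ i, gen σ i ^ a i) = ∏ t, φ (a (t, false)) (a (t, true)) := by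
  have : σ ^ (∑ i, a i) ≠ 0 := by positivity
  rw [prod_gen_pow, map_smul, kernelFunctional_δ, weight, smul_eq_mul, mul_inv_cancel_left₀ this]

/-- Multiplication by a polynomial in a pair of generators is dual to a combination of shifts of the
kernel. On a unit mass, expanding the product over `t` gives exactly the product of the shifted
kernels, the powers of `σ` cancelling. -/
theorem kernelFunctional_mul_prod {σ : ℝ} (hσ : 1 ≤ σ) {K : Type*} [Fintype K] (c : K → ℝ)
    (a b : K → ℕ) {φ φ' : ℕ → ℕ → ℝ} {B B' : ℝ} (hφ : ∀ a b, |φ a b| ≤ B)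
    (hφ' : ∀ a b, |φ' a b| ≤ B') (h : ∀ i j, φ' i j = ∑ k, c k * φ (i + a k) (j + b k))
    (x : ConvAlg (J × Bool → ℕ)) :
    kernelFunctional hσ hφ
        (x * ∏ t, ∑ k, c k • (gen σ (t, false) ^ a k * gen σ (t, true) ^ b k))
      = kernelFunctional hσ hφ' x := by
  classical
  have hσ0 : ∀ k : ℕ, σ ^ k ≠ 0 := fun k => by positivity
  have key := pair_mul_eq (f := kernelFunctional hσ hφ) (g := kernelFunctional hσ hφ')
    (∏ t, ∑ k, c k • (gen σ (t, false) ^ a k * gen σ (t, true) ^ b k)) 1 (fun e => ?_) x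
  · rwa [mul_one] at key
  rw [mul_one, kernelFunctional_δ, Finset.prod_univ_sum, Fintype.piFinset_univ, Finset.mul_sum,
    map_sum]
  have hterm : ∀ κ : J → K, kernelFunctional hσ hφ (δ e *
      ∏ t, c (κ t) • (gen σ (t, false) ^ a (κ t) * gen σ (t, true) ^ b (κ t)))
      = (σ ^ ∑ i, e i)⁻¹ * ∏ t, c (κ t) * φ (e (t, false) + a (κ t)) (e (t, true) + b (κ t)) := by
    intro κ
    let β : J × Bool → ℕ := fun i => cond i.2 (b (κ i.1)) (a (κ i.1))
    have h1 : ∏ t, (gen σ (t, false) ^ a (κ t) * gen σ (t, true) ^ b (κ t))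
        = σ ^ (∑ i, β i) • δ β := by
      rw [← prod_gen_pow, Fintype.prod_prod_type]
      simp [β, mul_comm]
    rw [Finset.prod_smul, h1, mul_smul_comm, mul_smul_comm, ← δ_add, map_smul, map_smul,
      kernelFunctional_δ, weight, Finset.prod_mul_distrib]
    simp only [Pi.add_apply, Finset.sum_add_distrib, pow_add, smul_eq_mul, β, cond_true,
      cond_false]
    field_simp [hσ0]
  rw [Finset.sum_congr rfl fun κ _ => hterm κ, ← Finset.mul_sum, weight]
  simp only [h]
  rw [Finset.prod_univ_sum, Fintype.piFinset_univ]

theorem kernelFunctional_mul_gen_pow {σ : ℝ} (hσ : 1 ≤ σ) {φ : ℕ → ℕ → ℝ} {B : ℝ}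
    (hφ : ∀ a b, |φ a b| ≤ B) {n : ℕ} (h0 : ∀ a b, n ≤ a ∨ n ≤ b → φ a b = 0)
    (x : ConvAlg (J × Bool → ℕ)) (i : J × Bool) :
    kernelFunctional hσ hφ (x * gen σ i ^ n) = 0 := by
  have key := pair_mul_eq (f := kernelFunctional hσ hφ) (g := 0) (gen σ i ^ n) 1 (fun e => ?_) x
  · simpa using key
  have h1 : gen σ i ^ n = ∏ j, gen σ j ^ (Pi.single i n : J × Bool → ℕ) j := by
    rw [Finset.prod_eq_single i (fun j _ hj => by simp [Pi.single_eq_of_ne hj]) (by simp)]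
    simp
  rw [h1, prod_gen_pow, mul_smul_comm, ← δ_add, map_smul, kernelFunctional_δ, weight]
  have h2 : ∏ t, φ ((e + Pi.single i n : J × Bool → ℕ) (t, false))
      ((e + Pi.single i n : J × Bool → ℕ) (t, true)) = 0 := by
    refine Finset.prod_eq_zero (Finset.mem_univ i.1) (h0 _ _ ?_)
    rcases i with ⟨t, b⟩
    cases b
    · left; simp
    · right; simp
  rw [h2, mul_zero, smul_zero]
  rfl

/-- The ideal generated by the `n`-th powers of the generators. -/
noncomputable def powIdeal (σ : ℝ) (n : ℕ) : Ideal (ConvAlg (J × Bool → ℕ)) :=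
  Ideal.span (Set.range fun i => gen σ i ^ n)

/-- A kernel supported on exponents below `n` annihilates every multiple of `gen σ i ^ n`, so the
functional factors through the quotient by `powIdeal`. -/
theorem kernelFunctional_eq_of_sub_mem {σ : ℝ} (hσ : 1 ≤ σ) {φ : ℕ → ℕ → ℝ} {B : ℝ}
    (hφ : ∀ a b, |φ a b| ≤ B) {n : ℕ} (h0 : ∀ a b, n ≤ a ∨ n ≤ b → φ a b = 0)
    {x y : ConvAlg (J × Bool → ℕ)} (h : x - y ∈ powIdeal σ n) :
    kernelFunctional hσ hφ x = kernelFunctional hσ hφ y := by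
  rw [← sub_eq_zero, ← map_sub]
  generalize x - y = u at h
  induction h using Submodule.span_induction with
  | mem u hu =>
    obtain ⟨i, rfl⟩ := hu
    simpa using kernelFunctional_mul_gen_pow hσ hφ h0 1 i
  | zero => simp
  | add u v _ _ hu hv => rw [map_add, hu, hv, add_zero]
  | smul c u hu hu0 =>
    -- Vanishing at `u` alone says nothing about `c * u`, so the inner induction proves vanishing at
    -- all multiples of `u`.
    clear hu0
    have : ∀ c : ConvAlg (J × Bool → ℕ), kernelFunctional hσ hφ (c * u) = 0 := by
      induction hu using Submodule.span_induction with
      | mem u hu =>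
        obtain ⟨i, rfl⟩ := hu
        exact fun c => kernelFunctional_mul_gen_pow hσ hφ h0 c i
      | zero => simp
      | add u v _ _ hu hv => intro c; rw [mul_add, map_add, hu, hv, add_zero]
      | smul d u _ hu => intro c; rw [smul_eq_mul, ← mul_assoc]; exact hu _
    exact this c

theorem mul_prod_aeval_sub_mem {σ : ℝ} {n : ℕ} {Y D : ℝ[X]} (hY : Y = 1 - X + X ^ n * D)
    {κ : Type*} (s : Finset κ) (v : κ → ConvAlg (J × Bool → ℕ))
    (hv : ∀ k, v k ^ n ∈ powIdeal σ n) (x : ConvAlg (J × Bool → ℕ)) :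
    x * (∏ k ∈ s, aeval (v k) Y) - x * ∏ k ∈ s, (1 - v k) ∈ powIdeal σ n := by
  rw [← Ideal.Quotient.eq, map_mul, map_mul, map_prod, map_prod]
  congr 1
  refine Finset.prod_congr rfl fun k _ => ?_
  rw [Ideal.Quotient.eq, hY]
  simp only [map_add, map_sub, map_one, map_mul, map_pow, aeval_X, add_sub_cancel_left]
  exact Ideal.mul_mem_right _ _ (hv k)

end ConvAlg

open ConvAlg

/-! ### The correlation kernel and the exchange of Euler products for differences. -/

section Kernels

/-- The backward difference of a sequence. -/
def diffSeq (g : ℕ → ℝ) (k : ℕ) : ℝ := g k - g (k + 1)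

/-- The correlations of a sequence. -/
def corr (n : ℕ) (g : ℕ → ℝ) (a b : ℕ) : ℝ := ∑ k ∈ Finset.range n, g (a + k) * g (b + k)

theorem abs_corr_le {n : ℕ} {g : ℕ → ℝ} {B : ℝ} (hg : ∀ k, |g k| ≤ B) (a b : ℕ) :
    |corr n g a b| ≤ n * B ^ 2 := by
  refine (Finset.abs_sum_le_sum_abs _ _).trans ((Finset.sum_le_sum fun k _ => ?_).trans_eq
    (by simp : ∑ _k ∈ Finset.range n, B ^ 2 = n * B ^ 2))
  rw [abs_mul, pow_two]
  exact mul_le_mul (hg _) (hg _) (abs_nonneg _) ((abs_nonneg _).trans (hg 0))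

/-- The sum telescopes and the term at `n` vanishes. This is the effect of the factor `1 - z z'` on
the kernel `corr`. -/
theorem corr_sub_corr_succ {n : ℕ} {g : ℕ → ℝ} (h0 : ∀ k, n ≤ k → g k = 0) (a b : ℕ) :
    corr n g a b - corr n g (a + 1) (b + 1) = g a * g b := by
  rw [corr, corr, ← Finset.sum_sub_distrib]
  have := Finset.sum_range_sub' (fun k => g (a + k) * g (b + k)) n
  simp only [h0 (a + n) (by lia), zero_mul, sub_zero, add_zero] at this
  rw [← this]
  refine Finset.sum_congr rfl fun k _ => ?_
  rw [show a + 1 + k = a + (k + 1) by ring, show b + 1 + k = b + (k + 1) by ring]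

theorem corr_eq_zero {n : ℕ} {g : ℕ → ℝ} (h0 : ∀ k, n ≤ k → g k = 0) (a b : ℕ)
    (h : n ≤ a ∨ n ≤ b) : corr n g a b = 0 := by
  refine Finset.sum_eq_zero fun k _ => ?_
  rcases h with h | h
  · rw [h0 (a + k) (by lia), zero_mul]
  · rw [h0 (b + k) (by lia), mul_zero]

/-- The effect of the factor `(1 - z)(1 - z')` on the kernel `corr`. -/
theorem corr_diffSeq (n : ℕ) (g : ℕ → ℝ) (a b : ℕ) :
    corr n (diffSeq g) a b = corr n g a b - corr n g (a + 1) b - corr n g a (b + 1)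
      + corr n g (a + 1) (b + 1) := by
  simp only [corr, diffSeq]
  rw [← Finset.sum_sub_distrib, ← Finset.sum_sub_distrib, ← Finset.sum_add_distrib]
  refine Finset.sum_congr rfl fun k _ => ?_
  rw [show a + 1 + k = a + k + 1 by ring, show b + 1 + k = b + k + 1 by ring]
  ring

variable {J : Type*} [Fintype J] [DecidableEq J]

/-- Both sides are values of one functional, with kernel `corr n g`: the left at `F ∏ (1 - z z')`,
the right at `H ∏ (1 - z)(1 - z')`. Modulo `powIdeal` each `1 - v` may be replaced by `Y` evaluated
at `v`, after which `hFH` identifies the arguments. -/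
theorem kernelFunctional_product_eq_corr {σ : ℝ} (hσ : 1 ≤ σ) {n : ℕ} {g : ℕ → ℝ}
    (h0 : ∀ k, n ≤ k → g k = 0) {B B₁ B₂ : ℝ} (hg : ∀ k, |g k| ≤ B)
    (hφ : ∀ a b, |g a * g b| ≤ B₁) (hψ : ∀ a b, |corr n (diffSeq g) a b| ≤ B₂)
    {Y D : ℝ[X]} (hY : Y = 1 - X + X ^ n * D) {F H : ConvAlg (J × Bool → ℕ)}
    (hFH : F * ∏ t, aeval (gen σ (t, false) * gen σ (t, true)) Y = H * ∏ i, aeval (gen σ i) Y) :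
    kernelFunctional hσ hφ F = kernelFunctional hσ hψ H := by
  have hθ := abs_corr_le (n := n) hg
  have hv : ∀ i : J × Bool, gen σ i ^ n ∈ powIdeal σ n := fun i =>
    Ideal.subset_span ⟨i, rfl⟩
  have e1 : kernelFunctional hσ hφ F = kernelFunctional hσ hθ
      (F * ∏ t, (1 - gen σ (t, false) * gen σ (t, true))) := by
    rw [← kernelFunctional_mul_prod hσ ![1, -1] ![0, 1] ![0, 1] hθ hφ]
    · simp [Fin.sum_univ_two, sub_eq_add_neg]
    · intro i j
      rw [Fin.sum_univ_two, ← corr_sub_corr_succ h0]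
      simp [sub_eq_add_neg]
  have e2 : kernelFunctional hσ hψ H = kernelFunctional hσ hθ (H * ∏ i, (1 - gen σ i)) := by
    rw [← kernelFunctional_mul_prod hσ ![1, -1, -1, 1] ![0, 1, 0, 1] ![0, 0, 1, 1] hθ hψ]
    · rw [Fintype.prod_prod_type]
      congr 2
      refine Finset.prod_congr rfl fun t _ => ?_
      simp [Fin.sum_univ_four]
      ring
    · intro i j
      rw [Fin.sum_univ_four, corr_diffSeq]
      simp
      ring
  rw [e1, e2, ← kernelFunctional_eq_of_sub_mem hσ hθ (corr_eq_zero h0)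
    (mul_prod_aeval_sub_mem hY Finset.univ (fun t => gen σ (t, false) * gen σ (t, true))
      (fun t => by rw [mul_pow]; exact Ideal.mul_mem_right _ _ (hv _)) F),
    ← kernelFunctional_eq_of_sub_mem hσ hθ (corr_eq_zero h0)
    (mul_prod_aeval_sub_mem hY Finset.univ (fun i => gen σ i) hv H), hFH]

end Kernels

open ConvAlg

/-! ### The sieve sum in terms of Euler products. -/

section AbstractSieve

variable {J : Type*} [Fintype J] [DecidableEq J]

/-- The character of the convolution algebra sending all generators to `1`. -/
noncomputable def augmentation {σ : ℝ} (hσ : 1 ≤ σ) : ConvAlg (J × Bool → ℕ) →ₐ[ℝ] ℝ :=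
  AlgHom.ofLinearMap (kernelFunctional hσ (φ := fun _ _ => 1) (B := 1) (by simp)).toLinearMap
    (by
      change kernelFunctional hσ (φ := fun _ _ => 1) (B := 1) _ (1 : ConvAlg (J × Bool → ℕ)) = 1
      rw [← δ_zero, kernelFunctional_δ]; simp [weight])
    (fun x y => pair_mul _ _ (fun a b => by
      simp [weight, Finset.sum_add_distrib, pow_add, mul_comm]) x y)

theorem augmentation_apply {σ : ℝ} (hσ : 1 ≤ σ) (x : ConvAlg (J × Bool → ℕ)) :
    augmentation hσ x = kernelFunctional hσ (φ := fun _ _ => 1) (B := 1) (by simp) x := rfl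

theorem augmentation_gen {σ : ℝ} (hσ : 1 ≤ σ) (i : J × Bool) :
    augmentation hσ (gen σ i) = 1 := by
  have : σ ≠ 0 := by positivity
  rw [augmentation_apply, gen, map_smul, kernelFunctional_δ]
  simp [weight, this]

theorem abs_augmentation_le {σ : ℝ} (hσ : 1 ≤ σ) (x : ConvAlg (J × Bool → ℕ)) :
    |augmentation hσ x| ≤ ‖x‖ := by
  refine (abs_pair_le _ _ x).trans_eq ?_
  rw [one_pow, one_mul]

/-- The factors are replaced by `c` one at a time; the other factors cost at most `M` each. -/
theorem abs_prod_sub_prod_le {α : Type*} (s : Finset α) (x : α → ℝ) (c : ℝ) {M : ℝ} (hM : 1 ≤ M)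
    (hx : ∀ t ∈ s, |x t| ≤ M) (hc : |c| ≤ M) {d : α → ℝ} (hd : ∀ t ∈ s, |x t - c| ≤ d t) :
    |∏ t ∈ s, x t - c ^ s.card| ≤ M ^ s.card * ∑ t ∈ s, d t := by
  classical
  induction s using Finset.induction_on with
  | empty => simp
  | insert a s ha ih =>
    rw [Finset.prod_insert ha, Finset.card_insert_of_notMem ha, Finset.sum_insert ha]
    have h1 := ih (fun t ht => hx t (Finset.mem_insert_of_mem ht))
      (fun t ht => hd t (Finset.mem_insert_of_mem ht))
    have h2 := hd a (Finset.mem_insert_self a s)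
    have h3 := hx a (Finset.mem_insert_self a s)
    have h4 : |c ^ s.card| ≤ M ^ s.card := by
      rw [abs_pow]; exact pow_le_pow_left₀ (abs_nonneg _) hc _
    have h5 : x a * ∏ t ∈ s, x t - c ^ (s.card + 1)
        = x a * (∏ t ∈ s, x t - c ^ s.card) + (x a - c) * c ^ s.card := by ring
    have hM0 : (0 : ℝ) ≤ M ^ s.card := by positivity
    have hd0 : 0 ≤ d a := (abs_nonneg _).trans h2
    calc _ ≤ M * (M ^ s.card * ∑ t ∈ s, d t) + d a * M ^ s.card := by
          rw [h5]
          refine (abs_add_le _ _).trans (add_le_add ?_ ?_)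
          · rw [abs_mul]; exact mul_le_mul h3 h1 (abs_nonneg _) (by linarith)
          · rw [abs_mul]; exact mul_le_mul h2 h4 (abs_nonneg _) hd0
      _ ≤ M * (M ^ s.card * ∑ t ∈ s, d t) + M * (d a * M ^ s.card) :=
          add_le_add_right (le_mul_of_one_le_left (mul_nonneg hd0 hM0) hM) _
      _ = _ := by ring

/-- A functional whose kernel is close to a constant is close to a multiple of the augmentation. -/
theorem kernelFunctional_near_augmentation {σ : ℝ} (hσ : 1 ≤ σ) {w : ℝ} (hw : 1 ≤ w)
    (hσw : σ = 1 + 1 / w)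
    {φ : ℕ → ℕ → ℝ} {B : ℝ} (hφ : ∀ a b, |φ a b| ≤ B) {c r M : ℝ} (hr : 0 < r) (hM : 1 ≤ M)
    (hc : |c| ≤ M) (h1 : ∀ a b, |r * φ a b| ≤ M)
    (h2 : ∀ a b : ℕ, |r * φ a b - c| ≤ M * (1 + a + b) / r) (H : ConvAlg (J × Bool → ℕ)) :
    |r ^ Fintype.card J * kernelFunctional hσ hφ H - c ^ Fintype.card J * augmentation hσ H|
      ≤ M ^ (Fintype.card J + 1) * (Fintype.card J + w) / r * ‖H‖ := by
  set T := Fintype.card J with hT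
  let ψ : (J × Bool → ℕ) → ℝ := fun a =>
    r ^ T * weight σ φ a - c ^ T * weight σ (fun _ _ => 1) a
  have hψ : ∀ a, |ψ a| ≤ M ^ (T + 1) * (T + w) / r := by
    intro a
    have e1 : ψ a = (σ ^ ∑ i, a i)⁻¹ * (∏ t, (r * φ (a (t, false)) (a (t, true))) - c ^ T) := by
      simp only [ψ, weight, Finset.prod_mul_distrib, Finset.prod_const, Finset.card_univ, ← hT,
        one_pow]
      ring
    have e2 := abs_prod_sub_prod_le Finset.univ (fun t => r * φ (a (t, false)) (a (t, true))) c hM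
      (fun t _ => h1 _ _) hc (fun t _ => h2 (a (t, false)) (a (t, true)))
    have hs : ∑ t, M * (1 + (a (t, false) : ℝ) + a (t, true)) / r
        = M * (T + (∑ i, a i : ℕ)) / r := by
      rw [← Finset.sum_div, ← Finset.mul_sum]
      congr 2
      rw [Fintype.sum_prod_type]
      simp only [Fintype.sum_bool]
      push_cast
      simp only [Finset.sum_add_distrib, Finset.sum_const, Finset.card_univ, ← hT, nsmul_eq_mul]
      ring
    rw [Finset.card_univ, ← hT, hs] at e2
    set k := ∑ i, a i
    -- Bernoulli's inequality gives `σ ^ k ≥ 1 + k / w`, so the weight `σ ^ (-k)` absorbs the linear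
    -- growth of the kernel error at the price of a factor `T + w`.
    have hk : (T : ℝ) + k ≤ σ ^ k * (T + w) := by
      have hb := one_add_mul_le_pow (show (-2 : ℝ) ≤ 1 / w by
        have : 0 ≤ 1 / w := by positivity
        linarith) k
      rw [← hσw] at hb
      have hσk : (1 : ℝ) ≤ σ ^ k := one_le_pow₀ hσ
      have : (k : ℝ) ≤ σ ^ k * w := by
        have := mul_le_mul_of_nonneg_right hb (show 0 ≤ w by linarith)
        have e : (1 + (k : ℝ) * (1 / w)) * w = w + k := by field_simp
        linarith
      nlinarith [Nat.cast_nonneg (α := ℝ) T]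
    have hσk : (0 : ℝ) < σ ^ k := by positivity
    rw [e1, abs_mul, abs_of_pos (inv_pos.2 hσk), inv_mul_le_iff₀ hσk]
    calc _ ≤ M ^ T * (M * (T + k) / r) := e2
      _ ≤ M ^ T * (M * (σ ^ k * (T + w)) / r) := by gcongr
      _ = _ := by ring
  have hlin : pair ψ hψ = r ^ T • kernelFunctional hσ hφ - c ^ T •
      kernelFunctional hσ (φ := fun _ _ => 1) (B := 1) (by simp) :=
    hom_ext fun a => by
      rw [pair_δ]
      simp [kernelFunctional_δ, ψ]
  have := abs_pair_le ψ hψ H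
  rw [hlin] at this
  simpa [augmentation_apply] using this

/-- Expanding the Euler product chooses at each prime the set `β p` of variables it divides; the
exponent of `z_i` is then the total degree of the primes assigned to `i`. -/
theorem kernelFunctional_localFactor_prod {σ : ℝ} (hσ : 1 ≤ σ) {g : ℕ → ℝ} {B : ℝ}
    (hφ : ∀ a b, |g a * g b| ≤ B) {Q : Type*} [DecidableEq Q] (P : Finset Q) (m : Q → ℕ)
    (α : Q → Finset (J × Bool) → ℝ) :
    kernelFunctional hσ hφ (∏ p ∈ P, localFactor (α p) (fun i => gen σ i ^ m p))
      = ∑ β : P → Finset (J × Bool), (∏ p : P, (-1) ^ (β p).card * α p (β p)) *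
          ∏ i, g (∑ p : P, if i ∈ β p then m p else 0) := by
  rw [← Finset.prod_coe_sort]
  simp only [localFactor]
  rw [Finset.prod_univ_sum, Fintype.piFinset_univ, map_sum]
  refine Finset.sum_congr rfl fun β _ => ?_
  have h1 : ∏ p : P, ∏ i ∈ β p, gen σ i ^ m p
      = ∏ i, gen σ i ^ (∑ p : P, if i ∈ β p then m p else 0) := by
    simp only [← Finset.prod_pow_eq_pow_sum]
    rw [Finset.prod_comm]
    refine Finset.prod_congr rfl fun p _ => ?_
    rw [← Finset.prod_subset (Finset.subset_univ (β p))]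
    · exact Finset.prod_congr rfl fun i hi => by rw [if_pos hi]
    · intro i _ hi; rw [if_neg hi, pow_zero]
  rw [Finset.prod_smul, map_smul, h1, kernelFunctional_prod_gen, Fintype.prod_prod_type,
    smul_eq_mul]
  congr 1
  refine Finset.prod_congr rfl fun t _ => ?_
  rw [Fintype.prod_bool, mul_comm]

/-- The evaluation of a multidimensional sieve sum. -/
theorem abstract_sieve {Q : Type*} [DecidableEq Q] {y : Q → ℝ} {m : Q → ℕ} {S P : Finset Q} (hSP : Disjoint S P)
    {α : Q → Finset (J × Bool) → ℝ}
    (hα : ∀ p ∈ P, LocalDensity (y p) (α p)) (hyS : ∀ p ∈ S, 0 ≤ y p) (hyP : ∀ p ∈ P, 0 ≤ y p)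
    {w η : ℝ} (hw : 1 ≤ w)
    (hS1 : ∀ p ∈ S, y p * (1 + 1 / w) ^ m p ≤ 3 / 4) (hS2 : ∀ p ∈ S, (1 + 1 / w) ^ m p ≤ 3)
    (hS3 : ∑ p ∈ S, y p ≤ w) (hV0 : 0 < eulerProd y m S (1 : ℝ))
    (hV1 : eulerProd y m S (1 : ℝ) ≤ 1)
    (hP1 : ∀ p ∈ P, y p * (1 + 1 / w) ^ m p ≤ 1 / 2)
    (hP2 : ∀ p ∈ P,
      localConst (Fintype.card J) * (y p * ((1 + 1 / w) ^ m p) ^ (2 * Fintype.card J + 2)) ≤ 1)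
    (hP3 : ∑ p ∈ P, y p ^ 2 * ((1 + 1 / w) ^ m p) ^ (4 * Fintype.card J + 4) ≤ η)
    {n : ℕ} {D : ℝ[X]}
    (hY : eulerProd y m (S.disjUnion P hSP) (X : ℝ[X]) = 1 - X + X ^ n * D)
    {g : ℕ → ℝ} (h0 : ∀ k, n ≤ k → g k = 0) {c r M : ℝ} (hr : 0 < r) (hM : 1 ≤ M)
    (hc0 : 0 < c) (hc : c ≤ M) (h1 : ∀ a b, |r * corr n (diffSeq g) a b| ≤ M)
    (h2 : ∀ a b : ℕ, |r * corr n (diffSeq g) a b - c| ≤ M * (1 + a + b) / r) :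
    |(r * eulerProd y m S (1 : ℝ) / c) ^ Fintype.card J *
        (∑ β : P → Finset (J × Bool), (∏ p : P, (-1) ^ (β p).card * α p (β p)) *
          ∏ i, g (∑ p : P, if i ∈ β p then m p else 0)) - 1|
      ≤ M ^ (Fintype.card J + 1) * (Fintype.card J + w) / r / c ^ Fintype.card J *
          Real.exp (33 * Fintype.card J * w + localConst' (Fintype.card J) * η)
        + (Real.exp (localConst' (Fintype.card J) * η) - 1) := by
  set T := Fintype.card J with hT
  obtain ⟨σ, hσw⟩ : ∃ σ, σ = 1 + 1 / w := ⟨_, rfl⟩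
  simp only [← hσw] at hS1 hS2 hP1 hP2 hP3
  have hσ : (1 : ℝ) ≤ σ := by
    have : 0 ≤ 1 / w := by positivity
    linarith
  obtain ⟨E, H, hFH, hHE, hE, hH⟩ := eulerProduct_compare hSP hα hyS hyP (gen σ) hσ
    (norm_gen_le hσ) hS1 hS2 hS3 hP1 hP2 hP3
  obtain ⟨B, hB⟩ : ∃ B, ∀ k, |g k| ≤ B := by
    refine ⟨∑ k ∈ Finset.range n, |g k|, fun k => ?_⟩
    by_cases hk : k < n
    · exact Finset.single_le_sum (f := fun k => |g k|) (fun _ _ => abs_nonneg _)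
        (Finset.mem_range.2 hk)
    · rw [h0 k (by lia), abs_zero]; exact Finset.sum_nonneg fun _ _ => abs_nonneg _
  have hφ : ∀ a b, |g a * g b| ≤ B * B := fun a b => by
    rw [abs_mul]; exact mul_le_mul (hB _) (hB _) (abs_nonneg _) ((abs_nonneg _).trans (hB 0))
  have hψ : ∀ a b, |corr n (diffSeq g) a b| ≤ M / r := fun a b => by
    have := h1 a b
    rw [abs_mul, abs_of_pos hr] at this
    rwa [le_div_iff₀ hr, mul_comm]
  have haeval : ∀ x : ConvAlg (J × Bool → ℕ), eulerProd y m (S.disjUnion P hSP) x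
      = aeval x (eulerProd y m (S.disjUnion P hSP) (X : ℝ[X])) := fun x => by
    simp [eulerProd, map_prod]
  simp only [haeval] at hFH
  rw [← kernelFunctional_localFactor_prod hσ hφ P m α,
    kernelFunctional_product_eq_corr hσ h0 hB hφ hψ hY hFH]
  have hnear := kernelFunctional_near_augmentation hσ hw hσw hψ hr hM
    (by rwa [abs_of_pos hc0]) h1 h2 H
  set V := eulerProd y m S (1 : ℝ) with hV
  -- With all variables equal to `1`, the relation between `H` and `E` reads `V ^ (2 T) H(1) = V ^ T
  -- E(1)`.
  have haug : augmentation hσ H * V ^ T = augmentation hσ E := by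
    have hVx : ∀ x : ConvAlg (J × Bool → ℕ), augmentation hσ x = 1 →
        augmentation hσ (eulerProd y m S x) = V := fun x hx => by
      simp [eulerProd, map_prod, hx, hV]
    have := congrArg (augmentation hσ) hHE
    rw [map_mul, map_mul, map_prod, map_prod,
      Finset.prod_congr rfl fun i _ => hVx _ (augmentation_gen hσ i),
      Finset.prod_congr rfl fun t _ => hVx _ (by simp [augmentation_gen])] at this
    simp only [Finset.prod_const, Finset.card_univ, Fintype.card_prod, Fintype.card_bool, ← hT]
      at this
    have hVT : V ^ T ≠ 0 := by positivity
    apply mul_left_cancel₀ hVT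
    rw [← this]
    ring
  have hE' : |augmentation hσ E - 1| ≤ Real.exp (localConst' T * η) - 1 := by
    have : augmentation hσ E - 1 = augmentation hσ (E - 1) := by rw [map_sub, map_one]
    rw [this]
    exact (abs_augmentation_le hσ _).trans hE
  set K := kernelFunctional hσ hψ H
  -- The first summand is the kernel approximation error, the second the convergent Euler product
  -- error.
  have hsplit : (r * V / c) ^ T * K - 1
      = V ^ T / c ^ T * (r ^ T * K - c ^ T * augmentation hσ H) + (augmentation hσ E - 1) := by
    have hcT : c ^ T ≠ 0 := by positivity
    rw [← haug, div_pow, mul_pow]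
    field_simp
    ring
  rw [hsplit]
  refine (abs_add_le _ _).trans (add_le_add ?_ hE')
  rw [abs_mul, abs_of_pos (by positivity)]
  have hV1' : V ^ T ≤ 1 := pow_le_one₀ hV0.le hV1
  calc _ ≤ 1 / c ^ T * (M ^ (T + 1) * (T + w) / r *
        Real.exp (33 * T * w + localConst' T * η)) := by
        have : 0 ≤ M ^ (T + 1) * (T + w) / r := by positivity
        exact mul_le_mul (div_le_div_of_nonneg_right hV1' (by positivity))
          (hnear.trans (mul_le_mul_of_nonneg_left hH this)) (abs_nonneg _) (by positivity)
    _ = _ := by ring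

end AbstractSieve

/-! ### The smooth cutoff and the autocorrelation of its differences. -/

section Cutoff

/-- A smooth function equal to `1` on `(-∞, 0]` and to `0` on `[1, ∞)`. -/
noncomputable def cutoff (t : ℝ) : ℝ := Real.smoothTransition (1 - t)

theorem contDiff_cutoff : ContDiff ℝ ∞ cutoff :=
  Real.smoothTransition.contDiff.comp (contDiff_const.sub contDiff_id)

theorem cutoff_eq_zero {t : ℝ} (ht : 1 ≤ t) : cutoff t = 0 :=
  Real.smoothTransition.zero_of_nonpos (by linarith)

theorem cutoff_eq_one {t : ℝ} (ht : t ≤ 0) : cutoff t = 1 :=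
  Real.smoothTransition.one_of_one_le (by linarith)

theorem deriv_cutoff_eq_zero {t : ℝ} (ht : t ∉ Set.Icc (0 : ℝ) 1) : deriv cutoff t = 0 := by
  rw [Set.mem_Icc, not_and_or, not_le, not_le] at ht
  rcases ht with ht | ht
  · have : cutoff =ᶠ[nhds t] fun _ => 1 := by
      filter_upwards [Iio_mem_nhds ht] with x hx using cutoff_eq_one (le_of_lt hx)
    rw [this.deriv_eq]; simp
  · have : cutoff =ᶠ[nhds t] fun _ => 0 := by
      filter_upwards [Ioi_mem_nhds ht] with x hx using cutoff_eq_zero (le_of_lt hx)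
    rw [this.deriv_eq]; simp

theorem contDiff_deriv_cutoff : ContDiff ℝ 1 (deriv cutoff) :=
  (contDiff_succ_iff_deriv.1 (contDiff_cutoff.of_le (m := 1 + 1) (by norm_cast))).2.2

theorem continuous_deriv_cutoff : Continuous (deriv cutoff) := contDiff_deriv_cutoff.continuous

theorem hasCompactSupport_deriv_cutoff : HasCompactSupport (deriv cutoff) :=
  HasCompactSupport.intro isCompact_Icc fun _ ht => deriv_cutoff_eq_zero ht

theorem exists_bound_deriv_cutoff : ∃ K : ℝ, 1 ≤ K ∧ (∀ x, |deriv cutoff x| ≤ K) ∧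
    ∀ x y, |deriv cutoff x - deriv cutoff y| ≤ K * |x - y| := by
  obtain ⟨C, hC⟩ := contDiff_deriv_cutoff.lipschitzWith_of_hasCompactSupport
    hasCompactSupport_deriv_cutoff one_ne_zero
  obtain ⟨B, hB⟩ := continuous_deriv_cutoff.bounded_above_of_compact_support
    hasCompactSupport_deriv_cutoff
  refine ⟨max 1 (max B C), le_max_left _ _,
    fun x => (hB x).trans ((le_max_left _ _).trans (le_max_right _ _)), fun x y => ?_⟩
  have := hC.dist_le_mul x y
  rw [Real.dist_eq, Real.dist_eq] at this
  exact this.trans (mul_le_mul_of_nonneg_right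
    ((le_max_right _ _).trans (le_max_right _ _)) (abs_nonneg _))

theorem deriv_cutoff_one : deriv cutoff 1 = 0 := by
  have h : Filter.Tendsto (deriv cutoff) (nhdsWithin 1 (Set.Ioi 1)) (nhds (deriv cutoff 1)) :=
    continuous_deriv_cutoff.continuousAt.tendsto.mono_left nhdsWithin_le_nhds
  refine tendsto_nhds_unique h (tendsto_const_nhds.congr' ?_)
  filter_upwards [self_mem_nhdsWithin] with x hx
  exact (deriv_cutoff_eq_zero fun h => absurd h.2 (not_le.2 hx)).symm

/-- The energy of the cutoff. -/
noncomputable def cutoffEnergy : ℝ := ∫ t in (0 : ℝ)..1, deriv cutoff t ^ 2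

/-- Cauchy–Schwarz, in the form `∫ (G' + 1) ^ 2 ≥ 0` together with `∫ G' = -1`. -/
theorem one_le_cutoffEnergy : 1 ≤ cutoffEnergy := by
  have hc := continuous_deriv_cutoff
  have h1 : ∫ t in (0 : ℝ)..1, deriv cutoff t = -1 := by
    rw [intervalIntegral.integral_deriv_eq_sub
      (fun x _ => (contDiff_cutoff.differentiable (by simp)) x) (hc.intervalIntegrable _ _),
      cutoff_eq_zero le_rfl, cutoff_eq_one le_rfl]
    norm_num
  have h2 : 0 ≤ ∫ t in (0 : ℝ)..1, (deriv cutoff t + 1) ^ 2 :=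
    intervalIntegral.integral_nonneg zero_le_one fun _ _ => sq_nonneg _
  have h3 : ∫ t in (0 : ℝ)..1, (deriv cutoff t + 1) ^ 2
      = cutoffEnergy + 2 * (∫ t in (0 : ℝ)..1, deriv cutoff t) + 1 := by
    have e : ∀ t, (deriv cutoff t + 1) ^ 2 = deriv cutoff t ^ 2 + 2 * deriv cutoff t + 1 :=
      fun t => by ring
    simp only [e]
    rw [intervalIntegral.integral_add, intervalIntegral.integral_add,
      intervalIntegral.integral_const_mul]
    · simp [cutoffEnergy]
    all_goals exact Continuous.intervalIntegrable (by fun_prop) _ _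
  rw [h3, h1] at h2
  linarith

theorem exists_diffSeq_cutoff {r : ℝ} (hr : 0 < r) (k : ℕ) : ∃ ξ ∈ Set.Icc ((k : ℝ) / r) ((k + 1) / r),
    diffSeq (fun k => cutoff (k / r)) k = -(deriv cutoff ξ / r) := by
  have hlt : (k : ℝ) / r < (k + 1) / r := by gcongr; linarith
  obtain ⟨ξ, hξ, h⟩ := exists_deriv_eq_slope cutoff hlt contDiff_cutoff.continuous.continuousOn
    (contDiff_cutoff.differentiable (by simp)).differentiableOn
  refine ⟨ξ, Set.Ioo_subset_Icc_self hξ, ?_⟩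
  have e : ((k : ℝ) + 1) / r - k / r = 1 / r := by field_simp; ring
  rw [h, e, diffSeq]
  push_cast
  field_simp
  ring

/-- By the mean value theorem each summand, multiplied by `r`, is `G'(ξ) G'(ξ') / r`, a Riemann sum
term for the energy. The points `ξ, ξ'` lie within `(a + 1) / r` and `(b + 1) / r` of `[k / r, (k +
1) / r]`, so the Lipschitz bound on `G'` gives the error, uniformly in `r` and `n`. -/
theorem exists_corr_cutoff_bound : ∃ M : ℝ, 1 ≤ M ∧ cutoffEnergy ≤ M ∧
    ∀ (r : ℝ) (n : ℕ), 1 ≤ r → r ≤ n → ∀ a b : ℕ,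
      |r * corr n (diffSeq fun k => cutoff (k / r)) a b| ≤ M ∧
      |r * corr n (diffSeq fun k => cutoff (k / r)) a b - cutoffEnergy|
        ≤ M * (1 + a + b) / r := by
  obtain ⟨K, hK1, hK, hKL⟩ := exists_bound_deriv_cutoff
  have hE := one_le_cutoffEnergy
  refine ⟨4 * K ^ 2 + cutoffEnergy, by nlinarith, by nlinarith, fun r n hr hrn a b => ?_⟩
  have hr0 : 0 < r := by linarith
  set f := deriv cutoff with hf
  set d := diffSeq fun k => cutoff ((k : ℕ) / r) with hd
  have hξ : ∀ k : ℕ, ∃ ξ ∈ Set.Icc ((k : ℝ) / r) ((k + 1) / r), d k = -(f ξ / r) :=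
    exists_diffSeq_cutoff hr0
  choose ξ hξ hdξ using hξ
  -- Only the first `⌈r⌉ ≤ 2 r` differences can be nonzero, so the bounds do not depend on `n`.
  set N := ⌈r⌉₊ with hN
  have hNr : r ≤ N := Nat.le_ceil r
  have hN2 : (N : ℝ) ≤ 2 * r := by linarith [Nat.ceil_lt_add_one hr0.le]
  have hNn : N ≤ n := Nat.ceil_le.2 hrn
  have hd0 : ∀ k, N ≤ k → d k = 0 := by
    intro k hk
    have h1 : (1 : ℝ) ≤ k / r := by
      rw [le_div_iff₀ hr0, one_mul]; exact hNr.trans (by exact_mod_cast hk)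
    have h2 : (1 : ℝ) ≤ ((k + 1 : ℕ) : ℝ) / r := h1.trans (by gcongr; lia)
    simp only [hd, diffSeq, cutoff_eq_zero h1, cutoff_eq_zero h2, sub_zero]
  have hcorr : corr n d a b = ∑ k ∈ Finset.range N, d (a + k) * d (b + k) := by
    rw [corr]
    symm
    refine Finset.sum_subset (Finset.range_mono hNn) fun k _ hk => ?_
    rw [hd0 (a + k) (by have := Finset.mem_range.not.1 hk; lia), zero_mul]
  have hmul : ∀ k, r * (d (a + k) * d (b + k)) = f (ξ (a + k)) * f (ξ (b + k)) / r := by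
    intro k
    rw [hdξ, hdξ]
    field_simp
  have hpos : 0 ≤ 4 * K ^ 2 := by positivity
  have hprodK : ∀ x z, |f x * f z| ≤ K ^ 2 := fun x z => by
    rw [abs_mul, pow_two]; exact mul_le_mul (hK _) (hK _) (abs_nonneg _) (by linarith)
  constructor
  · rw [hcorr, Finset.mul_sum]
    refine (Finset.abs_sum_le_sum_abs _ _).trans ((Finset.sum_le_sum
      (g := fun _ => K ^ 2 / r) fun k _ => ?_).trans ?_)
    · rw [hmul, abs_div, abs_of_pos hr0]
      exact div_le_div_of_nonneg_right (hprodK _ _) hr0.le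
    · rw [Finset.sum_const, Finset.card_range, nsmul_eq_mul]
      have : (N : ℝ) * (K ^ 2 / r) ≤ 2 * r * (K ^ 2 / r) :=
        mul_le_mul_of_nonneg_right hN2 (by positivity)
      have e : 2 * r * (K ^ 2 / r) = 2 * K ^ 2 := by field_simp
      nlinarith
  · have hint : ∀ u v : ℝ, IntervalIntegrable (fun s => f s ^ 2) MeasureTheory.volume u v :=
      fun u v => (continuous_deriv_cutoff.pow 2).intervalIntegrable _ _
    have hsum : ∑ k ∈ Finset.range N, ∫ s in ((k : ℕ) : ℝ) / r..((k + 1 : ℕ) : ℝ) / r, f s ^ 2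
        = cutoffEnergy := by
      rw [intervalIntegral.sum_integral_adjacent_intervals (a := fun k : ℕ => (k : ℝ) / r)
        fun k _ => hint _ _]
      have h1 : (1 : ℝ) ≤ N / r := by rwa [le_div_iff₀ hr0, one_mul]
      rw [Nat.cast_zero, zero_div, ← intervalIntegral.integral_add_adjacent_intervals
        (hint 0 1) (hint 1 (N / r))]
      have h2 : ∫ s in (1 : ℝ)..N / r, f s ^ 2 = 0 := by
        rw [intervalIntegral.integral_congr (g := fun _ => 0)]
        · simp
        · intro s hs
          rw [Set.uIcc_of_le h1] at hs
          simp only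
          rcases eq_or_lt_of_le hs.1 with h | h
          · rw [hf, ← h, deriv_cutoff_one]; simp
          · rw [hf, deriv_cutoff_eq_zero fun h' => absurd h'.2 (not_le.2 h)]; simp
      rw [h2, add_zero, cutoffEnergy]
    have hterm : ∀ k ∈ Finset.range N, |r * (d (a + k) * d (b + k))
        - ∫ s in ((k : ℕ) : ℝ) / r..((k + 1 : ℕ) : ℝ) / r, f s ^ 2|
        ≤ K ^ 2 * (a + b + 2) / r * (1 / r) := by
      intro k _
      have hlen : ((k + 1 : ℕ) : ℝ) / r - (k : ℝ) / r = 1 / r := by push_cast; field_simp; ring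
      have hle : (k : ℝ) / r ≤ ((k + 1 : ℕ) : ℝ) / r := by
        have : (0 : ℝ) < 1 / r := by positivity
        linarith
      have e1 : r * (d (a + k) * d (b + k))
          = ∫ _s in ((k : ℕ) : ℝ) / r..((k + 1 : ℕ) : ℝ) / r, f (ξ (a + k)) * f (ξ (b + k)) := by
        rw [intervalIntegral.integral_const, hlen, hmul, smul_eq_mul]; ring
      rw [e1, ← intervalIntegral.integral_sub (by simp) (hint _ _)]
      have := intervalIntegral.norm_integral_le_of_norm_le_const
        (f := fun s => f (ξ (a + k)) * f (ξ (b + k)) - f s ^ 2)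
        (a := ((k : ℕ) : ℝ) / r) (b := ((k + 1 : ℕ) : ℝ) / r)
        (C := K ^ 2 * (a + b + 2) / r) fun s hs => ?_
      · rwa [hlen, abs_of_pos (by positivity : 0 < 1 / r)] at this
      · rw [Set.uIoc_of_le hle] at hs
        have hdist : ∀ a : ℕ, |f (ξ (a + k)) - f s| ≤ K * ((a + 1) / r) := by
          intro a
          refine (hKL _ _).trans (mul_le_mul_of_nonneg_left ?_ (by linarith))
          have h := hξ (a + k)
          have h1 : (((a + k : ℕ) : ℝ) + 1) / r = (k : ℝ) / r + (a + 1) / r := by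
            push_cast; field_simp; ring
          have h2 : ((a + k : ℕ) : ℝ) / r = (k : ℝ) / r + a / r := by push_cast; field_simp; ring
          have h3 : ((a : ℝ) + 1) / r = a / r + 1 / r := by field_simp
          have h4 : (0 : ℝ) ≤ a / r := by positivity
          rw [h1, h2] at h
          rw [abs_le]
          constructor <;> linarith [h.1, h.2, hs.1, hs.2]
        have e2 : f (ξ (a + k)) * f (ξ (b + k)) - f s ^ 2
            = (f (ξ (a + k)) - f s) * f (ξ (b + k)) + (f (ξ (b + k)) - f s) * f s := by ring
        rw [e2]
        refine (norm_add_le _ _).trans ?_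
        rw [norm_mul, norm_mul]
        simp only [Real.norm_eq_abs]
        have g1 := mul_le_mul (hdist a) (hK (ξ (b + k))) (abs_nonneg _) (by positivity)
        have g2 := mul_le_mul (hdist b) (hK s) (abs_nonneg _) (by positivity)
        calc _ ≤ _ := add_le_add g1 g2
          _ = _ := by ring
    rw [hcorr, Finset.mul_sum, ← hsum, ← Finset.sum_sub_distrib]
    refine (Finset.abs_sum_le_sum_abs _ _).trans ((Finset.sum_le_sum hterm).trans ?_)
    rw [Finset.sum_const, Finset.card_range, nsmul_eq_mul]
    have h1 : (N : ℝ) * (K ^ 2 * (a + b + 2) / r * (1 / r))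
        ≤ 2 * r * (K ^ 2 * (a + b + 2) / r * (1 / r)) :=
      mul_le_mul_of_nonneg_right hN2 (by positivity)
    have h2 : 2 * r * (K ^ 2 * (a + b + 2) / r * (1 / r)) = 2 * K ^ 2 * (a + b + 2) / r := by
      field_simp
    rw [h2] at h1
    refine h1.trans (div_le_div_of_nonneg_right ?_ hr0.le)
    have : (0 : ℝ) ≤ a + b := by positivity
    have : (0 : ℝ) ≤ K ^ 2 * (a + b) := by positivity
    have : (0 : ℝ) ≤ cutoffEnergy * (1 + a + b) := by positivity
    rw [hsum]
    nlinarith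

end Cutoff

/-! ### Counting monic and prime polynomials; the truncated zeta function. -/

section PrimePolynomials

variable {F : Type*} [Field F] [Fintype F]

theorem finite_degreeLT (n : ℕ) : Finite (degreeLT F n) :=
  Finite.of_equiv _ (degreeLTEquiv F n).toEquiv.symm

theorem card_degreeLT (n : ℕ) : Nat.card (degreeLT F n) = Fintype.card F ^ n := by
  rw [Nat.card_congr (degreeLTEquiv F n).toEquiv, Nat.card_fun]
  simp

/-- A monic polynomial of degree `n` is `X ^ n` plus a polynomial of smaller degree. -/
noncomputable def monicDegEquiv (n : ℕ) : monicDeg F n ≃ degreeLT F n where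
  toFun f := ⟨f.1 - X ^ n, by
    rw [mem_degreeLT]
    have h := degree_sub_lt_left (p := f.1) (q := X ^ n)
      (by rw [degree_X_pow, degree_eq_natDegree f.2.1.ne_zero, f.2.2]) f.2.1.ne_zero
      (by rw [f.2.1.leadingCoeff, leadingCoeff_X_pow])
    rwa [degree_eq_natDegree f.2.1.ne_zero, f.2.2] at h⟩
  invFun g := ⟨X ^ n + g.1, monic_X_pow_add (mem_degreeLT.1 g.2), by
    refine natDegree_eq_of_degree_eq_some ?_
    rw [degree_add_eq_left_of_degree_lt, degree_X_pow]
    rw [degree_X_pow]; exact mem_degreeLT.1 g.2⟩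
  left_inv f := by simp
  right_inv g := by simp

theorem finite_monicDeg (n : ℕ) : (monicDeg F n).Finite :=
  have := finite_degreeLT (F := F) n
  Set.finite_coe_iff.1 (Finite.of_equiv _ (monicDegEquiv n).symm)

theorem ncard_monicDeg (n : ℕ) : (monicDeg F n).ncard = Fintype.card F ^ n := by
  rw [← Nat.card_coe_set_eq, Nat.card_congr (monicDegEquiv n), card_degreeLT]

/-- The monic polynomials of degree `n`, as a finite set. -/
noncomputable def monics (F : Type*) [Field F] [Fintype F] (n : ℕ) : Finset F[X] :=
  (finite_monicDeg n).toFinset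

theorem mem_monics {n : ℕ} {f : F[X]} : f ∈ monics F n ↔ f.Monic ∧ f.natDegree = n := by
  rw [monics, Set.Finite.mem_toFinset]; rfl

theorem card_monics (n : ℕ) : (monics F n).card = Fintype.card F ^ n := by
  rw [monics, ← Set.ncard_eq_toFinset_card _ (finite_monicDeg n), ncard_monicDeg]

theorem finite_primesIn (a b : ℕ) :
    {p : F[X] | IsPrimePoly p ∧ a ≤ p.natDegree ∧ p.natDegree < b}.Finite := by
  refine Set.Finite.subset (Set.finite_iUnion fun m : Fin b => finite_monicDeg (F := F) m) ?_
  rintro p ⟨hp, -, hb⟩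
  exact Set.mem_iUnion.2 ⟨⟨p.natDegree, hb⟩, hp.1, rfl⟩

/-- The monic irreducible polynomials with degree in `[a, b)`. -/
noncomputable def primesIn (F : Type*) [Field F] [Fintype F] (a b : ℕ) : Finset F[X] :=
  (finite_primesIn a b).toFinset

theorem mem_primesIn {a b : ℕ} {p : F[X]} :
    p ∈ primesIn F a b ↔ IsPrimePoly p ∧ a ≤ p.natDegree ∧ p.natDegree < b := by
  rw [primesIn, Set.Finite.mem_toFinset]; rfl

/-- The primes of degree `m` are bounded crudely by all `q ^ m` monic polynomials, which suffices
throughout. -/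
theorem sum_primesIn_le (a b : ℕ) (f : ℕ → ℝ) (hf : ∀ m, 0 ≤ f m) :
    ∑ p ∈ primesIn F a b, f p.natDegree ≤ ∑ m ∈ Finset.Ico a b, (Fintype.card F : ℝ) ^ m * f m := by
  classical
  rw [← Finset.sum_fiberwise_of_maps_to (t := Finset.Ico a b) (g := natDegree)
    (fun p hp => Finset.mem_Ico.2 (mem_primesIn.1 hp).2)]
  refine Finset.sum_le_sum fun m _ => ?_
  rw [Finset.sum_congr rfl fun p hp => by rw [(Finset.mem_filter.1 hp).2], Finset.sum_const,
    nsmul_eq_mul]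
  refine mul_le_mul_of_nonneg_right ?_ (hf m)
  rw [← Nat.cast_pow, ← card_monics]
  exact_mod_cast Finset.card_le_card fun p hp => mem_monics.2
    ⟨(mem_primesIn.1 (Finset.mem_filter.1 hp).1).1.1, (Finset.mem_filter.1 hp).2⟩

theorem isCoprime_of_isPrimePoly {p p' : F[X]} (hp : IsPrimePoly p) (hp' : IsPrimePoly p')
    (h : p ≠ p') : IsCoprime p p' :=
  hp.2.coprime_iff_not_dvd.2 fun hd =>
    h (eq_of_monic_of_associated hp.1 hp'.1 ((hp.2.dvd_irreducible_iff_associated hp'.2).1 hd))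

theorem prod_dvd_iff_of_isPrimePoly {D : Finset F[X]} (hD : ∀ p ∈ D, IsPrimePoly p) (f : F[X]) :
    ∏ p ∈ D, p ∣ f ↔ ∀ p ∈ D, p ∣ f :=
  ⟨fun h _ hp => (Finset.dvd_prod_of_mem _ hp).trans h, fun h => Finset.prod_dvd_of_coprime
    (fun _ hp _ hp' hne => isCoprime_of_isPrimePoly (hD _ hp) (hD _ hp') hne) h⟩

theorem monic_prod_of_isPrimePoly {D : Finset F[X]} (hD : ∀ p ∈ D, IsPrimePoly p) :
    (∏ p ∈ D, p).Monic := monic_prod_of_monic _ _ fun p hp => (hD p hp).1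

theorem natDegree_prod_of_isPrimePoly {D : Finset F[X]} (hD : ∀ p ∈ D, IsPrimePoly p) :
    (∏ p ∈ D, p).natDegree = ∑ p ∈ D, p.natDegree :=
  natDegree_prod_of_monic _ _ fun p hp => (hD p hp).1

theorem PolyTranslates.IsPrimePoly.natDegree_pos {p : F[X]} (hp : IsPrimePoly p) : 0 < p.natDegree :=
  hp.2.natDegree_pos

theorem exists_isPrimePoly_dvd {f : F[X]} (hf : f ≠ 0) (hu : ¬ IsUnit f) :
    ∃ p, IsPrimePoly p ∧ p ∣ f := by
  classical
  obtain ⟨p, hp⟩ := UniqueFactorizationMonoid.exists_mem_normalizedFactors hf hu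
  rw [Polynomial.mem_normalizedFactors_iff hf] at hp
  exact ⟨p, ⟨hp.2.1, hp.1⟩, hp.2.2⟩

theorem PolyTranslates.IsPrimePoly.eq_of_dvd {p p' : F[X]} (hp : IsPrimePoly p) (hp' : IsPrimePoly p')
    (h : p ∣ p') : p = p' :=
  eq_of_monic_of_associated hp.1 hp'.1 ((hp.2.dvd_irreducible_iff_associated hp'.2).1 h)

open Classical in
theorem card_monics_filter_dvd {g : F[X]} (hg : g.Monic) (m : ℕ) :
    (((monics F m).filter (g ∣ ·)).card : ℝ)
      = if g.natDegree ≤ m then (Fintype.card F : ℝ) ^ m * ((Fintype.card F : ℝ) ^ g.natDegree)⁻¹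
        else 0 := by
  have hq : (Fintype.card F : ℝ) ≠ 0 := by exact_mod_cast Fintype.card_ne_zero
  split_ifs with h
  · have : (monics F m).filter (g ∣ ·) = (monics F (m - g.natDegree)).image (g * ·) := by
      ext f
      simp only [Finset.mem_filter, Finset.mem_image, mem_monics]
      constructor
      · rintro ⟨⟨hf, hd⟩, u, rfl⟩
        have hu : u.Monic := hg.of_mul_monic_left hf
        refine ⟨u, ⟨hu, ?_⟩, rfl⟩
        rw [hg.natDegree_mul hu] at hd
        lia
      · rintro ⟨u, ⟨hu, hd⟩, rfl⟩
        exact ⟨⟨hg.mul hu, by rw [hg.natDegree_mul hu]; lia⟩, dvd_mul_right _ _⟩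
    rw [this, Finset.card_image_of_injective _ (mul_right_injective₀ hg.ne_zero), card_monics,
      Nat.cast_pow, ← div_eq_mul_inv, eq_div_iff (pow_ne_zero _ hq), ← pow_add]
    congr 1
    lia
  · rw [Finset.filter_false_of_mem, Finset.card_empty, Nat.cast_zero]
    intro f hf hd
    rw [mem_monics] at hf
    exact h (hf.2 ▸ natDegree_le_of_dvd hd hf.1.ne_zero)

/-- The weight `|p|⁻¹` of a polynomial. -/
noncomputable def invNorm (p : F[X]) : ℝ := ((Fintype.card F : ℝ) ^ p.natDegree)⁻¹

open Classical in
theorem eulerProd_eq_sum {P : Finset F[X]} {R : Type*} [CommRing R] [Algebra ℝ R] (x : R) :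
    eulerProd (invNorm (F := F)) natDegree P x
      = ∑ D ∈ P.powerset, ((-1) ^ D.card * ((Fintype.card F : ℝ) ^ ∑ p ∈ D, p.natDegree)⁻¹) •
          x ^ ∑ p ∈ D, p.natDegree := by
  simp only [eulerProd, sub_eq_add_neg, Finset.prod_one_add]
  refine Finset.sum_congr rfl fun D _ => ?_
  simp only [← neg_smul, Finset.prod_smul, Finset.prod_pow_eq_pow_sum]
  congr 1
  simp only [invNorm, ← Finset.prod_pow_eq_pow_sum, Finset.prod_neg, Finset.prod_inv_distrib]

open Classical in
-- For monic `f` of degree `m < n`, all prime factors of `f` are available, so the alternating sum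
-- over the sets `D` whose product divides `f` is `1` for `f = 1` and `0` otherwise. Sum over all
-- such `f` and count the multiples of `∏ D`.
theorem sum_powerset_primesIn {n m : ℕ} (hm : m < n) :
    ∑ D ∈ (primesIn F 0 n).powerset with ∑ p ∈ D, p.natDegree ≤ m,
      ((-1) ^ D.card * ((Fintype.card F : ℝ) ^ ∑ p ∈ D, p.natDegree)⁻¹)
      = if m = 0 then 1 else 0 := by
  have hq : (Fintype.card F : ℝ) ≠ 0 := by exact_mod_cast Fintype.card_ne_zero
  have hprime : ∀ D ∈ (primesIn F 0 n).powerset, ∀ p ∈ D, IsPrimePoly p := fun D hD p hp =>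
    (mem_primesIn.1 (Finset.mem_powerset.1 hD hp)).1
  have h1 : ∀ f ∈ monics F m, ∑ D ∈ (primesIn F 0 n).powerset with ∏ p ∈ D, p ∣ f,
      (-1 : ℝ) ^ D.card = if m = 0 then 1 else 0 := by
    intro f hf
    rw [mem_monics] at hf
    have e1 : (primesIn F 0 n).powerset.filter (fun D => ∏ p ∈ D, p ∣ f)
        = ((primesIn F 0 n).filter (· ∣ f)).powerset := by
      ext D
      simp only [Finset.mem_filter, Finset.mem_powerset]
      constructor
      · rintro ⟨hD, hd⟩ p hp
        exact Finset.mem_filter.2 ⟨hD hp, (Finset.dvd_prod_of_mem _ hp).trans hd⟩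
      · intro hD
        have hD' : D ⊆ primesIn F 0 n := hD.trans (Finset.filter_subset _ _)
        exact ⟨hD', (prod_dvd_iff_of_isPrimePoly (hprime D (Finset.mem_powerset.2 hD')) f).2
          fun p hp => (Finset.mem_filter.1 (hD hp)).2⟩
    have e2 := congrArg (Int.cast (R := ℝ))
      (Finset.sum_powerset_neg_one_pow_card (x := (primesIn F 0 n).filter (· ∣ f)))
    push_cast at e2
    rw [e1, e2]
    refine if_congr ?_ rfl rfl
    constructor
    · intro he
      by_contra hm0
      obtain ⟨p, hp, hpf⟩ := exists_isPrimePoly_dvd hf.1.ne_zero fun hu =>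
        hm0 (hf.2 ▸ natDegree_eq_zero_of_isUnit hu)
      have : p ∈ (primesIn F 0 n).filter (· ∣ f) := Finset.mem_filter.2 ⟨mem_primesIn.2
        ⟨hp, Nat.zero_le _, (hf.2 ▸ natDegree_le_of_dvd hpf hf.1.ne_zero).trans_lt hm⟩, hpf⟩
      rw [he] at this
      exact absurd this (Finset.notMem_empty _)
    · intro hm0
      have hf1 : f = 1 := hf.1.natDegree_eq_zero.1 (hf.2.trans hm0)
      refine Finset.filter_eq_empty_iff.2 fun p hp hd => ?_
      rw [hf1] at hd
      exact (mem_primesIn.1 hp).1.2.not_isUnit (isUnit_of_dvd_one hd)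
  have h2 : ∑ f ∈ monics F m, ∑ D ∈ (primesIn F 0 n).powerset with ∏ p ∈ D, p ∣ f,
      (-1 : ℝ) ^ D.card = (Fintype.card F : ℝ) ^ m * if m = 0 then 1 else 0 := by
    rw [Finset.sum_congr rfl h1, Finset.sum_const, card_monics, nsmul_eq_mul, Nat.cast_pow]
  simp only [Finset.sum_filter] at h2
  rw [Finset.sum_comm] at h2
  have h3 : ∀ D ∈ (primesIn F 0 n).powerset, ∑ f ∈ monics F m,
      (if ∏ p ∈ D, p ∣ f then (-1 : ℝ) ^ D.card else 0)
      = (Fintype.card F : ℝ) ^ m * if ∑ p ∈ D, p.natDegree ≤ m then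
        ((-1) ^ D.card * ((Fintype.card F : ℝ) ^ ∑ p ∈ D, p.natDegree)⁻¹) else 0 := by
    intro D hD
    rw [← Finset.sum_filter, Finset.sum_const, nsmul_eq_mul,
      card_monics_filter_dvd (monic_prod_of_isPrimePoly (hprime D hD)),
      natDegree_prod_of_isPrimePoly (hprime D hD)]
    split_ifs <;> ring
  rw [Finset.sum_congr rfl h3, ← Finset.mul_sum] at h2
  rw [Finset.sum_filter]
  exact mul_left_cancel₀ (pow_ne_zero m hq) h2

/-- The Euler product over all primes of degree less than `n` agrees with `1 - X` modulo `X ^ n`. -/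
theorem exists_eulerProd_primesIn_eq (n : ℕ) : ∃ D : ℝ[X],
    eulerProd (invNorm (F := F)) natDegree (primesIn F 0 n) (X : ℝ[X]) = 1 - X + X ^ n * D := by
  classical
  set A := eulerProd (invNorm (F := F)) natDegree (primesIn F 0 n) (X : ℝ[X]) with hA
  suffices h : (X : ℝ[X]) ^ n ∣ A - (1 - X) by
    obtain ⟨D, hD⟩ := h
    exact ⟨D, by rw [← hD]; ring⟩
  set t : Finset F[X] → ℝ :=
    fun D => (-1) ^ D.card * ((Fintype.card F : ℝ) ^ ∑ p ∈ D, p.natDegree)⁻¹ with ht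
  have hcoeff : ∀ m, A.coeff m = ∑ D ∈ (primesIn F 0 n).powerset,
      if ∑ p ∈ D, p.natDegree = m then t D else 0 := by
    intro m
    rw [hA, eulerProd_eq_sum, finset_sum_coeff]
    refine Finset.sum_congr rfl fun D _ => ?_
    rw [coeff_smul, coeff_X_pow, smul_eq_mul, mul_ite, mul_one, mul_zero]
    simp only [eq_comm, ht]
  -- The condition `deg ∏ D ≤ m` yields partial sums of coefficients, `1, 0, 0, …`; their
  -- differences are the coefficients `1, -1, 0, …` of `1 - X`.
  have hpartial : ∀ m, m < n → ∑ j ∈ Finset.range (m + 1), A.coeff j = if m = 0 then 1 else 0 := by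
    intro m hm
    rw [← sum_powerset_primesIn (F := F) hm, Finset.sum_filter]
    simp only [hcoeff]
    rw [Finset.sum_comm]
    refine Finset.sum_congr rfl fun D _ => ?_
    rw [Finset.sum_ite_eq]
    simp only [Finset.mem_range, Nat.lt_succ_iff]
    rfl
  rw [X_pow_dvd_iff]
  intro m hm
  rcases m with _ | m
  · have := hpartial 0 hm
    simp at this
    simp [this]
  · have e1 := hpartial (m + 1) hm
    have e2 := hpartial m (by lia)
    rw [Finset.sum_range_succ, e2] at e1
    simp only [coeff_sub, coeff_one, coeff_X]
    rcases m with _ | m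
    · simp at e1 ⊢; linarith
    · simp at e1 ⊢; linarith

end PrimePolynomials

/-! ### The modulus `W`, its totient, and divisor sums over sets of primes. -/

section PrimeProduct

variable {F : Type*} [Field F] [Fintype F]

theorem primeProduct_eq_prod (w : ℕ) : primeProduct F w = ∏ p ∈ primesIn F 0 w, p := by
  have : {p : F[X] | IsPrimePoly p ∧ p.natDegree < w} = (primesIn F 0 w : Set F[X]) := by
    ext p; simp [mem_primesIn]
  rw [primeProduct, this, finprod_mem_coe_finset]

theorem isPrimePoly_of_mem_primesIn {a b : ℕ} {p : F[X]} (hp : p ∈ primesIn F a b) :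
    IsPrimePoly p := (mem_primesIn.1 hp).1

theorem monic_primeProduct (w : ℕ) : (primeProduct F w).Monic := by
  rw [primeProduct_eq_prod]
  exact monic_prod_of_isPrimePoly fun p hp => isPrimePoly_of_mem_primesIn hp

theorem dvd_primeProduct {w : ℕ} {p : F[X]} (hp : IsPrimePoly p) (h : p.natDegree < w) :
    p ∣ primeProduct F w := by
  rw [primeProduct_eq_prod]
  exact Finset.dvd_prod_of_mem _ (mem_primesIn.2 ⟨hp, Nat.zero_le _, h⟩)

theorem not_dvd_primeProduct {w : ℕ} {p : F[X]} (hp : IsPrimePoly p) (h : w ≤ p.natDegree) :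
    ¬ p ∣ primeProduct F w := by
  rw [primeProduct_eq_prod, Prime.dvd_finsetProd_iff hp.2.prime]
  rintro ⟨p', hp', hd⟩
  rw [mem_primesIn] at hp'
  rw [hp.eq_of_dvd hp'.1 hd] at h
  lia

theorem le_natDegree_of_dvd_of_isCoprime {w : ℕ} {p f : F[X]} (hp : IsPrimePoly p)
    (hf : IsCoprime (primeProduct F w) f) (hpf : p ∣ f) : w ≤ p.natDegree := by
  by_contra h
  exact hp.2.not_isUnit (hf.isUnit_of_dvd' (dvd_primeProduct hp (not_le.1 h)) hpf)

theorem natDegree_primeProduct_pos {w : ℕ} (hw : 2 ≤ w) : 0 < (primeProduct F w).natDegree :=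
  IsPrimePoly.natDegree_pos (p := X) ⟨monic_X, irreducible_X⟩ |>.trans_le <|
    natDegree_le_of_dvd (dvd_primeProduct ⟨monic_X, irreducible_X⟩ (by rw [natDegree_X]; lia))
      (monic_primeProduct w).ne_zero

/-- The Chinese remainder theorem splits the unit group, and each quotient by a prime is a field. -/
theorem polyTotient_prod {D : Finset F[X]} (hD : ∀ p ∈ D, IsPrimePoly p) :
    (polyTotient (∏ p ∈ D, p) : ℝ) = ∏ p ∈ D, ((Fintype.card F : ℝ) ^ p.natDegree - 1) := by
  classical
  have hcop : Pairwise fun i j : D => IsCoprime (i : F[X]) (j : F[X]) := fun i j h =>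
    isCoprime_of_isPrimePoly (hD _ i.2) (hD _ j.2) fun h' => h (Subtype.ext h')
  have hspan : Ideal.span {∏ p ∈ D, p} = ⨅ p : D, Ideal.span {(p : F[X])} := by
    rw [Ideal.iInf_span_singleton hcop, Finset.prod_coe_sort D fun p => p]
  have hcop' : Pairwise (Function.onFun IsCoprime fun p : D => Ideal.span {(p : F[X])}) :=
    fun i j h => (Ideal.isCoprime_span_singleton_iff _ _).2 (hcop h)
  have e : (F[X] ⧸ Ideal.span {∏ p ∈ D, p})ˣ ≃ ∀ p : D, (F[X] ⧸ Ideal.span {(p : F[X])})ˣ :=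
    ((Units.mapEquiv ((Ideal.quotEquivOfEq hspan).trans
      (Ideal.quotientInfRingEquivPiQuotient _ hcop')).toMulEquiv).trans MulEquiv.piUnits).toEquiv
  rw [polyTotient, Nat.card_congr e, Nat.card_pi, Nat.cast_prod, ← Finset.prod_coe_sort D]
  refine Finset.prod_congr rfl fun p _ => ?_
  have hp := hD p p.2
  have : Fact (Irreducible (p : F[X])) := ⟨hp.2⟩
  have : Finite (F[X] ⧸ Ideal.span {(p : F[X])}) := finite_adjoinRoot hp.1
  have hmax : (Ideal.span {(p : F[X])}).IsMaximal :=
    PrincipalIdealRing.isMaximal_of_irreducible hp.2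
  let _ := Ideal.Quotient.field (Ideal.span {(p : F[X])})
  have hcard : Nat.card (F[X] ⧸ Ideal.span {(p : F[X])}) = Fintype.card F ^ (p : F[X]).natDegree := by
    rw [Module.natCard_eq_pow_finrank (K := F), finrank_quotient_span_eq_natDegree,
      Nat.card_eq_fintype_card]
  have h1 : 1 ≤ Fintype.card F ^ (p : F[X]).natDegree := Nat.one_le_pow _ _ Fintype.card_pos
  rw [Nat.card_units, hcard, Nat.cast_sub h1]
  push_cast
  rfl

theorem polyNorm_pos (f : F[X]) : 0 < polyNorm f := by
  have : (0 : ℝ) < Fintype.card F := by exact_mod_cast Fintype.card_pos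
  unfold polyNorm; positivity

theorem two_le_card : (2 : ℝ) ≤ Fintype.card F := by
  exact_mod_cast Fintype.one_lt_card (α := F)

theorem invNorm_pos (p : F[X]) : 0 < invNorm p := by
  have := two_le_card (F := F)
  unfold invNorm; positivity

theorem totient_div_norm (w : ℕ) :
    (polyTotient (primeProduct F w) : ℝ) / polyNorm (primeProduct F w)
      = eulerProd (invNorm (F := F)) natDegree (primesIn F 0 w) (1 : ℝ) := by
  have hD : ∀ p ∈ primesIn F 0 w, IsPrimePoly p := fun p hp => isPrimePoly_of_mem_primesIn hp
  have hq : (Fintype.card F : ℝ) ≠ 0 := by exact_mod_cast Fintype.card_ne_zero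
  rw [primeProduct_eq_prod, polyTotient_prod hD, polyNorm, natDegree_prod_of_isPrimePoly hD,
    ← Finset.prod_pow_eq_pow_sum, ← Finset.prod_div_distrib, eulerProd]
  refine Finset.prod_congr rfl fun p _ => ?_
  rw [invNorm, one_pow, smul_eq_mul, mul_one, sub_div, div_self (pow_ne_zero _ hq), one_div]

theorem invNorm_lt_one {p : F[X]} (hp : IsPrimePoly p) : invNorm p < 1 := by
  have := two_le_card (F := F)
  unfold invNorm
  exact inv_lt_one_of_one_lt₀ (one_lt_pow₀ (by linarith) hp.natDegree_pos.ne')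

theorem totient_div_norm_pos (w : ℕ) :
    0 < (polyTotient (primeProduct F w) : ℝ) / polyNorm (primeProduct F w) := by
  rw [totient_div_norm]
  refine Finset.prod_pos fun p hp => ?_
  simpa using invNorm_lt_one (isPrimePoly_of_mem_primesIn hp)

theorem totient_div_norm_le_one (w : ℕ) :
    (polyTotient (primeProduct F w) : ℝ) / polyNorm (primeProduct F w) ≤ 1 := by
  rw [totient_div_norm]
  refine Finset.prod_le_one (fun p hp => ?_) fun p hp => ?_
  · simpa using (invNorm_lt_one (isPrimePoly_of_mem_primesIn hp)).le
  · simpa using (invNorm_pos p).le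

theorem polyMoebius_eq_moebius (d : F[X]) :
    polyMoebius d = (UniqueFactorizationMonoid.moebius d : ℝ) := by
  rw [polyMoebius, UniqueFactorizationMonoid.moebius]
  split_ifs <;> simp

theorem polyMoebius_prod {D : Finset F[X]} (hD : ∀ p ∈ D, IsPrimePoly p) :
    polyMoebius (∏ p ∈ D, p) = (-1) ^ D.card := by
  classical
  rw [polyMoebius_eq_moebius]
  induction D using Finset.induction_on with
  | empty => simp
  | insert p D hp ih =>
    have hrel : IsRelPrime p (∏ p ∈ D, p) := by
      refine (IsCoprime.prod_right fun p' hp' => isCoprime_of_isPrimePoly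
        (hD p (Finset.mem_insert_self _ _)) (hD p' (Finset.mem_insert_of_mem hp')) ?_).isRelPrime
      rintro rfl
      exact hp hp'
    rw [Finset.prod_insert hp, hrel.moebius_mul,
      (hD p (Finset.mem_insert_self _ _)).2.moebius_eq, Int.cast_mul,
      ih fun p' hp' => hD p' (Finset.mem_insert_of_mem hp'), Finset.card_insert_of_notMem hp]
    push_cast
    ring

theorem polyMoebius_of_not_squarefree {d : F[X]} (hd : ¬ Squarefree d) : polyMoebius d = 0 := by
  rw [polyMoebius, if_neg hd]

open Classical in
theorem exists_finset_prod_eq_of_squarefree {d : F[X]} (hm : d.Monic) (hd : Squarefree d) :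
    ∃ D : Finset F[X], (∀ p ∈ D, IsPrimePoly p) ∧ ∏ p ∈ D, p = d := by
  have h0 := hm.ne_zero
  have hnd := (UniqueFactorizationMonoid.squarefree_iff_nodup_normalizedFactors h0).1 hd
  refine ⟨(UniqueFactorizationMonoid.normalizedFactors d).toFinset, fun p hp => ?_, ?_⟩
  · rw [Multiset.mem_toFinset, Polynomial.mem_normalizedFactors_iff h0] at hp
    exact ⟨hp.2.1, hp.1⟩
  · change (Finset.prod _ id) = d
    have := leadingCoeff_mul_prod_normalizedFactors d
    rw [hm.leadingCoeff, C_1, one_mul] at this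
    rw [← Finset.prod_val, Multiset.toFinset_val, hnd.dedup, this]

open Classical in
theorem prod_injOn_isPrimePoly {D D' : Finset F[X]} (hD : ∀ p ∈ D, IsPrimePoly p)
    (hD' : ∀ p ∈ D', IsPrimePoly p) (h : ∏ p ∈ D, p = ∏ p ∈ D', p) : D = D' := by
  have key : ∀ {D D' : Finset F[X]}, (∀ p ∈ D, IsPrimePoly p) → (∀ p ∈ D', IsPrimePoly p) →
      ∏ p ∈ D, p = ∏ p ∈ D', p → D ⊆ D' := by
    intro D D' hD hD' h p hp
    have hd : p ∣ ∏ p ∈ D', p := h ▸ Finset.dvd_prod_of_mem _ hp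
    rw [Prime.dvd_finsetProd_iff (hD p hp).2.prime] at hd
    obtain ⟨p', hp', hd⟩ := hd
    rwa [(hD p hp).eq_of_dvd (hD' p' hp') hd]
  exact Finset.Subset.antisymm (key hD hD' h) (key hD' hD h.symm)

open Classical in
/-- The divisor sum as a sum over sets of primes, for arguments coprime to `W`. -/
theorem divisorSum_eq_sum {G : ℝ → ℝ} (hG : ∀ t, 1 ≤ t → G t = 0) {r : ℝ} (hr : 0 < r) {n w : ℕ}
    (hrn : r ≤ n) {f : F[X]} (hf : IsCoprime (primeProduct F w) f) :
    divisorSum G r f = ∑ D : Finset (primesIn F w n), if ∀ p ∈ D, (p : F[X]) ∣ f then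
      (-1) ^ D.card * G (((∑ p ∈ D, (p : F[X]).natDegree : ℕ) : ℝ) / r) else 0 := by
  have hprime : ∀ D : Finset (primesIn F w n),
      ∀ p ∈ D.map (Function.Embedding.subtype (· ∈ primesIn F w n)), IsPrimePoly p := by
    intro D p hp
    obtain ⟨p', -, rfl⟩ := Finset.mem_map.1 hp
    exact isPrimePoly_of_mem_primesIn p'.2
  let pr : Finset (primesIn F w n) → F[X] := fun D =>
    ∏ p ∈ D.map (Function.Embedding.subtype (· ∈ primesIn F w n)), p
  have hinj : Function.Injective pr := fun D D' h =>
    Finset.map_injective _ (prod_injOn_isPrimePoly (hprime D) (hprime D') h)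
  let T : Finset (Finset (primesIn F w n)) := Finset.univ.filter fun D => ∀ p ∈ D, (p : F[X]) ∣ f
  have hdvd : ∀ D, pr D ∣ f ↔ ∀ p ∈ D, (p : F[X]) ∣ f := by
    intro D
    simp only [pr]
    rw [prod_dvd_iff_of_isPrimePoly (hprime D)]
    simp
  have hdeg : ∀ D, (pr D).natDegree = ∑ p ∈ D, (p : F[X]).natDegree := fun D => by
    simp only [pr]
    rw [natDegree_prod_of_isPrimePoly (hprime D), Finset.sum_map]
    rfl
  have hmu : ∀ D, polyMoebius (pr D) = (-1) ^ D.card := fun D => by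
    simp only [pr]
    rw [polyMoebius_prod (hprime D), Finset.card_map]
  rw [divisorSum, finsum_mem_eq_sum_of_inter_support_eq (t := T.image pr), Finset.sum_image
    (fun _ _ _ _ h => hinj h), ← Finset.sum_filter]
  · exact Finset.sum_congr rfl fun D _ => by rw [hmu, hdeg]
  · ext d
    simp only [Set.mem_inter_iff, Set.mem_ofPred_eq, Function.mem_support, Finset.coe_image,
      Set.mem_image, Finset.mem_coe, and_congr_left_iff]
    intro hd
    constructor
    · rintro ⟨hm, hdf⟩
      have hsq : Squarefree d := by
        by_contra h
        exact hd (by rw [polyMoebius_of_not_squarefree h, zero_mul])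
      -- A contributing divisor has degree below `r ≤ n`, so its primes have degree less than `n`;
      -- coprimality with `W` gives degree at least `w`.
      have hlt : (d.natDegree : ℝ) < r := by
        by_contra h
        exact hd (by rw [hG _ (by rwa [le_div_iff₀ hr, one_mul, ← not_lt]), mul_zero])
      obtain ⟨D, hD, rfl⟩ := exists_finset_prod_eq_of_squarefree hm hsq
      have hDP : ∀ p ∈ D, p ∈ primesIn F w n := by
        intro p hp
        have hpd := Finset.dvd_prod_of_mem (fun p => p) hp
        refine mem_primesIn.2 ⟨hD p hp,
          le_natDegree_of_dvd_of_isCoprime (hD p hp) hf (hpd.trans hdf), ?_⟩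
        have h1 : p.natDegree ≤ _ := natDegree_le_of_dvd hpd hm.ne_zero
        have h2 : ((∏ p ∈ D, p : F[X]).natDegree : ℝ) < n := hlt.trans_le hrn
        exact h1.trans_lt (by exact_mod_cast h2)
      refine ⟨D.subtype (· ∈ primesIn F w n), ?_, ?_⟩
      · simp only [T, Finset.mem_filter, Finset.mem_univ, true_and, Finset.mem_subtype]
        exact fun p hp => (Finset.dvd_prod_of_mem _ hp).trans hdf
      · simp only [pr, Finset.subtype_map_of_mem hDP]
    · rintro ⟨D, hD, rfl⟩
      exact ⟨monic_prod_of_isPrimePoly (hprime D), (hdvd D).2 (Finset.mem_filter.1 hD).2⟩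

end PrimeProduct

/-! ### Normalized averages. -/

section Mean

theorem mean_const {α : Type*} [Finite α] [Nonempty α] (c : ℝ) : mean (fun _ : α => c) = c := by
  have := Fintype.ofFinite α
  rw [mean_eq, Finset.sum_const, Finset.card_univ, nsmul_eq_mul]
  field_simp

theorem mean_const_mul {α : Type*} [Finite α] (c : ℝ) (f : α → ℝ) :
    mean (fun x => c * f x) = c * mean f := by
  have := Fintype.ofFinite α
  rw [mean_eq, mean_eq, ← Finset.mul_sum, mul_div_assoc]

theorem mean_sum {α β : Type*} [Finite α] (s : Finset β) (f : β → α → ℝ) :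
    mean (fun x => ∑ b ∈ s, f b x) = ∑ b ∈ s, mean (f b) := by
  have := Fintype.ofFinite α
  simp only [mean_eq]
  rw [Finset.sum_comm, Finset.sum_div]

theorem mean_mono {α : Type*} [Finite α] {f g : α → ℝ} (h : ∀ x, f x ≤ g x) : mean f ≤ mean g := by
  have := Fintype.ofFinite α
  rw [mean_eq, mean_eq]
  exact div_le_div_of_nonneg_right (Finset.sum_le_sum fun x _ => h x) (Nat.cast_nonneg _)

theorem abs_mean_sub_le {α : Type*} [Finite α] [Nonempty α] {f : α → ℝ} {c κ : ℝ}
    (h : ∀ x, |f x - c| ≤ κ) : |mean f - c| ≤ κ := by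
  rw [abs_le]
  constructor
  · have := mean_mono (f := fun _ => c - κ) (g := f) fun x => by linarith [(abs_le.1 (h x)).1]
    rw [mean_const] at this
    linarith
  · have := mean_mono (f := f) (g := fun _ => c + κ) fun x => by linarith [(abs_le.1 (h x)).2]
    rw [mean_const] at this
    linarith

theorem mean_indicator_eq {α : Type*} [Finite α] (a : α) [DecidablePred (· = a)] :
    mean (fun x : α => if x = a then (1 : ℝ) else 0) = (Nat.card α : ℝ)⁻¹ := by
  classical
  have := Fintype.ofFinite α
  rw [mean_eq, Nat.card_eq_fintype_card, inv_eq_one_div]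
  congr 1
  rw [Finset.sum_eq_single a (fun b _ hb => if_neg hb) (by simp), if_pos rfl]

/-- All fibres are cosets of the kernel: a set-theoretic section identifies `A` with `B × φ.ker`. -/
theorem mean_comp_surjective {A B : Type*} [AddCommGroup A] [AddCommGroup B] [Finite A]
    (φ : A →+ B) (hφ : Function.Surjective φ) (g : B → ℝ) :
    mean (fun a => g (φ a)) = mean g := by
  have := Fintype.ofFinite A
  have hB := Finite.of_surjective φ hφ
  have := Fintype.ofFinite B
  have := Fintype.ofFinite φ.ker
  choose s hs using hφ
  let e : A ≃ B × φ.ker :=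
    { toFun := fun a => (φ a, ⟨a - s (φ a), by rw [AddMonoidHom.mem_ker, map_sub, hs, sub_self]⟩)
      invFun := fun x => s x.1 + x.2
      left_inv := fun a => by simp
      right_inv := fun x => by
        have : φ x.2 = 0 := x.2.2
        ext <;> simp [hs, this] }
  have hsum : ∑ a, g (φ a) = ∑ x : B × φ.ker, g x.1 := Fintype.sum_equiv e _ _ fun a => rfl
  rw [mean_eq, mean_eq, Fintype.card_congr e, Fintype.card_prod, hsum, Fintype.sum_prod_type]
  simp only [Finset.sum_const, Finset.card_univ, nsmul_eq_mul]
  rw [← Finset.mul_sum, Nat.cast_mul, mul_comm]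
  have : (Fintype.card φ.ker : ℝ) ≠ 0 := by exact_mod_cast Fintype.card_ne_zero
  rw [mul_div_mul_right _ _ this]

theorem mean_pi_prod {I : Type*} [Fintype I] {B : I → Type*} [∀ i, Finite (B i)]
    (f : ∀ i, B i → ℝ) : mean (fun x : ∀ i, B i => ∏ i, f i (x i)) = ∏ i, mean (f i) := by
  classical
  have := fun i => Fintype.ofFinite (B i)
  simp only [mean_eq]
  rw [Finset.prod_div_distrib, Finset.prod_univ_sum, Fintype.piFinset_univ, Fintype.card_pi]
  push_cast
  rfl

/-- If all averages over translates are close to `c` then so is the average. -/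
theorem abs_mean_sub_le_of_translates {A V : Type*} [AddCommGroup A] [Finite A] [Finite V]
    [Nonempty V] (j : V → A) (g : A → ℝ) {c κ : ℝ}
    (h : ∀ x, |mean (fun v => g (x + j v)) - c| ≤ κ) : |mean g - c| ≤ κ := by
  have := Fintype.ofFinite A
  have := Fintype.ofFinite V
  have hmean : mean g = mean fun x => mean fun v => g (x + j v) := by
    have h1 : ∀ v, mean (fun x => g (x + j v)) = mean g := fun v => by
      have : ∑ x, g (x + j v) = ∑ x, g x := Fintype.sum_equiv (Equiv.addRight (j v)) _ _ fun x => rfl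
      rw [mean_eq, mean_eq, this]
    have h2 : mean (fun x => mean fun v => g (x + j v)) = mean fun v => mean fun x => g (x + j v) := by
      simp only [mean_eq]
      rw [← Finset.sum_div, ← Finset.sum_div, Finset.sum_comm, div_right_comm]
    rw [h2]
    simp only [h1, mean_const]
  rw [hmean]
  exact abs_mean_sub_le h

end Mean

/-! ### Solution counts for one or two affine equations over a finite field. -/

section LocalProbability

variable {K : Type*} [Field K] [Finite K] {κ : Type*} [Fintype κ]

open Classical in
theorem mean_linear_eq_zero (c : κ → K) (a u : K) (hu : u ≠ 0) (hc : ∃ k, c k ≠ 0) :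
    mean (fun y : κ → K => if u * ∑ k, c k * y k + a = 0 then (1 : ℝ) else 0)
      = (Nat.card K : ℝ)⁻¹ := by
  obtain ⟨k, hk⟩ := hc
  let φ : (κ → K) →+ K :=
    { toFun := fun y => u * ∑ k, c k * y k
      map_zero' := by simp
      map_add' := fun x y => by simp [mul_add, Finset.sum_add_distrib] }
  have hφ : Function.Surjective φ := fun z => ⟨Pi.single k (z / (u * c k)), by
    change u * ∑ j, c j * (Pi.single k (z / (u * c k)) : κ → K) j = z
    rw [Finset.sum_eq_single k (fun j _ hj => by rw [Pi.single_eq_of_ne hj, mul_zero]) (by simp),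
      Pi.single_eq_same]
    field_simp⟩
  have := mean_comp_surjective φ hφ (fun z => if z + a = 0 then (1 : ℝ) else 0)
  refine this.trans ?_
  simp only [add_eq_zero_iff_eq_neg]
  exact mean_indicator_eq (-a)

open Classical in
-- A nonzero two by two minor makes the pair of forms surjective onto `K × K`; Cramer's rule in the
-- variables `k, k'` gives the preimages.
theorem mean_linear_pair_eq_zero (c c' : κ → K) (a a' u : K) (hu : u ≠ 0)
    (hc : ∃ k k', c k * c' k' - c k' * c' k ≠ 0) :
    mean (fun y : κ → K => if u * ∑ k, c k * y k + a = 0 ∧ u * ∑ k, c' k * y k + a' = 0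
      then (1 : ℝ) else 0) = ((Nat.card K : ℝ)⁻¹) ^ 2 := by
  obtain ⟨k, k', hk⟩ := hc
  let φ : (κ → K) →+ K × K :=
    { toFun := fun y => (u * ∑ k, c k * y k, u * ∑ k, c' k * y k)
      map_zero' := by simp
      map_add' := fun x y => by simp [mul_add, Finset.sum_add_distrib] }
  have hφ : Function.Surjective φ := by
    rintro ⟨z, z'⟩
    set Δ := c k * c' k' - c k' * c' k with hΔ
    refine ⟨Pi.single k ((z * c' k' - z' * c k') / (u * Δ)) +
      Pi.single k' ((c k * z' - c' k * z) / (u * Δ)), ?_⟩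
    have hsum : ∀ (c : κ → K) (s t : K),
        ∑ j, c j * (Pi.single k s + Pi.single k' t : κ → K) j = c k * s + c k' * t := by
      intro c s t
      simp only [Pi.add_apply, mul_add, Finset.sum_add_distrib]
      congr 1
      · rw [Finset.sum_eq_single k (fun j _ hj => by rw [Pi.single_eq_of_ne hj, mul_zero])
          (by simp), Pi.single_eq_same]
      · rw [Finset.sum_eq_single k' (fun j _ hj => by rw [Pi.single_eq_of_ne hj, mul_zero])
          (by simp), Pi.single_eq_same]
    change (u * _, u * _) = (z, z')
    rw [hsum, hsum]
    ext
    · simp only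
      field_simp
      rw [hΔ]; ring
    · simp only
      field_simp
      rw [hΔ]; ring
  have := mean_comp_surjective φ hφ
    (fun z => if z.1 + a = 0 ∧ z.2 + a' = 0 then (1 : ℝ) else 0)
  refine this.trans ?_
  have e : ∀ z : K × K, (z.1 + a = 0 ∧ z.2 + a' = 0) ↔ z = (-a, -a') := fun z => by
    rw [add_eq_zero_iff_eq_neg, add_eq_zero_iff_eq_neg, Prod.ext_iff]
  simp only [e]
  rw [mean_indicator_eq, Nat.card_prod, Nat.cast_mul, mul_inv, pow_two]

end LocalProbability

/-! ### Exact equidistribution of short polynomials modulo several primes. -/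

section Equidistribution

variable {F : Type*} [Field F] [Fintype F]

/-- Every residue system modulo `∏ p i` has a representative of degree below `N`, so reduction is a
surjective homomorphism and independence is exact. -/
theorem mean_prod_primes {κ : Type*} [Fintype κ] {I : Type*} [Fintype I] (p : I → F[X])
    (hp : ∀ i, IsPrimePoly (p i)) (hinj : Function.Injective p) {N : ℕ}
    (hN : ∑ i, (p i).natDegree ≤ N) (f : ∀ i, (κ → AdjoinRoot (p i)) → ℝ) :
    mean (fun v : κ → degreeLT F N => ∏ i, f i fun k => AdjoinRoot.mk (p i) (v k : F[X]))
      = ∏ i, mean (f i) := by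
  have := finite_degreeLT (F := F) N
  have := fun i => finite_adjoinRoot (hp i).1
  let φ : (κ → degreeLT F N) →+ ∀ i, κ → AdjoinRoot (p i) :=
    { toFun := fun v i k => AdjoinRoot.mk (p i) (v k : F[X])
      map_zero' := by ext; simp
      map_add' := fun x y => by ext; simp }
  have hφ : Function.Surjective φ := by
    intro y
    have hcop : Pairwise (Function.onFun IsCoprime fun i => Ideal.span {p i}) := fun i j h =>
      (Ideal.isCoprime_span_singleton_iff _ _).2
        (isCoprime_of_isPrimePoly (hp i) (hp j) fun h' => h (hinj h'))
    have hg : ∀ k, ∃ g : F[X], ∀ i, AdjoinRoot.mk (p i) g = y i k := fun k =>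
      Ideal.pi_quotient_surjective hcop fun i => y i k
    choose g hg using hg
    have hm : (∏ i, p i).Monic := monic_prod_of_monic _ _ fun i _ => (hp i).1
    refine ⟨fun k => ⟨g k %ₘ ∏ i, p i, mem_degreeLT.2 ?_⟩, ?_⟩
    · refine (degree_modByMonic_lt _ hm).trans_le ?_
      rw [degree_eq_natDegree hm.ne_zero, natDegree_prod_of_monic _ _ fun i _ => (hp i).1]
      exact_mod_cast hN
    · ext i k
      change AdjoinRoot.mk (p i) (g k %ₘ ∏ i, p i) = y i k
      rw [← hg k i, AdjoinRoot.mk_eq_mk, modByMonic_eq_sub_mul_div]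
      rw [sub_sub_cancel_left, dvd_neg]
      exact (Finset.dvd_prod_of_mem p (Finset.mem_univ i)).mul_right _
  exact (mean_comp_surjective φ hφ fun y => ∏ i, f i (y i)).trans (mean_pi_prod f)

open Classical in
/-- The probability that the affine forms with index in `B` all vanish modulo `p`. -/
noncomputable def localProb {κ J : Type*} [Fintype κ] (W : F[X]) (coef : J → κ → F[X])
    (a : J → F[X]) (p : F[X]) (B : Finset (J × Bool)) : ℝ :=
  mean fun y : κ → AdjoinRoot p => if ∀ i ∈ B,
    AdjoinRoot.mk p W * ∑ k, AdjoinRoot.mk p (coef i.1 k) * y k + AdjoinRoot.mk p (a i.1) = 0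
    then 1 else 0

theorem card_adjoinRoot {p : F[X]} (hp : p.Monic) :
    Nat.card (AdjoinRoot p) = Fintype.card F ^ p.natDegree := by
  have : Module.Finite F (AdjoinRoot p) := Monic.finite_adjoinRoot hp
  have h : Module.finrank F (AdjoinRoot p) = p.natDegree := finrank_quotient_span_eq_natDegree
  rw [Module.natCard_eq_pow_finrank (K := F), h, Nat.card_eq_fintype_card]

/-- Conditions under which affine forms are in general position at `p`. -/
structure GeneralPosition {κ J : Type*} (coef : J → κ → F[X]) (a : J → F[X]) (p : F[X]) :
    Prop where
  ne_zero : ∀ t, ∃ k, ¬ p ∣ coef t k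
  pair : ∀ t t', t ≠ t' → (∃ k k', ¬ p ∣ coef t k * coef t' k' - coef t k' * coef t' k) ∨
    (coef t = coef t' ∧ ¬ p ∣ a t - a t')

/-- If `B` involves two different forms, either these are independent modulo `p` and vanish together
with probability `|p| ^ (-2)`, or they differ by a constant not divisible by `p` and never vanish
together. -/
theorem localDensity_localProb {κ J : Type*} [Fintype κ] [DecidableEq J] {W : F[X]}
    {coef : J → κ → F[X]} {a : J → F[X]} {p : F[X]} (hp : IsPrimePoly p) (hW : ¬ p ∣ W)
    (h : GeneralPosition coef a p) : LocalDensity (invNorm p) (localProb W coef a p) := by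
  classical
  have : Fact (Irreducible p) := ⟨hp.2⟩
  have := finite_adjoinRoot hp.1
  have hcard : (Nat.card (AdjoinRoot p) : ℝ)⁻¹ = invNorm p := by
    rw [card_adjoinRoot hp.1, Nat.cast_pow, invNorm]
  have hne : ∀ {f : F[X]}, ¬ p ∣ f → AdjoinRoot.mk p f ≠ 0 := fun hf h' =>
    hf (AdjoinRoot.mk_eq_zero.1 h')
  refine ⟨?_, ?_, ?_⟩
  · simp [localProb, mean_const]
  · rintro B ⟨i, hi⟩ ⟨t, ht⟩
    obtain ⟨k, hk⟩ := h.ne_zero t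
    rw [← hcard, ← mean_linear_eq_zero (fun k => AdjoinRoot.mk p (coef t k))
      (AdjoinRoot.mk p (a t)) (AdjoinRoot.mk p W) (hne hW) ⟨k, hne hk⟩, localProb]
    congr 1
    ext y
    refine if_congr ⟨fun h => ht i hi ▸ h i hi, fun h j hj => ?_⟩ rfl rfl
    rw [ht j hj]
    exact h
  · intro B hBne hB
    have hnonneg : 0 ≤ localProb W coef a p B := by
      have := mean_mono (f := fun _ : κ → AdjoinRoot p => 0) (g := fun y => if ∀ i ∈ B,
        AdjoinRoot.mk p W * ∑ k, AdjoinRoot.mk p (coef i.1 k) * y k + AdjoinRoot.mk p (a i.1) = 0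
        then (1 : ℝ) else 0) fun y => by split_ifs <;> simp
      rwa [mean_const] at this
    rw [abs_of_nonneg hnonneg]
    push Not at hB
    have hpair : ∃ i ∈ B, ∃ j ∈ B, i.1 ≠ j.1 := by
      by_contra! hall
      obtain ⟨i, hi⟩ := hBne
      obtain ⟨j, hj, hne⟩ := hB i.1
      exact hne (hall j hj i hi)
    obtain ⟨i, hi, j, hj, hij⟩ := hpair
    rcases h.pair _ _ hij with ⟨k, k', hk⟩ | ⟨hc, ha⟩
    · rw [← hcard, ← mean_linear_pair_eq_zero (fun k => AdjoinRoot.mk p (coef i.1 k))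
        (fun k => AdjoinRoot.mk p (coef j.1 k)) (AdjoinRoot.mk p (a i.1))
        (AdjoinRoot.mk p (a j.1)) (AdjoinRoot.mk p W) (hne hW)
        ⟨k, k', by simpa only [map_sub, map_mul] using hne hk⟩]
      refine mean_mono fun y => ?_
      split_ifs with h1 h2
      · exact le_rfl
      · exact absurd ⟨h1 i hi, h1 j hj⟩ h2
      · exact zero_le_one
      · exact le_rfl
    · have : localProb W coef a p B = 0 := by
        refine Eq.trans ?_ (mean_const (α := κ → AdjoinRoot p) 0)
        rw [localProb]
        congr 1
        ext y
        refine if_neg fun h1 => hne ha ?_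
        have e1 := h1 i hi
        have e2 := h1 j hj
        rw [← hc] at e2
        rw [map_sub]
        linear_combination e1 - e2
      rw [this]
      positivity

/-- Exchanging the roles of primes and indices in a family of sets. -/
def transposeEquiv (A B : Type*) [Fintype A] [Fintype B] [DecidableEq A] [DecidableEq B] :
    (A → Finset B) ≃ (B → Finset A) where
  toFun β b := Finset.univ.filter fun a => b ∈ β a
  invFun γ a := Finset.univ.filter fun b => a ∈ γ b
  left_inv β := by ext; simp
  right_inv γ := by ext; simp

open Classical in
-- Primes with `β p` empty impose no condition and have local probability `1`; only the others need
-- room in the degree budget `N`.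
theorem mean_forall_dvd {κ J : Type*} [Fintype κ] {W : F[X]} {coef : J → κ → F[X]}
    {a : J → F[X]} {P : Finset F[X]} (hP : ∀ p ∈ P, IsPrimePoly p) {N : ℕ}
    (β : P → Finset (J × Bool))
    (hN : ∑ p : P, (if (β p).Nonempty then (p : F[X]).natDegree else 0) ≤ N) :
    mean (fun v : κ → degreeLT F N => if ∀ p : P, ∀ i ∈ β p,
        (p : F[X]) ∣ W * ∑ k, coef i.1 k * (v k : F[X]) + a i.1 then (1 : ℝ) else 0)
      = ∏ p : P, localProb W coef a p (β p) := by
  have hfin : ∀ p : P, Finite (AdjoinRoot (p : F[X])) := fun p => finite_adjoinRoot (hP p p.2).1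
  let I := {p : P // (β p).Nonempty}
  have hsum : ∑ i : I, (i.1 : F[X]).natDegree ≤ N := by
    rw [← Finset.sum_filter] at hN
    refine le_trans (le_of_eq ?_) hN
    exact (Finset.sum_subtype _ (by simp) fun p : P => (p : F[X]).natDegree).symm
  have key := mean_prod_primes (κ := κ) (fun i : I => (i.1 : F[X])) (fun i => hP _ i.1.2)
    (fun i j h => Subtype.ext (Subtype.ext h)) hsum fun i y => if ∀ j ∈ β i.1,
      AdjoinRoot.mk (i.1 : F[X]) W * ∑ k, AdjoinRoot.mk (i.1 : F[X]) (coef j.1 k) * y k +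
        AdjoinRoot.mk (i.1 : F[X]) (a j.1) = 0 then 1 else 0
  have hR : ∏ p : P, localProb W coef a p (β p) = ∏ i : I, localProb W coef a i.1 (β i.1) := by
    rw [← Finset.prod_subtype (Finset.univ.filter fun p : P => (β p).Nonempty) (by simp)
      fun p : P => localProb W coef a p (β p)]
    refine (Finset.prod_filter_of_ne fun p _ hp => ?_).symm
    by_contra he
    rw [Finset.not_nonempty_iff_eq_empty] at he
    have := hfin p
    exact hp (by simp [localProb, he, mean_const])
  rw [hR]
  refine Eq.trans ?_ key
  congr 1
  ext v
  have hdvd : ∀ (p : P) (j : J × Bool), ((p : F[X]) ∣ W * ∑ k, coef j.1 k * (v k : F[X]) + a j.1) ↔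
      AdjoinRoot.mk (p : F[X]) W * ∑ k, AdjoinRoot.mk (p : F[X]) (coef j.1 k) *
        AdjoinRoot.mk (p : F[X]) (v k) + AdjoinRoot.mk (p : F[X]) (a j.1) = 0 := fun p j => by
    rw [← AdjoinRoot.mk_eq_zero]
    simp only [map_add, map_mul, map_sum]
  simp only [hdvd]
  by_cases h : ∀ p : P, ∀ j ∈ β p, AdjoinRoot.mk (p : F[X]) W *
      ∑ k, AdjoinRoot.mk (p : F[X]) (coef j.1 k) * AdjoinRoot.mk (p : F[X]) (v k) +
        AdjoinRoot.mk (p : F[X]) (a j.1) = 0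
  · rw [if_pos h, Finset.prod_eq_one fun i _ => if_pos (h i.1)]
  · rw [if_neg h]
    push Not at h
    obtain ⟨p, j, hj, hne⟩ := h
    exact (Finset.prod_eq_zero (Finset.mem_univ (⟨p, j, hj⟩ : I))
      (if_neg fun h' => hne (h' j hj))).symm

end Equidistribution

/-! ### Expansion of correlations of divisor sums. -/

section DivisorCorrelation

/-- Choosing a set of primes for every index amounts to choosing a set of indices for every prime;
the second form suits an Euler product. -/
theorem prod_sum_forall_eq_sum_transpose {A B : Type*} [Fintype A] [Fintype B] [DecidableEq A]
    [DecidableEq B] (R : A → B → Prop) [∀ a b, Decidable (R a b)] (s : Finset A → ℝ) :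
    ∏ b, ∑ D : Finset A, (if ∀ x ∈ D, R x b then s D else 0)
      = ∑ β : A → Finset B, (∏ b, s (transposeEquiv A B β b)) *
          if ∀ x, ∀ b ∈ β x, R x b then (1 : ℝ) else 0 := by
  rw [Finset.prod_univ_sum, Fintype.piFinset_univ, ← Equiv.sum_comp (transposeEquiv A B)]
  refine Finset.sum_congr rfl fun β _ => ?_
  by_cases h : ∀ x, ∀ b ∈ β x, R x b
  · rw [if_pos h, mul_one]
    refine Finset.prod_congr rfl fun b _ => if_pos fun x hx => h x b ?_
    simpa [transposeEquiv] using hx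
  · rw [if_neg h, mul_zero]
    push Not at h
    obtain ⟨x, b, hb, hne⟩ := h
    exact Finset.prod_eq_zero (Finset.mem_univ b) (if_neg fun h' => hne
      (h' x (by simpa [transposeEquiv] using hb)))

theorem prod_neg_one_pow_transpose {A B : Type*} [Fintype A] [Fintype B] [DecidableEq A]
    [DecidableEq B] (β : A → Finset B) :
    ∏ b, (-1 : ℝ) ^ (transposeEquiv A B β b).card = ∏ a, (-1 : ℝ) ^ (β a).card := by
  rw [Finset.prod_pow_eq_pow_sum, Finset.prod_pow_eq_pow_sum]
  congr 1
  simp only [Finset.card_eq_sum_ones, transposeEquiv, Equiv.coe_fn_mk, Finset.sum_filter]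
  rw [Finset.sum_comm]
  refine Finset.sum_congr rfl fun a _ => ?_
  rw [Finset.sum_ite_mem, Finset.univ_inter]

variable {F : Type*} [Field F] [Fintype F]

open Classical in
/-- The average of a product of squared divisor sums along affine forms, as a sum over families of
sets of primes. -/
theorem mean_prod_divisorSum_sq {κ J : Type*} [Fintype κ] [Fintype J] {G : ℝ → ℝ}
    (hG : ∀ t, 1 ≤ t → G t = 0) {r : ℝ} (hr : 0 < r) {n w N : ℕ} (hrn : r ≤ n)
    {coef : J → κ → F[X]} {a : J → F[X]}
    (ha : ∀ t, IsCoprime (primeProduct F w) (a t)) (hN : 2 * Fintype.card J * r ≤ N) :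
    mean (fun v : κ → degreeLT F N => ∏ t, divisorSum G r
        (primeProduct F w * ∑ k, coef t k * (v k : F[X]) + a t) ^ 2)
      = ∑ β : primesIn F w n → Finset (J × Bool),
        (∏ p : primesIn F w n, (-1) ^ (β p).card * localProb (primeProduct F w) coef a p (β p)) *
          ∏ i, G (((∑ p : primesIn F w n, if i ∈ β p then (p : F[X]).natDegree else 0 : ℕ) : ℝ) / r)
      := by
  have := finite_degreeLT (F := F) N
  have hΛ := fun (f : F[X]) (hf : IsCoprime (primeProduct F w) f) =>
    divisorSum_eq_sum hG hr hrn hf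
  generalize primeProduct F w = W at *
  have hprime : ∀ p ∈ primesIn F w n, IsPrimePoly p := fun p hp => isPrimePoly_of_mem_primesIn hp
  generalize primesIn F w n = P at *
  have hcop : ∀ (v : κ → degreeLT F N) (t : J),
      IsCoprime W (W * ∑ k, coef t k * (v k : F[X]) + a t) := fun v t =>
    by simpa [IsCoprime.mul_add_left_right_iff] using ha t
  let deg : Finset P → ℝ := fun D => G (((∑ p ∈ D, (p : F[X]).natDegree : ℕ) : ℝ) / r)
  have hexp : ∀ v : κ → degreeLT F N, ∏ t, divisorSum G r
        (W * ∑ k, coef t k * (v k : F[X]) + a t) ^ 2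
      = ∑ β : P → Finset (J × Bool), (∏ i, ((-1) ^ (transposeEquiv P (J × Bool) β i).card *
          deg (transposeEquiv P (J × Bool) β i))) * if ∀ p : P, ∀ i ∈ β p,
        (p : F[X]) ∣ W * ∑ k, coef i.1 k * (v k : F[X]) + a i.1 then (1 : ℝ) else 0 := by
    intro v
    have h1 : ∏ t, divisorSum G r (W * ∑ k, coef t k * (v k : F[X]) + a t) ^ 2
        = ∏ i : J × Bool, divisorSum G r (W * ∑ k, coef i.1 k * (v k : F[X]) + a i.1) := by
      rw [Fintype.prod_prod_type]
      simp only [Fintype.prod_bool, pow_two]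
    rw [h1]
    have hstep := fun i : J × Bool => hΛ _ (hcop v i.1)
    refine (Finset.prod_congr rfl fun i _ => hstep i).trans ?_
    exact prod_sum_forall_eq_sum_transpose (A := P) (B := J × Bool)
      (fun p i => (p : F[X]) ∣ W * ∑ k, coef i.1 k * (v k : F[X]) + a i.1)
      fun D => (-1) ^ D.card * deg D
  simp only [hexp]
  rw [mean_sum]
  refine Finset.sum_congr rfl fun β _ => ?_
  rw [mean_const_mul, Finset.prod_mul_distrib, Finset.prod_mul_distrib]
  have hsign := prod_neg_one_pow_transpose β
  have hdeg : ∀ i, deg (transposeEquiv P (J × Bool) β i)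
      = G (((∑ p : P, if i ∈ β p then (p : F[X]).natDegree else 0 : ℕ) : ℝ) / r) := by
    intro i
    simp only [deg, transposeEquiv, Equiv.coe_fn_mk, Finset.sum_filter]
  simp only [hdeg, hsign]
  -- A nonzero weight forces every index to carry primes of total degree at most `r`. The primes
  -- involved then have total degree at most `2 T r ≤ N`, with `T` the cardinality of `J`, so the
  -- exact count applies.
  by_cases hz : ∏ i, G (((∑ p : P, if i ∈ β p then (p : F[X]).natDegree else 0 : ℕ) : ℝ) / r) = 0
  · rw [hz, mul_zero, mul_zero, zero_mul]
  · rw [← ne_eq, Finset.prod_ne_zero_iff] at hz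
    have hlt : ∀ i : J × Bool,
        ((∑ p : P, if i ∈ β p then (p : F[X]).natDegree else 0 : ℕ) : ℝ) ≤ r := by
      intro i
      by_contra h
      exact hz i (Finset.mem_univ i) (hG _ (by rw [le_div_iff₀ hr, one_mul]; linarith))
    have hsum : ∑ p : P, (if (β p).Nonempty then (p : F[X]).natDegree else 0) ≤ N := by
      have h1 : ∑ p : P, (if (β p).Nonempty then (p : F[X]).natDegree else 0)
          ≤ ∑ i : J × Bool, ∑ p : P, if i ∈ β p then (p : F[X]).natDegree else 0 := by
        rw [Finset.sum_comm]
        refine Finset.sum_le_sum fun p _ => ?_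
        split_ifs with h
        · obtain ⟨i, hi⟩ := h
          refine le_trans (by rw [if_pos hi]) (Finset.single_le_sum
            (f := fun i => if i ∈ β p then (p : F[X]).natDegree else 0)
            (fun _ _ => Nat.zero_le _) (Finset.mem_univ i))
        · exact Nat.zero_le _
      have h2 : ((∑ i : J × Bool, ∑ p : P, if i ∈ β p then (p : F[X]).natDegree else 0 : ℕ) : ℝ)
          ≤ 2 * Fintype.card J * r := by
        rw [Nat.cast_sum]
        refine (Finset.sum_le_sum fun i _ => hlt i).trans_eq ?_
        simp [mul_comm]
      exact_mod_cast (Nat.cast_le.2 h1).trans (h2.trans hN)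
    rw [← mean_forall_dvd hprime β hsum, mul_right_comm]
    congr!

end DivisorCorrelation

/-! ### The sieve estimate for affine forms in general position. -/

section SieveAverage

variable {F : Type*} [Field F] [Fintype F]

/-- The radius `1 + 1 / w` is close enough to `1` that its powers stay below `3` for all primes
dividing `W`. -/
theorem one_add_one_div_pow_le_three {w m : ℕ} (hm : m ≤ w) :
    (1 + 1 / (w : ℝ)) ^ m ≤ 3 := by
  rcases Nat.eq_zero_or_pos w with rfl | hw
  · obtain rfl : m = 0 := by omega
    norm_num
  have hw' : (0 : ℝ) < w := by exact_mod_cast hw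
  have h1 : 1 + 1 / (w : ℝ) ≤ Real.exp (1 / w) := by
    linarith [Real.add_one_le_exp (1 / (w : ℝ))]
  calc (1 + 1 / (w : ℝ)) ^ m ≤ (1 + 1 / (w : ℝ)) ^ w :=
        pow_le_pow_right₀ (by linarith [one_div_pos.2 hw']) hm
    _ ≤ Real.exp (1 / w) ^ w := by gcongr
    _ = Real.exp 1 := by rw [← Real.exp_nat_mul]; congr 1; field_simp
    _ ≤ 3 := by linarith [Real.exp_one_lt_d9]

theorem invNorm_mul_pow_le {p : F[X]} {x : ℝ} (hx : 0 ≤ x) (hx' : x ≤ 3 / 2) :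
    invNorm p * x ^ p.natDegree ≤ (3 / 4 : ℝ) ^ p.natDegree := by
  have hq : (2 : ℝ) ≤ Fintype.card F := by exact_mod_cast two_le_card
  rw [invNorm, ← inv_pow, ← mul_pow]
  have : (Fintype.card F : ℝ)⁻¹ ≤ 2⁻¹ := inv_anti₀ (by norm_num) hq
  refine pow_le_pow_left₀ (by positivity) ?_ _
  nlinarith

open Classical in
-- Here `abstract_sieve` is applied with the primes dividing `W` as `S`. Counting monics gives `∑
-- 1/|p| ≤ w` over `S`. Since `σ ^ (4 T + 4) ≤ 3 / 2` and `q ≥ 2`, the quadratic error over the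
-- other primes is at most the geometric tail `∑ (3/4) ^ m ≤ 4 (3/4) ^ w` over `m ≥ w`.
theorem abs_mean_prod_divisorSum_sq_sub_one_le {κ J : Type*} [Fintype κ] [Fintype J] {M : ℝ}
    (hM1 : 1 ≤ M) (hM2 : cutoffEnergy ≤ M)
    (hM : ∀ (r : ℝ) (n : ℕ), 1 ≤ r → r ≤ n → ∀ a b : ℕ,
      |r * corr n (diffSeq fun k : ℕ => cutoff (k / r)) a b| ≤ M ∧
      |r * corr n (diffSeq fun k : ℕ => cutoff (k / r)) a b - cutoffEnergy| ≤ M * (1 + a + b) / r)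
    {r : ℝ} {n w N : ℕ} (hr : 1 ≤ r) (hrn : r ≤ n) (hw : 2 ≤ w) (hwn : w ≤ n)
    (hσ : (1 + 1 / (w : ℝ)) ^ (4 * Fintype.card J + 4) ≤ 3 / 2)
    (hloc : localConst (Fintype.card J) * (3 / 4 : ℝ) ^ w ≤ 1)
    {coef : J → κ → F[X]} {a : J → F[X]}
    (ha : ∀ t, IsCoprime (primeProduct F w) (a t))
    (hgen : ∀ p, IsPrimePoly p → w ≤ p.natDegree → GeneralPosition coef a p)
    (hN : 2 * Fintype.card J * r ≤ N) :
    |(r * (polyTotient (primeProduct F w) / polyNorm (primeProduct F w)) / cutoffEnergy)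
        ^ Fintype.card J *
      mean (fun v : κ → degreeLT F N => ∏ t, divisorSum cutoff r
        (primeProduct F w * ∑ k, coef t k * (v k : F[X]) + a t) ^ 2) - 1|
      ≤ M ^ (Fintype.card J + 1) * (Fintype.card J + w) / r / cutoffEnergy ^ Fintype.card J *
          Real.exp (33 * Fintype.card J * w + localConst' (Fintype.card J) * (4 * (3 / 4) ^ w)) +
        (Real.exp (localConst' (Fintype.card J) * (4 * (3 / 4) ^ w)) - 1) := by
  set T := Fintype.card J with hT
  have hw0 : (0 : ℝ) < w := by positivity
  have hw2 : (2 : ℝ) ≤ w := by exact_mod_cast hw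
  set σ : ℝ := 1 + 1 / (w : ℝ) with hσdef
  have hσ1 : 1 ≤ σ := by rw [hσdef]; linarith [one_div_pos.2 hw0]
  have hσ0 : 0 ≤ σ := by linarith
  have hσ32 : σ ≤ 3 / 2 := (le_self_pow₀ hσ1 (by omega)).trans hσ
  have hσT : σ ^ (2 * T + 2) ≤ 3 / 2 := (pow_le_pow_right₀ hσ1 (by omega)).trans hσ
  have hdisj : Disjoint (primesIn F 0 w) (primesIn F w n) := by
    rw [Finset.disjoint_left]
    intro p h1 h2
    rw [mem_primesIn] at h1 h2
    omega
  have hunion : (primesIn F 0 w).disjUnion (primesIn F w n) hdisj = primesIn F 0 n := by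
    ext p
    simp only [Finset.mem_disjUnion, mem_primesIn]
    constructor
    · rintro (h | h)
      · exact ⟨h.1, by omega, by omega⟩
      · exact ⟨h.1, by omega, by omega⟩
    · intro h
      rcases lt_or_ge p.natDegree w with h' | h'
      · exact Or.inl ⟨h.1, by omega, h'⟩
      · exact Or.inr ⟨h.1, h', h.2.2⟩
  obtain ⟨D, hD⟩ := exists_eulerProd_primesIn_eq (F := F) n
  have hP : ∀ p ∈ primesIn F w n, IsPrimePoly p ∧ w ≤ p.natDegree := fun p hp =>
    ⟨((mem_primesIn).1 hp).1, ((mem_primesIn).1 hp).2.1⟩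
  have hpow : ∀ p ∈ primesIn F w n, (3 / 4 : ℝ) ^ p.natDegree ≤ (3 / 4 : ℝ) ^ w := fun p hp =>
    pow_le_pow_of_le_one (by norm_num) (by norm_num) (hP p hp).2
  have hloc1 : 2 ≤ localConst T := by
    rw [localConst]
    have : (1 : ℝ) ≤ 4 ^ T := one_le_pow₀ (by norm_num)
    have : (0 : ℝ) ≤ T := Nat.cast_nonneg _
    linarith
  have hhalf : (3 / 4 : ℝ) ^ w ≤ 1 / 2 := by
    have : (0 : ℝ) < (3 / 4) ^ w := by positivity
    nlinarith
  have hc := one_le_cutoffEnergy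
  have key := abstract_sieve (J := J) (y := invNorm) (m := natDegree)
    (α := fun p => localProb (primeProduct F w) coef a p) (S := primesIn F 0 w)
    (P := primesIn F w n) hdisj
    (fun p hp => localDensity_localProb (hP p hp).1
      (not_dvd_primeProduct (hP p hp).1 (hP p hp).2) (hgen p (hP p hp).1 (hP p hp).2))
    (fun p _ => (invNorm_pos p).le) (fun p _ => (invNorm_pos p).le) (w := w)
    (η := 4 * (3 / 4) ^ w) (by linarith)
    (fun p hp => by
      refine (invNorm_mul_pow_le hσ0 hσ32).trans ?_
      exact pow_le_of_le_one (by norm_num) (by norm_num)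
        ((mem_primesIn.1 hp).1.natDegree_pos).ne')
    (fun p hp => one_add_one_div_pow_le_three (mem_primesIn.1 hp).2.2.le)
    (by
      refine (sum_primesIn_le (F := F) 0 w (fun m => ((Fintype.card F : ℝ) ^ m)⁻¹)
        (fun m => by positivity)).trans (le_of_eq ?_)
      simp)
    (by rw [← totient_div_norm]; exact totient_div_norm_pos w)
    (by rw [← totient_div_norm]; exact totient_div_norm_le_one w)
    (fun p hp => ((invNorm_mul_pow_le hσ0 hσ32).trans (hpow p hp)).trans hhalf)
    (fun p hp => by
      refine le_trans ?_ hloc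
      refine mul_le_mul_of_nonneg_left ?_ (by linarith)
      rw [← pow_mul, mul_comm, ← mul_comm (invNorm p), mul_comm p.natDegree, pow_mul]
      exact (invNorm_mul_pow_le (by positivity) hσT).trans (hpow p hp))
    (by
      refine (sum_primesIn_le (F := F) w n
        (fun m => (((Fintype.card F : ℝ) ^ m)⁻¹) ^ 2 * ((σ ^ m) ^ (4 * T + 4)))
        (fun m => by positivity)).trans ?_
      refine (Finset.sum_le_sum (g := fun m => (3 / 4 : ℝ) ^ m) fun m _ => ?_).trans
        ((geom_sum_Ico_le_of_lt_one (by norm_num) (by norm_num)).trans (le_of_eq (by ring)))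
      have hq : (2 : ℝ) ≤ Fintype.card F := by exact_mod_cast two_le_card
      have hqm : (Fintype.card F : ℝ) ^ m ≠ 0 := by positivity
      rw [show (Fintype.card F : ℝ) ^ m * ((((Fintype.card F : ℝ) ^ m)⁻¹) ^ 2 *
        ((σ ^ m) ^ (4 * T + 4))) = ((Fintype.card F : ℝ)⁻¹ * σ ^ (4 * T + 4)) ^ m by
          rw [mul_pow, ← pow_mul, ← pow_mul, mul_comm m]; simp only [inv_pow]; field_simp]
      have : (Fintype.card F : ℝ)⁻¹ ≤ 2⁻¹ := inv_anti₀ (by norm_num) hq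
      refine pow_le_pow_left₀ (by positivity) ?_ _
      have : 0 ≤ σ ^ (4 * T + 4) := by positivity
      have : 0 ≤ (Fintype.card F : ℝ)⁻¹ := by positivity
      nlinarith)
    (by rw [hunion]; exact hD) (g := fun k : ℕ => cutoff (k / r))
    (fun k hk => cutoff_eq_zero (by
      rw [le_div_iff₀ (by linarith), one_mul]
      exact hrn.trans (by exact_mod_cast hk)))
    (by linarith : 0 < r) hM1 (by linarith : 0 < cutoffEnergy) hM2
    (fun a b => (hM r n hr hrn a b).1) (fun a b => (hM r n hr hrn a b).2)
  rw [mean_prod_divisorSum_sq (fun t => cutoff_eq_zero) (by linarith) hrn ha hN, totient_div_norm]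
  convert! key using 6

end SieveAverage

/-! ### Smallness of the error terms for large `w`. -/

section Thresholds

open Filter Topology

/-- The growth condition says `log n ≥ exp (w / C)`, which exceeds `(w / C) ^ 2 / 2`, hence any
fixed multiple of `w` once `w` is large. -/
theorem exp_mul_le_of_le_mul_log_log {C L : ℝ} (hC : 0 < C) {w n : ℕ} (hw : 1 ≤ w)
    (hL : 2 * C ^ 2 * L ≤ w) (h : (w : ℝ) ≤ C * Real.log (Real.log n)) :
    Real.exp (L * w) ≤ n := by
  have hw0 : (0 : ℝ) < w := by exact_mod_cast hw
  have h1 : (w : ℝ) / C ≤ Real.log (Real.log n) := by rwa [div_le_iff₀' hC]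
  have hpos : 0 < (w : ℝ) / C := by positivity
  have hlog0 : 0 ≤ Real.log n := Real.log_natCast_nonneg n
  have hlog : 0 < Real.log n := hlog0.lt_of_ne fun h0 => by
    rw [← h0, Real.log_zero] at h1; linarith
  have hn : (0 : ℝ) < n := (Nat.cast_nonneg n).lt_of_ne fun h0 => by
    rw [← h0, Real.log_zero] at hlog; linarith
  rw [Real.le_log_iff_exp_le hlog] at h1
  refine le_trans (Real.exp_le_exp.2 (le_trans ?_ h1)) (Real.exp_log hn).le
  refine le_trans ?_ (Real.quadratic_le_exp_of_nonneg hpos.le)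
  have h2 : L * w ≤ (w / C) ^ 2 / 2 := by
    rw [div_pow, div_div, le_div_iff₀ (by positivity)]
    nlinarith
  linarith

theorem tendsto_sieve_error (A B ρ : ℝ) :
    Tendsto (fun w : ℕ => A / ρ * Real.exp (-(w : ℝ)) +
      (Real.exp (B * (4 * (3 / 4) ^ w)) - 1)) atTop (𝓝 0) := by
  have h1 : Tendsto (fun w : ℕ => Real.exp (-(w : ℝ))) atTop (𝓝 0) :=
    Real.tendsto_exp_neg_atTop_nhds_zero.comp tendsto_natCast_atTop_atTop
  have h2 : Tendsto (fun w : ℕ => (3 / 4 : ℝ) ^ w) atTop (𝓝 0) :=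
    tendsto_pow_atTop_nhds_zero_of_lt_one (by norm_num) (by norm_num)
  have h3 := (h1.const_mul (A / ρ)).add
    (((Real.continuous_exp.tendsto _).comp ((h2.const_mul 4).const_mul B)).sub_const 1)
  simpa using h3

/-- For large `w` the error term in the sieve estimate with `T` forms is small. -/
theorem eventually_sieve_error_le {M c : ℝ} (hM : 1 ≤ M) (hc : 1 ≤ c) {ρ C κ : ℝ} (hρ : 0 < ρ)
    (hC : 0 < C) (hκ : 0 < κ) (T ℓ : ℕ) :
    ∀ᶠ w : ℕ in atTop, ∀ n : ℕ, (w : ℝ) ≤ C * Real.log (Real.log n) →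
      1 ≤ ρ * n ∧ w ≤ n ∧ ℓ ≤ w ∧ 2 ≤ w ∧ (1 + 1 / (w : ℝ)) ^ (4 * T + 4) ≤ 3 / 2 ∧
      localConst T * (3 / 4 : ℝ) ^ w ≤ 1 ∧
      M ^ (T + 1) * (T + w) / (ρ * n) / c ^ T *
          Real.exp (33 * T * w + localConst' T * (4 * (3 / 4) ^ w)) +
        (Real.exp (localConst' T * (4 * (3 / 4) ^ w)) - 1) ≤ κ := by
  have hK : 0 ≤ localConst' T := by rw [localConst', localConst]; positivity
  have h34 : Tendsto (fun w : ℕ => (3 / 4 : ℝ) ^ w) atTop (𝓝 0) :=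
    tendsto_pow_atTop_nhds_zero_of_lt_one (by norm_num) (by norm_num)
  have h1 : ∀ᶠ w : ℕ in atTop, localConst T * (3 / 4 : ℝ) ^ w ≤ 1 := by
    have := h34.const_mul (localConst T)
    rw [mul_zero] at this
    exact this.eventually (eventually_le_nhds (by norm_num))
  have h2 : ∀ᶠ w : ℕ in atTop, (1 + 1 / (w : ℝ)) ^ (4 * T + 4) ≤ 3 / 2 := by
    have := (tendsto_one_div_atTop_nhds_zero_nat (𝕜 := ℝ)).const_add 1 |>.pow (4 * T + 4)
    rw [add_zero, one_pow] at this
    exact this.eventually (eventually_le_nhds (by norm_num))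
  -- The rate `33 T + 2` cancels `exp (33 T w)` and the factor `T + w ≤ exp (T + w)`, leaving a
  -- spare `exp (-w)`.
  have h3 : ∀ᶠ w : ℕ in atTop, 2 * C ^ 2 * (33 * T + 2) ≤ (w : ℝ) :=
    tendsto_natCast_atTop_atTop.eventually_ge_atTop _
  have h4 : ∀ᶠ w : ℕ in atTop, 1 / ρ ≤ (w : ℝ) :=
    tendsto_natCast_atTop_atTop.eventually_ge_atTop _
  have h5 := (tendsto_sieve_error (M ^ (T + 1) * Real.exp T * Real.exp (localConst' T * 4))
    (localConst' T) ρ).eventually (eventually_le_nhds hκ)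
  filter_upwards [h1, h2, h3, h4, h5, eventually_ge_atTop ℓ, eventually_ge_atTop 2]
    with w h1 h2 h3 h4 h5 h6 h7 n hn
  have hw0 : (0 : ℝ) ≤ w := Nat.cast_nonneg _
  have hT0 : (0 : ℝ) ≤ T := Nat.cast_nonneg _
  have hexp := exp_mul_le_of_le_mul_log_log hC (by omega) h3 hn
  have hwn : (w : ℝ) ≤ n := by
    have := Real.add_one_le_exp ((33 * T + 2 : ℝ) * w)
    nlinarith
  have hnpos : (0 : ℝ) < n := (Real.exp_pos _).trans_le hexp
  refine ⟨?_, by exact_mod_cast hwn, h6, h7, h2, h1, le_trans ?_ h5⟩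
  · rw [div_le_iff₀ hρ] at h4
    nlinarith
  refine add_le_add_left ?_ _
  have e1 : (T : ℝ) + w ≤ Real.exp (T + w) := by linarith [Real.add_one_le_exp ((T : ℝ) + w)]
  have e2 : (3 / 4 : ℝ) ^ w ≤ 1 := pow_le_one₀ (by norm_num) (by norm_num)
  have e3 : M ^ (T + 1) * (T + w) / (ρ * n) / c ^ T ≤
      M ^ (T + 1) * Real.exp (T + w) / (ρ * Real.exp ((33 * T + 2) * w)) := by
    refine (div_le_self (by positivity) (one_le_pow₀ hc)).trans ?_
    gcongr
  have e4 : Real.exp (33 * T * w + localConst' T * (4 * (3 / 4) ^ w)) ≤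
      Real.exp (33 * T * w + localConst' T * 4) := by
    gcongr; linarith
  refine (mul_le_mul e3 e4 (by positivity) (by positivity)).trans (le_of_eq ?_)
  have e5 : Real.exp ((33 * T + 2) * w) = Real.exp (33 * T * w) * Real.exp w * Real.exp w := by
    rw [← Real.exp_add, ← Real.exp_add]; congr 1; ring
  rw [e5, Real.exp_add, Real.exp_add, Real.exp_neg]
  field_simp

end Thresholds

/-! ### Reduced representatives modulo `M`. -/

section Rep

variable {F : Type*} [Field F] [Fintype F] {M : F[X]} (hM : M.Monic)

theorem rep_add (x y : AdjoinRoot M) : rep hM (x + y) = rep hM x + rep hM y := map_add _ x y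

theorem rep_mk {f : F[X]} (hf : f.degree < M.degree) : rep hM (AdjoinRoot.mk M f) = f := by
  rw [rep, AdjoinRoot.modByMonicHom_mk, modByMonic_eq_self_iff hM]
  exact hf

end Rep

/-! ### General position and number of the linear forms. -/

section LinearForms

variable {F : Type*} [Field F] [Fintype F]

open Classical in
/-- The coefficients of the form `∑ (i - j) x_{i, e_i}` in the variables `x_{i, s}`. -/
noncomputable def formCoef {S : Finset F[X]} (j : S) (e : {i : S // i ≠ j} → Fin 2)
    (k : S × Fin 2) : F[X] :=
  ∑ i : {i : S // i ≠ j}, if (i.1, e i) = k then (i.1 : F[X]) - (j : F[X]) else 0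

theorem formCoef_apply {S : Finset F[X]} (j : S) (e : {i : S // i ≠ j} → Fin 2)
    (i : {i : S // i ≠ j}) : formCoef j e (i.1, e i) = (i.1 : F[X]) - (j : F[X]) := by
  rw [formCoef, Finset.sum_eq_single i (fun i' _ h => if_neg fun h' => h ?_) (by simp),
    if_pos rfl]
  exact Subtype.ext (congrArg Prod.fst h')

theorem formCoef_of_ne {S : Finset F[X]} (j : S) (e : {i : S // i ≠ j} → Fin 2)
    (i : {i : S // i ≠ j}) {s : Fin 2} (hs : e i ≠ s) : formCoef j e (i.1, s) = 0 := by
  refine Finset.sum_eq_zero fun i' _ => if_neg fun h' => hs ?_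
  obtain rfl : i' = i := Subtype.ext (congrArg Prod.fst h')
  exact congrArg Prod.snd h'

theorem formCoef_self {S : Finset F[X]} (j : S) (e : {i : S // i ≠ j} → Fin 2) (s : Fin 2) :
    formCoef j e (j, s) = 0 :=
  Finset.sum_eq_zero fun i _ => if_neg fun h => i.2 (congrArg Prod.fst h)

open Classical in
theorem sum_formCoef_mul {S : Finset F[X]} (j : S) (e : {i : S // i ≠ j} → Fin 2)
    (v : S × Fin 2 → F[X]) : ∑ k, formCoef j e k * v k
      = ∑ i : {i : S // i ≠ j}, ((i.1 : F[X]) - (j : F[X])) * v (i.1, e i) := by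
  simp only [formCoef, Finset.sum_mul, ite_mul, zero_mul]
  rw [Finset.sum_comm]
  simp

theorem not_dvd_sub_of_degree_lt {p i j : F[X]} {ℓ : ℕ} (hp : ℓ ≤ p.natDegree)
    (hi : i.degree < ℓ) (hj : j.degree < ℓ) (hij : i ≠ j) : ¬ p ∣ i - j := by
  intro h
  have h1 := degree_le_of_dvd h (sub_ne_zero.2 hij)
  have h2 : p ≠ 0 := by
    rintro rfl
    exact sub_ne_zero.2 hij (zero_dvd_iff.1 h)
  rw [degree_eq_natDegree h2] at h1
  have h3 := h1.trans_lt ((degree_sub_le i j).trans_lt (max_lt hi hj))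
  have : p.natDegree < ℓ := by exact_mod_cast h3
  omega

/-- Forms with the same `j` but different `e` use different copies of some variable `x_i`, with
minor `(i - j) ^ 2`. For `j ≠ j'` the variable of `j'` is missing from the form of `j'`, and
conversely, so a minor is `(j' - j)(j - j')`. Identical forms carry different shifts `h, h'`. The
prime cannot divide the differences involved, for degree reasons. -/
theorem generalPosition_formCoef {S H : Finset F[X]} {ℓ w : ℕ} (hS : ∀ i ∈ S, i.degree < ℓ)
    (hS2 : 2 ≤ S.card) (hH : ∀ h ∈ H, h.degree < w)
    {P : (Σ j : S, ({i : S // i ≠ j} → Fin 2)) × H → Prop}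
    (a : (Σ j : S, ({i : S // i ≠ j} → Fin 2)) → F[X]) {p : F[X]} (hp : IsPrimePoly p)
    (hpℓ : ℓ ≤ p.natDegree) (hpw : w ≤ p.natDegree) :
    GeneralPosition (fun t : {t // P t} => formCoef t.1.1.1 t.1.1.2)
      (fun t => a t.1.1 + (t.1.2 : F[X])) p := by
  have hdiff : ∀ i j : S, i ≠ j → ¬ p ∣ (i : F[X]) - (j : F[X]) := fun i j h =>
    not_dvd_sub_of_degree_lt hpℓ (hS i i.2) (hS j j.2) fun h' => h (Subtype.ext h')
  have hprime : Prime p := hp.2.prime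
  constructor
  · rintro ⟨⟨⟨j, e⟩, h⟩, ht⟩
    obtain ⟨i, hi, hij⟩ := S.exists_mem_ne (by omega : 1 < S.card) j
    have hne : (⟨i, hi⟩ : S) ≠ j := fun h => hij (congrArg Subtype.val h)
    refine ⟨(⟨i, hi⟩, e ⟨_, hne⟩), ?_⟩
    rw [formCoef_apply j e ⟨_, hne⟩]
    exact hdiff _ _ hne
  · rintro ⟨⟨⟨j, e⟩, h⟩, ht⟩ ⟨⟨⟨j', e'⟩, h'⟩, ht'⟩ hne
    by_cases hj : j = j'
    · subst hj
      by_cases he : e = e'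
      · subst he
        refine Or.inr ⟨rfl, ?_⟩
        simp only [add_sub_add_left_eq_sub]
        refine not_dvd_sub_of_degree_lt hpw (hH h h.2) (hH h' h'.2) fun hh => hne ?_
        obtain rfl := Subtype.ext hh
        rfl
      · left
        obtain ⟨i, hi⟩ := Function.ne_iff.1 he
        refine ⟨(i.1, e i), (i.1, e' i), ?_⟩
        simp only
        rw [formCoef_apply, formCoef_apply, formCoef_of_ne j e i hi, zero_mul, sub_zero]
        exact hprime.not_dvd_mul (hdiff _ _ i.2) (hdiff _ _ i.2)
    · left
      refine ⟨(j', e ⟨j', Ne.symm hj⟩), (j, e' ⟨j, hj⟩), ?_⟩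
      simp only
      rw [formCoef_apply j e ⟨j', Ne.symm hj⟩, formCoef_apply j' e' ⟨j, hj⟩, formCoef_self,
        zero_mul, sub_zero]
      exact hprime.not_dvd_mul (hdiff _ _ (Ne.symm hj)) (hdiff _ _ hj)

/-- The exponents are `0` or `1`, so they merely select an index set, which absorbs the product over
`H` as well. -/
theorem prod_prod_pow_eq_prod_subtype {S H : Finset F[X]}
    (c : (j : S) → ({i : S // i ≠ j} → Fin 2) → Fin 2)
    [∀ j : S, Fintype ({i : S // i ≠ j} → Fin 2)]
    [Fintype {t : (Σ j : S, ({i : S // i ≠ j} → Fin 2)) × H // c t.1.1 t.1.2 = 1}]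
    (f : (Σ j : S, ({i : S // i ≠ j} → Fin 2)) → F[X] → ℝ) :
    ∏ j : S, ∏ e : {i : S // i ≠ j} → Fin 2, (∏ h ∈ H, f ⟨j, e⟩ h) ^ (c j e : ℕ)
      = ∏ t : {t : (Σ j : S, ({i : S // i ≠ j} → Fin 2)) × H // c t.1.1 t.1.2 = 1},
          f t.1.1 t.1.2 := by
  classical
  rw [← Finset.prod_subtype (Finset.univ.filter fun t : (Σ j : S, ({i : S // i ≠ j} → Fin 2)) × H
      => c t.1.1 t.1.2 = 1) (by simp) fun t => f t.1 t.2,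
    Finset.prod_filter, Fintype.prod_prod_type, Fintype.prod_sigma]
  refine Finset.prod_congr rfl fun j _ => Finset.prod_congr rfl fun e _ => ?_
  rw [← Finset.prod_coe_sort]
  have hc : c j e = 0 ∨ c j e = 1 := by omega
  rcases hc with hc | hc <;> simp [hc]

/-- The bound is independent of `S` and of the exponents, which gives the uniformity in the linear
forms conditions. -/
theorem card_subtype_forms_le {S H : Finset F[X]} {ℓ : ℕ} (hS : ∀ i ∈ S, i.degree < ℓ)
    {P : (Σ j : S, ({i : S // i ≠ j} → Fin 2)) × H → Prop} :
    Nat.card {t // P t} ≤ Fintype.card F ^ ℓ * 2 ^ Fintype.card F ^ ℓ * H.card := by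
  classical
  have hs : S.card ≤ Fintype.card F ^ ℓ := by
    have := finite_degreeLT (F := F) ℓ
    have h1 : Nat.card S ≤ Nat.card (degreeLT F ℓ) :=
      Nat.card_le_card_of_injective (fun i : S => ⟨i.1, mem_degreeLT.2 (hS i i.2)⟩)
        fun i j h => Subtype.ext (Subtype.mk.inj h)
    rwa [card_degreeLT, Nat.card_eq_fintype_card, Fintype.card_coe] at h1
  refine (Finite.card_subtype_le _).trans ?_
  rw [Nat.card_eq_fintype_card, Fintype.card_prod, Fintype.card_sigma, Fintype.card_coe]
  refine Nat.mul_le_mul_right _ ?_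
  refine (Finset.sum_le_sum (g := fun _ => 2 ^ S.card) fun j _ => ?_).trans ?_
  · rw [Fintype.card_fun, Fintype.card_fin]
    refine Nat.pow_le_pow_right (by norm_num) ?_
    exact (Fintype.card_subtype_le _).trans (Fintype.card_coe S).le
  · rw [Finset.sum_const, Finset.card_univ, Fintype.card_coe, smul_eq_mul]
    exact Nat.mul_le_mul hs (Nat.pow_le_pow_right (by norm_num) hs)

end LinearForms

/-! ### The linear forms conditions for the measure. -/

section Pseudorandomness

variable {F : Type*} [Field F] [Fintype F]

open Classical in
-- A coefficient of degree below `ℓ` times a translate of degree below `N` has degree below `deg M`,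
-- so passing to representatives involves no reduction and the form is genuinely affine in `v`.
theorem rep_sum_mk_mul_add {M : F[X]} (hM : M.Monic) {S : Finset F[X]} {ℓ N : ℕ}
    (hS : ∀ i ∈ S, i.degree < ℓ) (hN : ℓ + N ≤ M.natDegree)
    (x : S → Fin 2 → AdjoinRoot M) (v : S × Fin 2 → degreeLT F N) (j : S)
    (e : {i : S // i ≠ j} → Fin 2) :
    rep hM (∑ i : {i : S // i ≠ j}, AdjoinRoot.mk M ((i.1 : F[X]) - (j : F[X])) *
        (x + fun i s => AdjoinRoot.mk M (v (i, s) : F[X])) i.1 (e i))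
      = ∑ k, formCoef j e k * (v k : F[X]) + rep hM (∑ i : {i : S // i ≠ j},
          AdjoinRoot.mk M ((i.1 : F[X]) - (j : F[X])) * x i.1 (e i)) := by
  simp only [Pi.add_apply, mul_add, Finset.sum_add_distrib]
  rw [rep_add, add_comm, sum_formCoef_mul]
  congr 1
  simp only [← map_mul, ← map_sum]
  refine rep_mk hM (lt_of_le_of_lt (degree_sum_le _ _) ((Finset.sup_lt_iff ?_).2 fun i _ => ?_))
  · exact bot_lt_iff_ne_bot.2 fun h => hM.ne_zero (degree_eq_bot.1 h)
  by_cases hv : (v (i.1, e i) : F[X]) = 0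
  · rw [hv, mul_zero, degree_zero]
    exact bot_lt_iff_ne_bot.2 fun h => hM.ne_zero (degree_eq_bot.1 h)
  have h0 : (i.1 : F[X]) - (j : F[X]) ≠ 0 := sub_ne_zero.2 fun h => i.2 (Subtype.ext h)
  have h1 : ((i.1 : F[X]) - (j : F[X])).degree < ℓ :=
    (degree_sub_le _ _).trans_lt (max_lt (hS _ i.1.2) (hS _ j.2))
  have h2 := mem_degreeLT.1 (v (i.1, e i)).2
  rw [← natDegree_lt_iff_degree_lt h0] at h1
  rw [← natDegree_lt_iff_degree_lt hv] at h2
  rw [degree_eq_natDegree (mul_ne_zero h0 hv), degree_eq_natDegree hM.ne_zero,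
    natDegree_mul h0 hv]
  exact_mod_cast (by omega :
    ((i.1 : F[X]) - (j : F[X])).natDegree + (v (i.1, e i) : F[X]).natDegree < M.natDegree)

theorem gyFactor_eq {M : F[X]} (hM : M.Monic) (r : ℝ) (w : ℕ) (b h : F[X]) (x : AdjoinRoot M) :
    gyFactor hM cutoff r w b h x =
      r * (polyTotient (primeProduct F w) / polyNorm (primeProduct F w)) / cutoffEnergy *
        divisorSum cutoff r (primeProduct F w * rep hM x + b + h) ^ 2 := by
  rw [gyFactor, cutoffEnergy]
  congr 1
  ring

theorem abs_linearFormsMean_sub_one_le {B : ℝ} (hB1 : 1 ≤ B) (hB2 : cutoffEnergy ≤ B)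
    (hB : ∀ (r : ℝ) (n : ℕ), 1 ≤ r → r ≤ n → ∀ a b : ℕ,
      |r * corr n (diffSeq fun k : ℕ => cutoff (k / r)) a b| ≤ B ∧
      |r * corr n (diffSeq fun k : ℕ => cutoff (k / r)) a b - cutoffEnergy| ≤ B * (1 + a + b) / r)
    {H : Finset F[X]} {ℓ w n T₀ : ℕ} {ρ κ : ℝ} (hρ1 : ρ ≤ 1)
    (hT₀ : Fintype.card F ^ ℓ * 2 ^ Fintype.card F ^ ℓ * H.card ≤ T₀)
    (hρT : 4 * T₀ * ρ ≤ 1)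
    (hr : 1 ≤ ρ * n) (hwn : w ≤ n) (hw : 2 ≤ w) (hℓ : 2 * ℓ ≤ w)
    (hnum : ∀ T ≤ T₀, (1 + 1 / (w : ℝ)) ^ (4 * T + 4) ≤ 3 / 2 ∧
      localConst T * (3 / 4 : ℝ) ^ w ≤ 1 ∧
      B ^ (T + 1) * (T + w) / (ρ * n) / cutoffEnergy ^ T *
          Real.exp (33 * T * w + localConst' T * (4 * (3 / 4) ^ w)) +
        (Real.exp (localConst' T * (4 * (3 / 4) ^ w)) - 1) ≤ κ)
    {M b : F[X]} (hM : M.Monic) (hMn : M.natDegree = n) (hHw : ∀ h ∈ H, h.natDegree < w)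
    (hcop : ∀ h ∈ H, IsCoprime (primeProduct F w) (b + h))
    {S : Finset F[X]} (hS : ∀ i ∈ S, i.degree < ℓ) (hS2 : 2 ≤ S.card)
    (c : (j : S) → ({i : S // i ≠ j} → Fin 2) → Fin 2) :
    |linearFormsMean (gyMeasure hM cutoff (ρ * n) w b H) S c - 1| ≤ κ := by
  classical
  have := finite_adjoinRoot hM
  have := finite_degreeLT (F := F) (n - ℓ)
  let J := {t : (Σ j : S, ({i : S // i ≠ j} → Fin 2)) × H // c t.1.1 t.1.2 = 1}
  have hJ : Fintype.card J ≤ T₀ := by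
    rw [← Nat.card_eq_fintype_card]
    exact (card_subtype_forms_le hS).trans hT₀
  obtain ⟨hσ, hloc, herr⟩ := hnum _ hJ
  rw [linearFormsMean]
  -- Fix `x` and average over translates by polynomials of degree less than `n - ℓ`; the reduced
  -- form values at `x` become constant terms.
  refine abs_mean_sub_le_of_translates (V := S × Fin 2 → degreeLT F (n - ℓ))
    (fun v i s => AdjoinRoot.mk M (v (i, s) : F[X])) _ fun x => le_trans ?_ herr
  let z : (Σ j : S, ({i : S // i ≠ j} → Fin 2)) → F[X] := fun t =>
    rep hM (∑ i : {i : S // i ≠ t.1}, AdjoinRoot.mk M ((i.1 : F[X]) - (t.1 : F[X])) * x i.1 (t.2 i))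
  let a : (Σ j : S, ({i : S // i ≠ j} → Fin 2)) → F[X] := fun t => primeProduct F w * z t + b
  have hr0 : 0 < ρ * n := by linarith
  have hn0 : (0 : ℝ) ≤ n := Nat.cast_nonneg n
  have key := abs_mean_prod_divisorSum_sq_sub_one_le (F := F) (κ := S × Fin 2) (J := J)
    hB1 hB2 hB hr (by nlinarith : ρ * n ≤ n) hw hwn hσ hloc
    (coef := fun t => formCoef t.1.1.1 t.1.1.2) (a := fun t => a t.1.1 + (t.1.2 : F[X]))
    (fun t => by
      have : a t.1.1 + (t.1.2 : F[X]) = b + t.1.2 + primeProduct F w * z t.1.1 := by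
        simp only [a]; ring
      rw [this]
      exact (hcop _ t.1.2.2).add_mul_left_right _)
    (fun p hp hpw => generalPosition_formCoef hS hS2
      (fun h hh => degree_le_natDegree.trans_lt (by exact_mod_cast hHw h hh)) a hp (by omega) hpw)
    -- The degree budget: `2 T ρ n ≤ n / 2` by `hρT`, and `n / 2 ≤ n - ℓ` because `2 ℓ ≤ w ≤ n`.
    (N := n - ℓ) (by
      have h1 : (Fintype.card J : ℝ) ≤ T₀ := by exact_mod_cast hJ
      rw [Nat.cast_sub (by omega)]
      have h2 : (2 * ℓ : ℝ) ≤ n := by exact_mod_cast hℓ.trans hwn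
      have h3 : Fintype.card J * (ρ * n) ≤ T₀ * (ρ * n) := by gcongr
      nlinarith)
  refine le_trans (le_of_eq ?_) key
  rw [← mean_const_mul]
  congr 3
  ext v
  rw [← Finset.card_univ, ← Finset.prod_const, ← Finset.prod_mul_distrib]
  refine Eq.trans ?_ (prod_prod_pow_eq_prod_subtype (H := H) c fun t h => gyFactor hM cutoff (ρ * n) w b h
    (∑ i : {i : S // i ≠ t.1}, AdjoinRoot.mk M ((i.1 : F[X]) - (t.1 : F[X])) *
        (x + fun i s => AdjoinRoot.mk M (v (i, s) : F[X])) i.1 (t.2 i))) |>.trans ?_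
  · rfl
  refine Finset.prod_congr rfl fun t _ => ?_
  rw [gyFactor_eq, rep_sum_mk_mul_add hM hS (by omega)]
  congr 3
  simp only [a, z]
  ring

theorem gyMeasure_nonneg {M : F[X]} (hM : M.Monic) {r : ℝ} (hr : 0 ≤ r) (w : ℕ) (b : F[X])
    (H : Finset F[X]) (x : AdjoinRoot M) : 0 ≤ gyMeasure hM cutoff r w b H x := by
  refine Finset.prod_nonneg fun h _ => ?_
  have := one_le_cutoffEnergy
  have := (totient_div_norm_pos (F := F) w).le
  rw [gyFactor_eq]
  positivity

open Filter in
theorem pseudorandomUpTo_gyMeasure (H : Finset F[X]) (ℓ : ℕ) {T₀ : ℕ} {ρ : ℝ} (hρ : 0 < ρ)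
    (hρ1 : ρ ≤ 1) (hT₀ : Fintype.card F ^ ℓ * 2 ^ Fintype.card F ^ ℓ * H.card ≤ T₀)
    (hρT : 4 * T₀ * ρ ≤ 1) {C κ : ℝ} (hC : 0 < C) (hκ : 0 < κ) :
    ∃ w₀ : ℕ, ∀ (w n : ℕ) (M b : F[X]) (hs : Setup H C w n M b), w₀ ≤ w →
      PseudorandomUpTo ℓ κ (gyMeasure hs.monic cutoff (ρ * n) w b H) := by
  obtain ⟨B, hB1, hB2, hB⟩ := exists_corr_cutoff_bound
  -- Only the finitely many values `T ≤ T₀` occur, so one threshold serves all `S` and all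
  -- exponents.
  have hev := (eventually_all_finset (Finset.range (T₀ + 1))).2 fun T _ =>
    eventually_sieve_error_le hB1 one_le_cutoffEnergy hρ hC hκ T (2 * ℓ)
  obtain ⟨w₀, hw₀⟩ := eventually_atTop.1 hev
  refine ⟨w₀, fun w n M b hs hw => ⟨gyMeasure_nonneg hs.monic (by positivity) w b H,
    fun S hS hS2 c => ?_⟩⟩
  have h := fun T (hT : T ≤ T₀) => hw₀ w hw T (Finset.mem_range.2 (by omega)) n hs.growth
  obtain ⟨h1, h2, h3, h4, -⟩ := h 0 (Nat.zero_le _)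
  exact abs_linearFormsMean_sub_one_le hB1 hB2 hB hρ1 hT₀ hρT h1 h2 h4 h3
    (fun T hT => (h T hT).2.2.2.2) hs.monic hs.natDegree_eq hs.natDegree_lt hs.coprime hS hS2 c

end Pseudorandomness

/-! ### The minorant supported on almost-prime translates. -/

section AlmostPrimes

variable {F : Type*} [Field F] [Fintype F]

/-- A divisor `d ≠ 1` has a prime factor of degree at least `r`, where `G` vanishes; only `d = 1`
survives. -/
theorem divisorSum_eq_one {G : ℝ → ℝ} (hG : ∀ t, 1 ≤ t → G t = 0) (hG0 : G 0 = 1) {r : ℝ}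
    (hr : 0 < r) {f : F[X]} (hf : ∀ p, IsPrimePoly p → p ∣ f → r ≤ p.natDegree) :
    divisorSum G r f = 1 := by
  have h1 : polyMoebius (1 : F[X]) = 1 := by
    simpa using polyMoebius_prod (F := F) (D := ∅) (by simp)
  rw [divisorSum, finsum_mem_inter_support_eq _ _ {1}, finsum_mem_singleton, h1, natDegree_one]
  · simp [hG0]
  ext d
  simp only [Set.mem_inter_iff, Set.mem_ofPred_eq, Set.mem_singleton_iff, Function.mem_support]
  refine ⟨fun ⟨⟨hd, hdf⟩, hne⟩ => ⟨?_, hne⟩, fun ⟨hd, hne⟩ => ⟨?_, hne⟩⟩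
  · by_contra h
    obtain ⟨p, hp, hpd⟩ := exists_isPrimePoly_dvd hd.ne_zero fun hu => h (hd.eq_one_of_isUnit hu)
    refine hne ?_
    rw [hG _ ?_, mul_zero]
    rw [le_div_iff₀ hr, one_mul]
    refine (hf p hp (hpd.trans hdf)).trans ?_
    exact_mod_cast natDegree_le_of_dvd hpd hd.ne_zero
  · subst hd
    exact ⟨monic_one, one_dvd _⟩

theorem gyMeasure_eq_pow {M : F[X]} (hM : M.Monic) {H : Finset F[X]} {ε ρ : ℝ} {n w : ℕ}
    (hr : 0 < ρ * n) (hρ : ρ ≤ ε) {b : F[X]} {x : AdjoinRoot M}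
    (hx : primeProduct F w * rep hM x + b ∈ almostPrimeTranslates H ε n) :
    gyMeasure hM cutoff (ρ * n) w b H x = (ρ * n *
      (polyTotient (primeProduct F w) / polyNorm (primeProduct F w)) / cutoffEnergy) ^ H.card := by
  rw [gyMeasure, ← Finset.prod_const]
  refine Finset.prod_congr rfl fun h hh => ?_
  rw [gyFactor_eq, divisorSum_eq_one (fun t => cutoff_eq_zero) (cutoff_eq_one le_rfl) hr, one_pow,
    mul_one]
  intro p hp hpf
  refine le_trans ?_ (hx p hp (hpf.trans (Finset.dvd_prod_of_mem _ hh)))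
  gcongr

open Classical in
-- Each `f ∈ A` is `W g + b` with `deg g < deg M`, because `W` is nonconstant and `deg b < deg W`;
-- thus `g` represents a class hitting `f`.
theorem card_le_card_filter_rep {M : F[X]} (hM : M.Monic) [Fintype (AdjoinRoot M)] {W b : F[X]}
    (hW : 0 < W.natDegree) (hb : b.degree < W.degree) {A : Finset F[X]}
    (hA : ∀ f ∈ A, f.natDegree = M.natDegree ∧ W ∣ f - b) :
    A.card ≤ (Finset.univ.filter fun x : AdjoinRoot M => W * rep hM x + b ∈ A).card := by
  have hM0 : M.degree = M.natDegree := degree_eq_natDegree hM.ne_zero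
  have hW0 : W ≠ 0 := by
    rintro rfl
    simp at hW
  have hex : ∀ f ∈ A, ∃ x : AdjoinRoot M, W * rep hM x + b = f := by
    intro f hf
    obtain ⟨hn, g, hg⟩ := hA f hf
    refine ⟨AdjoinRoot.mk M g, ?_⟩
    rw [rep_mk hM, ← hg, sub_add_cancel]
    by_cases hg0 : g = 0
    · rw [hg0, degree_zero, hM0]
      exact WithBot.bot_lt_coe _
    have h1 := congrArg natDegree hg
    rw [natDegree_mul hW0 hg0] at h1
    have h2 := natDegree_sub_le f b
    have h3 : b.natDegree < W.natDegree := by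
      rcases eq_or_ne b 0 with rfl | hb0
      · simpa using hW
      · exact natDegree_lt_natDegree hb0 hb
    rw [degree_eq_natDegree hg0, hM0]
    have : g.natDegree < M.natDegree := by omega
    exact_mod_cast this
  choose s hs using hex
  refine Finset.card_le_card_of_injOn (fun f => if hf : f ∈ A then s f hf else 0) ?_ ?_
  · intro f hf
    have hf' : f ∈ A := hf
    simp [hf', hs]
  · intro f hf g hg h
    have hf' : f ∈ A := hf
    have hg' : g ∈ A := hg
    simp only [hf', hg', dite_true] at h
    rw [← hs f hf', ← hs g hg', h]

/-- The powers of `n` and of the totient cancel, leaving one factor `1 / N`. The integer exponent `k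
- 1` keeps this true for `k = 0`. -/
theorem le_mul_of_card_bound {k : ℕ} {a N φ ρ c Q A n : ℝ} (hN : 0 < N) (hφ : 0 < φ)
    (hc : 0 < c) (hQ : 0 < Q) (hn : 0 < n) (hρ : 0 < ρ)
    (hA : a * (N ^ ((k : ℤ) - 1) / φ ^ k) * (Q / n ^ k) ≤ A) :
    (ρ / c) ^ k * a / N ≤ A * (ρ * n * (φ / N) / c) ^ k / Q := by
  rw [le_div_iff₀ hQ]
  refine le_trans (le_of_eq ?_) (mul_le_mul_of_nonneg_right hA (by positivity))
  rw [zpow_sub_one₀ hN.ne', zpow_natCast]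
  simp only [div_pow, mul_pow]
  field_simp

/-- The measure is restricted to the classes landing in `A`, where it equals the constant `(ρ n
(φ(W)/|W|) / c_G) ^ k`. This is at most `n ^ k`, since `ρ ≤ 1`, `φ(W) ≤ |W|` and `c_G ≥ 1`. -/
theorem exists_le_gyMeasure {H : Finset F[X]} {ε ρ : ℝ} (hρ : 0 < ρ) (hρ1 : ρ ≤ 1)
    (hρε : ρ ≤ ε) {C : ℝ} {w n : ℕ} {M b : F[X]} (hs : Setup H C w n M b)
    {a : ℝ} {A : Finset F[X]}
    (hA : ∀ f ∈ A, f ∈ almostPrimeTranslates H ε n ∧ f ∈ monicDeg F n ∧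
      primeProduct F w ∣ f - b)
    (hcard : a * (polyNorm (primeProduct F w) ^ ((H.card : ℤ) - 1)
        / (polyTotient (primeProduct F w) : ℝ) ^ H.card)
      * ((monicDeg F n).ncard / (n : ℝ) ^ H.card) ≤ A.card) :
    ∃ φ : AdjoinRoot M → ℝ,
      (∀ x, 0 ≤ φ x) ∧
      (∀ x, φ x ≠ 0 → primeProduct F w * rep hs.monic x + b ∈ A) ∧
      (∀ x, φ x ≤ gyMeasure hs.monic cutoff (ρ * n) w b H x) ∧
      (ρ / cutoffEnergy) ^ H.card * a / polyNorm (primeProduct F w) ≤ mean φ ∧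
      (∀ x, φ x ≤ (n : ℝ) ^ H.card) := by
  classical
  have := finite_adjoinRoot hs.monic
  have := Fintype.ofFinite (AdjoinRoot M)
  have hn : 0 < (n : ℝ) := by
    rw [← hs.natDegree_eq]
    exact_mod_cast hs.irreducible.natDegree_pos
  have hr : 0 < ρ * n := by positivity
  have hc := one_le_cutoffEnergy
  have hφ := totient_div_norm_pos (F := F) w
  have hφ1 := totient_div_norm_le_one (F := F) w
  have hN := polyNorm_pos (primeProduct F w)
  have hφ0 : 0 < (polyTotient (primeProduct F w) : ℝ) := by
    have := mul_pos hφ hN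
    rwa [div_mul_cancel₀ _ hN.ne'] at this
  have hν := gyMeasure_nonneg hs.monic hr.le w b H
  have hval : ∀ x, primeProduct F w * rep hs.monic x + b ∈ A →
      gyMeasure hs.monic cutoff (ρ * n) w b H x = (ρ * n *
      (polyTotient (primeProduct F w) / polyNorm (primeProduct F w)) / cutoffEnergy) ^ H.card :=
    fun x hx => gyMeasure_eq_pow hs.monic hr hρε (hA _ hx).1
  refine ⟨fun x => if primeProduct F w * rep hs.monic x + b ∈ A then
    gyMeasure hs.monic cutoff (ρ * n) w b H x else 0, fun x => ?_, fun x hx => ?_, fun x => ?_, ?_,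
    fun x => ?_⟩
  · simp only
    split_ifs
    exacts [hν x, le_rfl]
  · by_contra h
    exact hx (if_neg h)
  · simp only
    split_ifs
    exacts [le_rfl, hν x]
  · have hsum : (∑ x, if primeProduct F w * rep hs.monic x + b ∈ A then
        gyMeasure hs.monic cutoff (ρ * n) w b H x else 0)
        = ((Finset.univ.filter fun x : AdjoinRoot M =>
          primeProduct F w * rep hs.monic x + b ∈ A).card : ℝ) * (ρ * n *
          (polyTotient (primeProduct F w) / polyNorm (primeProduct F w)) / cutoffEnergy)
            ^ H.card := by
      rw [← Finset.sum_filter, Finset.sum_congr rfl fun x hx => hval x (Finset.mem_filter.1 hx).2,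
        Finset.sum_const, nsmul_eq_mul]
    have hAle := card_le_card_filter_rep hs.monic (natDegree_primeProduct_pos hs.two_le)
      hs.reduced (A := A) fun f hf => ⟨(hA f hf).2.1.2.trans hs.natDegree_eq.symm, (hA f hf).2.2⟩
    rw [mean_eq, hsum, ← Nat.card_eq_fintype_card, card_adjoinRoot hs.monic, hs.natDegree_eq,
      ← ncard_monicDeg]
    refine le_mul_of_card_bound hN hφ0 (by linarith) ?_ hn hρ (hcard.trans (by exact_mod_cast hAle))
    rw [ncard_monicDeg]
    exact_mod_cast pow_pos Fintype.card_pos n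
  · simp only
    split_ifs with hx
    · rw [hval x hx]
      refine pow_le_pow_left₀ (by positivity) ?_ _
      rw [div_le_iff₀ (by linarith)]
      have h1 : ρ * n * (polyTotient (primeProduct F w) / polyNorm (primeProduct F w)) ≤ n := by
        have h2 : ρ * n ≤ n := mul_le_of_le_one_left hn.le hρ1
        exact (mul_le_of_le_one_right hr.le hφ1).trans h2
      nlinarith
    · positivity

end AlmostPrimes

/-! ### Choice of the parameters and conclusion. -/

theorem mainTheorem6 {F : Type*} [Field F] [Fintype F] (H : Finset F[X]) (hH : Admissible H)
    (ε : ℝ) (hε : 0 < ε) (ℓ : ℕ) (hℓ : 1 ≤ ℓ) :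
    ∃ (G : ℝ → ℝ) (ρ c₀ : ℝ),
      ContDiff ℝ ∞ G ∧ (∀ t, 1 ≤ t → G t = 0) ∧ G 0 = 1 ∧ 0 < ρ ∧ ρ < 1 ∧ 0 < c₀ ∧
      ∀ C : ℝ, 0 < C →
        (∀ κ : ℝ, 0 < κ → ∃ w₀ : ℕ, ∀ (w n : ℕ) (M b : F[X]) (hs : Setup H C w n M b), w₀ ≤ w →
          PseudorandomUpTo ℓ κ (gyMeasure hs.monic G (ρ * n) w b H)) ∧
        (∀ (w n : ℕ) (M b : F[X]) (hs : Setup H C w n M b) (a : ℝ) (A : Finset F[X]),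
          0 < a → a < 1 →
          (∀ f ∈ A, f ∈ almostPrimeTranslates H ε n ∧ f ∈ monicDeg F n ∧ primeProduct F w ∣ f - b) →
          a * (polyNorm (primeProduct F w) ^ ((H.card : ℤ) - 1)
              / (polyTotient (primeProduct F w) : ℝ) ^ H.card)
            * ((monicDeg F n).ncard / (n : ℝ) ^ H.card) ≤ A.card →
          ∃ φ : AdjoinRoot M → ℝ,
            (∀ x, 0 ≤ φ x) ∧
            (∀ x, φ x ≠ 0 → primeProduct F w * rep hs.monic x + b ∈ A) ∧
            (∀ x, φ x ≤ gyMeasure hs.monic G (ρ * n) w b H x) ∧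
            c₀ * a / polyNorm (primeProduct F w) ≤ mean φ ∧
            (∀ x, φ x ≤ (n : ℝ) ^ H.card)) := by
  -- An upper bound for the number of forms that any set `S` can produce, counted with the shifts in
  -- `H`.
  set T₀ := Fintype.card F ^ ℓ * 2 ^ Fintype.card F ^ ℓ * H.card with hT₀
  have hT : (0 : ℝ) ≤ T₀ := Nat.cast_nonneg _
  -- `ρ ≤ ε` makes the divisor sums equal to `1` on almost primes, and `4 T₀ ρ ≤ 1` is the degree
  -- budget. The extra `4` ensures `ρ < 1`, also when `T₀ = 0`.
  set ρ := min ε (1 / (4 * T₀ + 4)) with hρdef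
  have hρ : 0 < ρ := lt_min hε (by positivity)
  have hρ2 : ρ ≤ 1 / (4 * T₀ + 4) := min_le_right _ _
  have hρT : ρ * (4 * T₀ + 4) ≤ 1 := by rwa [le_div_iff₀ (by positivity)] at hρ2
  have hρ1 : ρ < 1 := by nlinarith
  have hc := one_le_cutoffEnergy
  refine ⟨cutoff, ρ, (ρ / cutoffEnergy) ^ H.card, contDiff_cutoff, fun t => cutoff_eq_zero,
    cutoff_eq_one le_rfl, hρ, hρ1, by positivity, fun C hC => ⟨fun κ hκ => ?_, ?_⟩⟩
  · exact pseudorandomUpTo_gyMeasure H ℓ hρ hρ1.le hT₀.ge (by nlinarith) hC hκ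
  · intro w n M b hs a A _ _ hA hcard
    exact exists_le_gyMeasure hρ hρ1.le (min_le_left _ _) hs hA hcard
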